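/- For $n\in\mathbb Z_{\ge 0}$ let $\Lambda_n=[-n,n]^2\cap\mathbb Z^2$, and let $\vec E_n$ be the set of directed nearest-neighbour edges of $\Lambda_n$. For $\beta\in[0,\infty)$ let $\mathbf n:\vec E_n\to\mathbb Z_{\ge0}$ be a random current with law proportional to $\prod_{xy\in\vec E_n}\frac{(\beta/2)^{\mathbf n_{xy}}}{\mathbf n_{xy}!}$, conditioned on $\partial\mathbf n=0$, where $\partial\mathbf n(x)=\sum_{y\sim x}(\mathbf n_{xy}-\mathbf n_{yx})$; write $\mathbb E_{n,\beta}$ for its expectation. Index the faces of $\mathbb Z^2$ by their lower-left corners. The height function $h:\mathbb Z^2\to\mathbb Z$ is the unique function with $h(a)=0$ for $a\notin[-n,n)^2$ and $h(a)-h(b)=\mathbf n_{xy}-\mathbf n_{yx}$ whenever $xy\in\vec E_n$ has the face $a$ on its right and the face $b$ on its left. For $a,b\in\mathbb Z^2$ set \[ \operatorname{Cov}_{n,\beta}[a;b]=\mathbb E_{n,\beta}[h(a)h(b)],\qquad \operatorname{SigCov}_{n,\beta}[a;b]=\mathbb E_{n,\beta}[\operatorname{Sign}(h(a))\operatorname{Sign}(h(b))],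 \] with $\operatorname{Sign}(z)\in\{-1,0,1\}$. \textbf{Lemma.} Let $\beta\in[0,\infty)$. For all $a,b\in\mathbb Z^2$ the limits $\operatorname{Cov}_{\infty,\beta}[a;b]=\lim_{n\to\infty}\operatorname{Cov}_{n,\beta}[a;b]$ and $\operatorname{SigCov}_{\infty,\beta}[a;b]=\lim_{n\to\infty}\operatorname{SigCov}_{n,\beta}[a;b]$ exist in $[0,\infty]$. Moreover, the mass of the height function, \[ \mathfrak m_{\operatorname{Height}}(\beta):=\liminf_{k\to\infty}-\frac1k\log\bigl(\operatorname{Cov}_{\infty,\beta}[(0,0);(0,k)]\wedge1\bigr), \] satisfies, as an identity of extended real numbers (with $\log 0=-\infty$), \[ \mathfrak m_{\operatorname{Height}}(\beta)=\liminf_{k\to\infty}-\frac1k\log\operatorname{SigCov}_{\infty,\beta}[(0,0);(0,k)]. \] -/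

import Mathlib

open MeasureTheory ProbabilityTheory Filter Topology

namespace XYHeight

/-- Vertices of the square lattice; also used to index its faces, the face `a` being the unit
square whose lower-left corner is the vertex `a`. -/
abbrev V : Type := ℤ × ℤ

/-- The box `[-n, n]² ∩ ℤ²`. -/
noncomputable def box (n : ℕ) : Finset V := Finset.Icc (-(n : ℤ), -(n : ℤ)) ((n : ℤ), (n : ℤ))

/-- The directed nearest-neighbour edges of the box: ordered pairs of vertices of the box
at Euclidean distance one. -/
noncomputable def dirEdges (n : ℕ) : Finset (V × V) :=
  (box n ×ˢ box n).filter fun e => (e.2.1 - e.1.1) ^ 2 + (e.2.2 - e.1.2) ^ 2 = 1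

/-- Currents: functions from the directed edges of the box to the non-negative integers. -/
abbrev Current (n : ℕ) : Type := {e : V × V // e ∈ dirEdges n} → ℕ

/-- The value of the current at the directed edge `xy` (zero if `xy` is not an edge of the box). -/
noncomputable def Current.val {n : ℕ} (c : Current n) (x y : V) : ℕ :=
  if h : (x, y) ∈ dirEdges n then c ⟨(x, y), h⟩ else 0

/-- The net current `c_{xy} - c_{yx}` from `x` to `y`. -/
noncomputable def Current.net {n : ℕ} (c : Current n) (x y : V) : ℤ := (c.val x y : ℤ) - (c.val y x : ℤ)

/-- The source function `∂c (x) = ∑_{y ∼ x} (c_{xy} - c_{yx})`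
(the summand vanishes unless `y ∼ x`). -/
noncomputable def Current.source {n : ℕ} (c : Current n) (x : V) : ℤ := ∑ y ∈ box n, c.net x y

/-- The event `∂c = 0`. -/
def sourceless (n : ℕ) : Set (Current n) := {c | ∀ x ∈ box n, c.source x = 0}

/-- The measure on `ℕ` giving mass `t ^ k / k!` to `k`. -/
noncomputable def poissonWeight (t : ℝ) : Measure ℕ :=
  Measure.count.withDensity fun k => ENNReal.ofReal (t ^ k / (k.factorial : ℝ))

/-- The non-normalised measure on currents giving mass `∏_{xy} t ^ {c_{xy}} / c_{xy}!` to `c`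
(see `currentMeasure_singleton`). -/
noncomputable def currentMeasure (n : ℕ) (t : ℝ) : Measure (Current n) :=
  Measure.pi fun _ => poissonWeight t

/-- The law of a sourceless current at inverse temperature `β`: the measure with parameter `β / 2`
conditioned on the event `∂c = 0`. -/
noncomputable def currentLaw (n : ℕ) (β : ℝ) : Measure (Current n) :=
  (currentMeasure n (β / 2))[|sourceless n]

/-- The face on the right of the directed edge `xy`. -/
def rightFace (x y : V) : V :=
  ((x.1 + y.1 + (y.2 - x.2) - 1) / 2, (x.2 + y.2 - (y.1 - x.1) - 1) / 2)

/-- The face on the left of the directed edge `xy`. -/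
def leftFace (x y : V) : V := rightFace y x

/-- `h` is a height function of the current `c`: it vanishes on the faces outside the box (which
together form the outer face), and for each directed edge `xy` of the box
the height on its right minus the height on its left equals `c_{xy} - c_{yx}`. -/
def IsHeightFunction {n : ℕ} (c : Current n) (h : V → ℤ) : Prop :=
  (∀ a : V, ¬ (-(n : ℤ) ≤ a.1 ∧ a.1 < n ∧ -(n : ℤ) ≤ a.2 ∧ a.2 < n) → h a = 0) ∧
  ∀ x y : V, (x, y) ∈ dirEdges n → h (rightFace x y) - h (leftFace x y) = c.net x y

/-- The height function of the current `c`: the height of the face `a` is the total winding of the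
current around `a`, that is, the net upward current through the horizontal half-line that goes
from the centre of the face to the left. For a sourceless current it is the unique
function with the property `IsHeightFunction`
(see `isHeightFunction_height` and `IsHeightFunction.eq_height`). -/
noncomputable def height {n : ℕ} (c : Current n) (a : V) : ℤ :=
  ∑ i ∈ Finset.Icc (-(n : ℤ)) a.1, c.net (i, a.2) (i, a.2 + 1)

/-- The covariance `Cov_{n,β}[a; b]` of the height function in the box at the faces `a`, `b`
(the heights are centred by symmetry). -/
noncomputable def heightCov (n : ℕ) (β : ℝ) (a b : V) : ℝ :=
  ∫ c, (height c a : ℝ) * (height c b : ℝ) ∂(currentLaw n β)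

/-- The covariance `SigCov_{n,β}[a; b]` of the signs of the height function in the box. -/
noncomputable def sigCov (n : ℕ) (β : ℝ) (a b : V) : ℝ :=
  ∫ c, ((height c a).sign : ℝ) * ((height c b).sign : ℝ) ∂(currentLaw n β)

/-- The infinite-volume covariance `Cov_{∞,β}[a; b] = lim_n Cov_{n,β}[a; b]`. -/
noncomputable def heightCovLim (β : ℝ) (a b : V) : ENNReal :=
  limUnder atTop fun n : ℕ => ENNReal.ofReal (heightCov n β a b)

/-- The infinite-volume sign covariance `SigCov_{∞,β}[a; b] = lim_n SigCov_{n,β}[a; b]`. -/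
noncomputable def sigCovLim (β : ℝ) (a b : V) : ENNReal :=
  limUnder atTop fun n : ℕ => ENNReal.ofReal (sigCov n β a b)

/-- The mass of the height function,
`liminf_k -(1/k) log (Cov_{∞,β}[(0,0); (0,k)] ∧ 1)`, with `log 0 = -∞`. -/
noncomputable def massHeight (β : ℝ) : EReal :=
  liminf (fun k : ℕ => -(1 / (k : EReal)) * ENNReal.log (min (heightCovLim β (0, 0) (0, k)) 1))
    atTop

/-! ### The definitions are sound -/

theorem mem_box {n : ℕ} {x : V} :
    x ∈ box n ↔ -(n : ℤ) ≤ x.1 ∧ x.1 ≤ n ∧ -(n : ℤ) ≤ x.2 ∧ x.2 ≤ n := by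
  simp only [box, Finset.mem_Icc, Prod.le_def]; tauto

theorem mem_dirEdges {n : ℕ} {x y : V} :
    (x, y) ∈ dirEdges n ↔
      x ∈ box n ∧ y ∈ box n ∧ (y.1 - x.1) ^ 2 + (y.2 - x.2) ^ 2 = 1 := by
  simp [dirEdges, and_assoc]

theorem unit_cases {p q : ℤ} (h : p ^ 2 + q ^ 2 = 1) :
    (p = 1 ∧ q = 0) ∨ (p = -1 ∧ q = 0) ∨ (p = 0 ∧ q = 1) ∨ (p = 0 ∧ q = -1) := by
  have h1 : p ≤ 1 := by nlinarith [sq_nonneg q]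
  have h2 : -1 ≤ p := by nlinarith [sq_nonneg q]
  have h3 : q ≤ 1 := by nlinarith [sq_nonneg p]
  have h4 : -1 ≤ q := by nlinarith [sq_nonneg p]
  interval_cases p <;> interval_cases q <;> simp_all

theorem net_symm {n : ℕ} (c : Current n) (x y : V) : c.net y x = - c.net x y := by
  simp [Current.net]

theorem net_eq_zero {n : ℕ} (c : Current n) {x y : V} (h : (x, y) ∉ dirEdges n) :
    c.net x y = 0 := by
  have h' : (y, x) ∉ dirEdges n := by
    rw [mem_dirEdges] at h ⊢
    intro hh
    exact h ⟨hh.2.1, hh.1, by linarith [hh.2.2]⟩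
  simp [Current.net, Current.val, h, h']

theorem net_outside {n : ℕ} (c : Current n) {x y : V} (h : x ∉ box n ∨ y ∉ box n) :
    c.net x y = 0 := by
  apply net_eq_zero
  rw [mem_dirEdges]
  tauto

theorem source_eq {n : ℕ} (c : Current n) (i j : ℤ) :
    c.source (i, j) = c.net (i, j) (i + 1, j) - c.net (i - 1, j) (i, j)
      + c.net (i, j) (i, j + 1) - c.net (i, j - 1) (i, j) := by
  classical
  set N : Finset V := {(i + 1, j), (i - 1, j), (i, j + 1), (i, j - 1)} with hN
  have h1 : c.source (i, j) = ∑ y ∈ box n ∪ N, c.net (i, j) y := by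
    refine Finset.sum_subset Finset.subset_union_left fun y _ hy => net_outside c (Or.inr hy)
  have h2 : ∑ y ∈ N, c.net (i, j) y = ∑ y ∈ box n ∪ N, c.net (i, j) y := by
    refine Finset.sum_subset Finset.subset_union_right fun y _ hy => net_eq_zero c ?_
    rw [mem_dirEdges]
    rintro ⟨-, -, h⟩
    apply hy
    obtain ⟨p, q⟩ := y
    simp only [hN, Finset.mem_insert, Finset.mem_singleton, Prod.mk.injEq]
    rcases unit_cases h with h | h | h | h <;> simp only at h <;> omega
  rw [h1, ← h2, hN, Finset.sum_insert, Finset.sum_insert, Finset.sum_insert,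
    Finset.sum_singleton, net_symm c (i - 1, j), net_symm c (i, j - 1)]
  · ring
  all_goals
    simp only [Finset.mem_insert, Finset.mem_singleton, Prod.mk.injEq]
    omega

theorem source_eq_zero {n : ℕ} {c : Current n} (hc : c ∈ sourceless n) (x : V) :
    c.source x = 0 := by
  by_cases hx : x ∈ box n
  · exact hc x hx
  · exact Finset.sum_eq_zero fun y _ => net_outside c (Or.inl hx)

theorem height_vertical {n : ℕ} (c : Current n) (i j : ℤ) :
    height c (i, j) - height c (i - 1, j) = c.net (i, j) (i, j + 1) := by
  by_cases hi : -(n : ℤ) ≤ i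
  · have : Finset.Icc (-(n : ℤ)) i = insert i (Finset.Icc (-(n : ℤ)) (i - 1)) := by
      ext k; simp only [Finset.mem_Icc, Finset.mem_insert]; omega
    simp only [height]
    rw [this, Finset.sum_insert (by simp)]
    ring
  · rw [net_outside c (Or.inl (by rw [mem_box]; simp only; omega))]
    simp only [height]
    rw [Finset.Icc_eq_empty (by omega), Finset.Icc_eq_empty (by omega)]
    simp

theorem height_left {n : ℕ} (c : Current n) (i j : ℤ) (hi : i < -(n : ℤ)) :
    height c (i, j) = 0 := by
  simp only [height]
  rw [Finset.Icc_eq_empty (by omega)]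
  simp

theorem height_horizontal {n : ℕ} {c : Current n} (hc : c ∈ sourceless n) (i j : ℤ) :
    height c (i, j - 1) - height c (i, j) = c.net (i, j) (i + 1, j) := by
  by_cases hi : i < -(n : ℤ)
  · rw [height_left c _ _ hi, height_left c _ _ hi,
      net_outside c (Or.inl (by rw [mem_box]; simp only; omega))]
    simp
  · obtain ⟨m, hm⟩ := Int.eq_ofNat_of_zero_le (show 0 ≤ i + n + 1 by omega)
    obtain rfl : i = -(n : ℤ) - 1 + m := by omega
    clear hi hm
    induction m with
    | zero =>
      rw [height_left c _ _ (by simp), height_left c _ _ (by simp),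
        net_outside c (Or.inl (by rw [mem_box]; simp))]
      simp
    | succ m ih =>
      have e : -(n : ℤ) - 1 + ((m + 1 : ℕ) : ℤ) = -(n : ℤ) - 1 + m + 1 := by push_cast; ring
      rw [e]
      set k : ℤ := -(n : ℤ) - 1 + m
      have v1 := height_vertical c (k + 1) j
      have v2 := height_vertical c (k + 1) (j - 1)
      have s := (source_eq c (k + 1) j).symm.trans (source_eq_zero hc _)
      simp only [add_sub_cancel_right, sub_add_cancel] at v1 v2 s
      linarith

theorem isHeightFunction_height {n : ℕ} {c : Current n} (hc : c ∈ sourceless n) :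
    IsHeightFunction c (height c) := by
  constructor
  · have row : ∀ i j : ℤ, (j < -(n : ℤ) ∨ (n : ℤ) ≤ j) → height c (i, j) = 0 := by
      intro i j hj
      refine Finset.sum_eq_zero fun k _ => net_outside c ?_
      rw [mem_box, mem_box]
      simp only
      omega
    rintro ⟨i, j⟩ h
    simp only at h
    by_cases hj : j < -(n : ℤ) ∨ (n : ℤ) ≤ j
    · exact row i j hj
    by_cases hi : i < -(n : ℤ)
    · exact height_left c i j hi
    have hin : (n : ℤ) ≤ i := by omega
    obtain ⟨m, hm⟩ := Int.eq_ofNat_of_zero_le (show 0 ≤ j + n + 1 by omega)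
    obtain rfl : j = -(n : ℤ) - 1 + m := by omega
    clear hj hm h
    induction m with
    | zero => exact row _ _ (Or.inl (by simp))
    | succ m ih =>
      have e : -(n : ℤ) - 1 + ((m + 1 : ℕ) : ℤ) = -(n : ℤ) - 1 + m + 1 := by push_cast; ring
      rw [e]
      have := height_horizontal hc i (-(n : ℤ) - 1 + m + 1)
      rw [net_outside c (Or.inr (by rw [mem_box]; simp only; omega)),
        add_sub_cancel_right] at this
      linarith
  · rintro ⟨i, j⟩ ⟨p, q⟩ h
    have hu := unit_cases (mem_dirEdges.1 h).2.2
    simp only at hu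
    simp only [rightFace, leftFace]
    rcases hu with ⟨h1, h2⟩ | ⟨h1, h2⟩ | ⟨h1, h2⟩ | ⟨h1, h2⟩
    · obtain rfl : p = i + 1 := by omega
      obtain rfl : q = j := by omega
      rw [← height_horizontal hc i q]
      congr 2 <;> congr 1 <;> omega
    · obtain rfl : p = i - 1 := by omega
      obtain rfl : q = j := by omega
      have := height_horizontal hc (i - 1) q
      rw [sub_add_cancel] at this
      rw [net_symm, ← this, neg_sub]
      congr 2 <;> congr 1 <;> omega
    · obtain rfl : p = i := by omega
      obtain rfl : q = j + 1 := by omega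
      rw [← height_vertical c p j]
      congr 2 <;> congr 1 <;> omega
    · obtain rfl : p = i := by omega
      obtain rfl : q = j - 1 := by omega
      have := height_vertical c p (j - 1)
      rw [sub_add_cancel] at this
      rw [net_symm, ← this, neg_sub]
      congr 2 <;> congr 1 <;> omega

theorem IsHeightFunction.eq_height {n : ℕ} {c : Current n} (hc : c ∈ sourceless n)
    {h : V → ℤ} (hh : IsHeightFunction c h) : h = height c := by
  have hg := isHeightFunction_height hc
  funext ⟨i, j⟩
  by_cases hj : -(n : ℤ) ≤ j ∧ j < n
  swap
  · rw [hh.1 (i, j) (by simp only; tauto), hg.1 (i, j) (by simp only; tauto)]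
  by_cases hi : i < -(n : ℤ)
  · rw [hh.1 (i, j) (by simp only; omega), hg.1 (i, j) (by simp only; omega)]
  obtain ⟨m, hm⟩ := Int.eq_ofNat_of_zero_le (show 0 ≤ i + n + 1 by omega)
  obtain rfl : i = -(n : ℤ) - 1 + m := by omega
  clear hi hm
  induction m with
  | zero => rw [hh.1 _ (by simp), hg.1 _ (by simp)]
  | succ m ih =>
    by_cases hn : -(n : ℤ) - 1 + ((m + 1 : ℕ) : ℤ) ≤ n
    · set k : ℤ := -(n : ℤ) - 1 + ((m + 1 : ℕ) : ℤ) with hk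
      have hk1 : -(n : ℤ) - 1 + (m : ℤ) = k - 1 := by rw [hk]; push_cast; ring
      have hk2 : -(n : ℤ) ≤ k := by rw [hk]; push_cast; omega
      rw [hk1] at ih
      have hmem : ((k, j), (k, j + 1)) ∈ dirEdges n := by
        rw [mem_dirEdges, mem_box, mem_box]
        refine ⟨?_, ?_, by ring⟩ <;> simp only <;> omega
      have e1 := hh.2 _ _ hmem
      have e2 := hg.2 _ _ hmem
      have r : rightFace (k, j) (k, j + 1) = (k, j) := by
        simp only [rightFace]; congr 1 <;> omega
      have l : leftFace (k, j) (k, j + 1) = (k - 1, j) := by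
        simp only [leftFace, rightFace]; congr 1 <;> omega
      rw [r, l] at e1 e2
      linarith
    · rw [hh.1 _ (by simp only; omega), hg.1 _ (by simp only; omega)]

theorem poissonWeight_singleton (t : ℝ) (k : ℕ) :
    poissonWeight t {k} = ENNReal.ofReal (t ^ k / (k.factorial : ℝ)) := by
  rw [poissonWeight, withDensity_apply _ (measurableSet_singleton k)]
  simp

instance instFinitePoissonWeight (t : ℝ) : IsFiniteMeasure (poissonWeight t) := by
  refine isFiniteMeasure_withDensity_ofReal ?_
  have : Integrable (fun k : ℕ => t ^ k / (k.factorial : ℝ)) Measure.count :=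
    integrable_count_iff.2 (Real.summable_pow_div_factorial t).norm
  exact this.2

theorem currentMeasure_singleton (n : ℕ) {t : ℝ} (ht : 0 ≤ t) (c : Current n) :
    currentMeasure n t {c} = ENNReal.ofReal (∏ e, t ^ c e / ((c e).factorial : ℝ)) := by
  rw [currentMeasure, Measure.pi_singleton, ENNReal.ofReal_prod_of_nonneg
    (fun _ _ => by positivity)]
  simp only [poissonWeight_singleton]

instance instFiniteCurrentMeasure (n : ℕ) (t : ℝ) : IsFiniteMeasure (currentMeasure n t) := by
  unfold currentMeasure; infer_instance

theorem isProbabilityMeasure_currentLaw (n : ℕ) {β : ℝ} (hβ : 0 ≤ β) :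
    IsProbabilityMeasure (currentLaw n β) := by
  refine cond_isProbabilityMeasure fun h0 => ?_
  have hz : (fun _ => 0 : Current n) ∈ sourceless n := by
    intro x _
    simp [Current.source, Current.net, Current.val]
  have := measure_mono_null (Set.singleton_subset_iff.2 hz) h0
  rw [currentMeasure_singleton n (by positivity)] at this
  simp at this

theorem val_le_sum {n : ℕ} (c : Current n) (x y : V) : c.val x y ≤ ∑ e, c e := by
  unfold Current.val
  split_ifs with h
  · exact Finset.single_le_sum (f := c) (fun _ _ => Nat.zero_le _) (Finset.mem_univ _)
  · exact Nat.zero_le _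

theorem abs_height_le {n : ℕ} (c : Current n) (a : V) :
    |(height c a : ℝ)| ≤ ((Finset.Icc (-(n : ℤ)) a.1).card : ℝ) * ∑ e, (c e : ℝ) := by
  have h1 : ∀ x y : V, |(c.net x y : ℝ)| ≤ ∑ e, (c e : ℝ) := by
    intro x y
    have hx : (c.val x y : ℝ) ≤ ∑ e, (c e : ℝ) := by exact_mod_cast val_le_sum c x y
    have hy : (c.val y x : ℝ) ≤ ∑ e, (c e : ℝ) := by exact_mod_cast val_le_sum c y x
    have hx0 : (0 : ℝ) ≤ c.val x y := Nat.cast_nonneg _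
    have hy0 : (0 : ℝ) ≤ c.val y x := Nat.cast_nonneg _
    simp only [Current.net, Int.cast_sub, Int.cast_natCast]
    rw [abs_le]
    constructor <;> linarith
  simp only [height, Int.cast_sum]
  refine (Finset.abs_sum_le_sum_abs _ _).trans ?_
  refine (Finset.sum_le_card_nsmul _ _ _ fun k _ => h1 _ _).trans ?_
  rw [nsmul_eq_mul]

theorem integrable_exp_poissonWeight {t : ℝ} (ht : 0 ≤ t) :
    Integrable (fun k : ℕ => Real.exp k) (poissonWeight t) := by
  unfold poissonWeight
  rw [integrable_withDensity_iff (by fun_prop) (by simp), integrable_count_iff]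
  refine (Real.summable_pow_div_factorial (Real.exp 1 * t)).norm.congr fun k => ?_
  rw [ENNReal.toReal_ofReal (by positivity), mul_pow, ← Real.exp_nat_mul, mul_one, mul_div_assoc]

/-- The covariances of the heights are integrals of integrable functions. -/
theorem integrable_height_mul_height (n : ℕ) {β : ℝ} (hβ : 0 ≤ β) (a b : V) :
    Integrable (fun c => (height c a : ℝ) * (height c b : ℝ)) (currentLaw n β) := by
  have key : Integrable (fun c : Current n => (height c a : ℝ) * (height c b : ℝ))
      (currentMeasure n (β / 2)) := by
    have hE : Integrable (fun c : Current n => ∏ e, Real.exp (c e)) (currentMeasure n (β / 2)) :=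
      Integrable.fintype_prod (f := fun _ (k : ℕ) => Real.exp k) fun _ =>
        integrable_exp_poissonWeight (by positivity)
    refine (hE.const_mul (2 * (((Finset.Icc (-(n : ℤ)) a.1).card : ℝ) *
      ((Finset.Icc (-(n : ℤ)) b.1).card : ℝ)))).mono' ?_ (ae_of_all _ fun c => ?_)
    · exact (Measurable.of_discrete).aestronglyMeasurable
    · rw [← Real.exp_sum, Real.norm_eq_abs, abs_mul]
      set S : ℝ := ∑ e, (c e : ℝ)
      have hS : 0 ≤ S := Finset.sum_nonneg fun _ _ => Nat.cast_nonneg _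
      have hq := Real.quadratic_le_exp_of_nonneg hS
      refine (mul_le_mul (abs_height_le c a) (abs_height_le c b) (abs_nonneg _)
        (by positivity)).trans ?_
      have : S * S ≤ 2 * Real.exp S := by nlinarith
      calc _ = (((Finset.Icc (-(n : ℤ)) a.1).card : ℝ) *
            ((Finset.Icc (-(n : ℤ)) b.1).card : ℝ)) * (S * S) := by ring
        _ ≤ (((Finset.Icc (-(n : ℤ)) a.1).card : ℝ) *
            ((Finset.Icc (-(n : ℤ)) b.1).card : ℝ)) * (2 * Real.exp S) := by gcongr
        _ = _ := by ring
  have : IsProbabilityMeasure (currentLaw n β) := isProbabilityMeasure_currentLaw n hβ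
  have hne : currentMeasure n (β / 2) (sourceless n) ≠ 0 := by
    intro h0
    have : currentLaw n β = 0 := cond_eq_zero_of_meas_eq_zero h0
    exact IsProbabilityMeasure.ne_zero (currentLaw n β) this
  exact (key.restrict (s := sourceless n)).smul_measure (ENNReal.inv_ne_top.2 hne)

end XYHeight

/-! The height function is a Gibbs field: heights vanish outside the box and each pair of adjacent
faces contributes `edgeWeight`, a modified Bessel function of the height difference. This weight is
the limit, as M tends to infinity, of the total weight of walks of M + 1 steps in {-1, 0, 1}, where
a step ±1 costs ε = t / (M + 1) with t = β / 2. So the model is a limit of models on the graph whose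
edges are subdivided into M + 1 pieces, in which neighbouring heights differ by at most one
(`Net.part_subdiv`, `tendsto_pathKernel`, `Net.tendsto_part`).

In the subdivided model the sign cannot change without passing through zero. Given |h|, the signs
are therefore constant on the clusters of {h ≠ 0} and are independent fair coins from cluster to
cluster. Hence the sign covariance is the probability that the two points are connected in {h ≠ 0},
and the height covariance is the expectation of |h(a) h(b)| on that event
(`Net.part_sign_mul_sign`). Moreover |h| satisfies the FKG inequality (`Net.fkg`): its law carries
the factor 2 to the number of clusters, which meets the lattice condition up to a factor 2 per
crossing edge, and 2ε² ≤ 1 absorbs that factor. Consequences of FKG: both covariances increase with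
the domain, so the limits exist, and SigCov[a;b] SigCov[b;c] ≤ SigCov[a;c].

A connection forces |h(a) h(b)| ≥ 1, so SigCov ≤ Cov ∧ 1, which is one half of the identity. For the
other half, decay of SigCov at rate c has to give decay of Cov at every rate below c, although
heights are unbounded and the box grows. Sort configurations by the first box, of index j + 1 > k,
that contains the cluster of the origin. Cutting out the cluster and applying FKG to the rest bounds
each contribution by its value in the box j + 1 itself (`Net.part_cluster_le`,
`Net.part_conn_le_sum`). There the cluster reaches the outermost shell, which costs SigCov[0;x] for
some x in the shell, while heights are polynomial in j up to an exponentially small error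
(`av_tailProd_le`). Reflection through x and supermultiplicativity give SigCov[0;x]² ≤
SigCov[0;(0,2r)] when a coordinate of x has absolute value r, so the shell decays at the rate of the
axis. A polynomial times exp(-cj), summed over j ≥ k, gives `heightCov_le_exp`. -/

namespace XYHeight

/-! ### Counting sign patterns -/

section Signs

variable {ι 𝓔 : Type*} [DecidableEq ι]

/-- A finite multigraph on the vertex set `ι`, with edges labelled by a finite subset of `𝓔`. -/
structure Net (ι 𝓔 : Type*) where
  /-- The edges. -/
  E : Finset 𝓔
  /-- The first end point of an edge. -/
  s : 𝓔 → ι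
  /-- The second end point of an edge. -/
  t : 𝓔 → ι

variable (G : Net ι 𝓔)

open Classical in
/-- The subsets of `A` which are unions of connected components of the graph induced on `A`. -/
noncomputable def Net.signs (A : Finset ι) : Finset (Finset ι) :=
  A.powerset.filter fun N => ∀ e ∈ G.E, G.s e ∈ A → G.t e ∈ A → (G.s e ∈ N ↔ G.t e ∈ N)

/-- The edges with one end point in `A \ B` and the other one in `B \ A`. -/
def Net.crossing (A B : Finset ι) : Finset 𝓔 :=
  G.E.filter fun e => (G.s e ∈ A \ B ∧ G.t e ∈ B \ A) ∨ (G.s e ∈ B \ A ∧ G.t e ∈ A \ B)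

theorem Net.mem_signs {A N : Finset ι} : N ∈ G.signs A ↔
    N ⊆ A ∧ ∀ e ∈ G.E, G.s e ∈ A → G.t e ∈ A → (G.s e ∈ N ↔ G.t e ∈ N) := by
  classical
  simp [Net.signs]

theorem Net.symmDiff_mem_signs {A M N : Finset ι} (hM : M ∈ G.signs A) (hN : N ∈ G.signs A) :
    symmDiff M N ∈ G.signs A := by
  rw [Net.mem_signs] at *
  refine ⟨fun x hx => ?_, fun e he hs ht => ?_⟩
  · rcases Finset.mem_symmDiff.1 hx with h | h
    · exact hM.1 h.1
    · exact hN.1 h.1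
  · have h1 := hM.2 e he hs ht
    have h2 := hN.2 e he hs ht
    simp only [Finset.mem_symmDiff]
    tauto

/-- Sign patterns on `A` and on `B` that agree on `A ∩ B` and across the crossing edges
can be glued together. -/
theorem Net.union_mem_signs {A B M N : Finset ι} (hM : M ∈ G.signs A) (hN : N ∈ G.signs B)
    (h : ∀ x ∈ A, x ∈ B → (x ∈ M ↔ x ∈ N))
    (hc : ∀ e ∈ G.crossing A B, (G.s e ∈ M ∪ N ↔ G.t e ∈ M ∪ N)) : M ∪ N ∈ G.signs (A ∪ B) := by
  have hM' := G.mem_signs.1 hM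
  have hN' := G.mem_signs.1 hN
  refine G.mem_signs.2 ⟨Finset.union_subset_union hM'.1 hN'.1, fun e he hs ht => ?_⟩
  by_cases hc' : e ∈ G.crossing A B
  · exact hc e hc'
  have key : ∀ x, (x ∈ A → (x ∈ M ∪ N ↔ x ∈ M)) ∧ (x ∈ B → (x ∈ M ∪ N ↔ x ∈ N)) := by
    intro x
    have h1 := h x
    have h2 : x ∈ M → x ∈ A := fun hx => hM'.1 hx
    have h3 : x ∈ N → x ∈ B := fun hx => hN'.1 hx
    rw [Finset.mem_union]
    tauto
  have hAB : (G.s e ∈ A ∧ G.t e ∈ A) ∨ (G.s e ∈ B ∧ G.t e ∈ B) := by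
    simp only [Net.crossing, Finset.mem_filter, he, true_and, Finset.mem_sdiff] at hc'
    simp only [Finset.mem_union] at hs ht
    tauto
  rcases hAB with h1 | h1
  · rw [(key _).1 h1.1, (key _).1 h1.2]
    exact hM'.2 e he h1.1 h1.2
  · rw [(key _).2 h1.1, (key _).2 h1.2]
    exact hN'.2 e he h1.1 h1.2

/-- This is the lattice condition for 2 to the number of components, proved by counting instead of
by ranks. Send a pair (N, N') to the trace of its symmetric difference on A ∩ B and to the set of
crossing edges that this difference separates. Sign patterns form a vector space over the field with
two elements, so subtracting a fixed pair of a fibre makes the two patterns agree on A ∩ B and match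
across crossing edges; they then glue to a pattern on A ∪ B, injectively. -/
theorem Net.card_signs_mul_le (A B : Finset ι) :
    (G.signs A).card * (G.signs B).card ≤
      2 ^ (G.crossing A B).card * ((G.signs (A ∩ B)).card * (G.signs (A ∪ B)).card) := by
  classical
  set φ : Finset ι × Finset ι → Finset ι × Finset 𝓔 := fun p =>
    (symmDiff p.1 p.2 ∩ (A ∩ B), (G.crossing A B).filter fun e =>
      ¬ (G.s e ∈ symmDiff p.1 p.2 ↔ G.t e ∈ symmDiff p.1 p.2)) with hφ
  have h := Finset.card_le_mul_card_image_of_maps_to (s := G.signs A ×ˢ G.signs B)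
    (t := G.signs (A ∩ B) ×ˢ (G.crossing A B).powerset) (f := φ) ?_ (G.signs (A ∪ B)).card ?_
  · rw [Finset.card_product, Finset.card_product, Finset.card_powerset] at h
    calc _ ≤ _ := h
      _ = _ := by ring
  · rintro ⟨N, N'⟩ hp
    simp only [Finset.mem_product, Net.mem_signs] at hp
    simp only [hφ, Finset.mem_product, Net.mem_signs, Finset.mem_powerset]
    refine ⟨⟨Finset.inter_subset_right, fun e he hs ht => ?_⟩, Finset.filter_subset _ _⟩
    have h1 := hp.1.2 e he
    have h2 := hp.2.2 e he
    simp only [Finset.mem_inter, Finset.mem_symmDiff] at *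
    tauto
  · rintro b hb
    rcases Finset.eq_empty_or_nonempty
      ((G.signs A ×ˢ G.signs B).filter fun a => φ a = b) with h0 | ⟨⟨N0, N0'⟩, h0⟩
    · rw [h0]; simp
    rw [Finset.mem_filter, Finset.mem_product] at h0
    have hag : ∀ p ∈ (G.signs A ×ˢ G.signs B).filter fun a => φ a = b, ∀ x ∈ A, x ∈ B →
        (x ∈ symmDiff p.1 N0 ↔ x ∈ symmDiff p.2 N0') := by
      intro p hp x hA hB
      have he : φ p = φ (N0, N0') := (Finset.mem_filter.1 hp).2.trans h0.2.symm
      have hx := Finset.ext_iff.1 (Prod.mk.inj he).1 x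
      simp only [Finset.mem_inter, hA, hB, and_true, Finset.mem_symmDiff] at hx ⊢
      clear he hp h0 hb hφ
      clear φ
      grind
    -- Translate the fibre by its reference element (N0, N0') and glue. The glued set determines
    -- both parts, because they coincide on the overlap.
    refine Finset.card_le_card_of_injOn (fun p => symmDiff p.1 N0 ∪ symmDiff p.2 N0') ?_ ?_
    · intro p hp
      have hp' := Finset.mem_filter.1 hp
      rw [Finset.mem_product] at hp'
      refine G.union_mem_signs (G.symmDiff_mem_signs hp'.1.1 h0.1.1)
        (G.symmDiff_mem_signs hp'.1.2 h0.1.2) (hag p hp) fun e he => ?_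
      have he' : φ p = φ (N0, N0') := hp'.2.trans h0.2.symm
      have hx := Finset.ext_iff.1 (Prod.mk.inj he').2 e
      simp only [Finset.mem_filter, he, true_and, not_iff_not] at hx
      have key : ∀ x, ((x ∈ A ∧ x ∉ B) ∨ (x ∈ B ∧ x ∉ A)) →
          (x ∈ symmDiff p.1 N0 ∪ symmDiff p.2 N0' ↔
            ¬ (x ∈ symmDiff p.1 p.2 ↔ x ∈ symmDiff N0 N0')) := by
        intro x hx
        have c1 : x ∈ p.1 → x ∈ A := fun h => (G.mem_signs.1 hp'.1.1).1 h
        have c2 : x ∈ p.2 → x ∈ B := fun h => (G.mem_signs.1 hp'.1.2).1 h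
        have c3 : x ∈ N0 → x ∈ A := fun h => (G.mem_signs.1 h0.1.1).1 h
        have c4 : x ∈ N0' → x ∈ B := fun h => (G.mem_signs.1 h0.1.2).1 h
        clear hp hp' h0 he he' hag hb hφ
        clear φ
        simp only [Finset.mem_union, Finset.mem_symmDiff]
        grind
      have he2 := (Finset.mem_filter.1 he).2
      simp only [Finset.mem_sdiff] at he2
      clear hp hp' h0 he he' hag hb hφ
      clear φ
      rw [key _ (by grind), key _ (by grind)]
      grind
    · intro p hp q hq hpq
      have hp1 := hag p hp
      have hq1 := hag q hq
      have hp' := Finset.mem_product.1 (Finset.mem_filter.1 hp).1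
      have hq' := Finset.mem_product.1 (Finset.mem_filter.1 hq).1
      have key : ∀ x, (x ∈ p.1 ↔ x ∈ q.1) ∧ (x ∈ p.2 ↔ x ∈ q.2) := by
        intro x
        have a1 := hp1 x
        have a2 := hq1 x
        have a3 := Finset.ext_iff.1 hpq x
        have c1 : x ∈ p.1 → x ∈ A := fun h => (G.mem_signs.1 hp'.1).1 h
        have c2 : x ∈ p.2 → x ∈ B := fun h => (G.mem_signs.1 hp'.2).1 h
        have c3 : x ∈ N0 → x ∈ A := fun h => (G.mem_signs.1 h0.1.1).1 h
        have c4 : x ∈ N0' → x ∈ B := fun h => (G.mem_signs.1 h0.1.2).1 h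
        have c5 : x ∈ q.1 → x ∈ A := fun h => (G.mem_signs.1 hq'.1).1 h
        have c6 : x ∈ q.2 → x ∈ B := fun h => (G.mem_signs.1 hq'.2).1 h
        clear hp1 hq1 hpq hp' hq' hp hq hag h0 hφ hb
        clear φ
        simp only [Finset.mem_union, Finset.mem_symmDiff] at a1 a2 a3
        by_cases hA : x ∈ A <;> by_cases hB : x ∈ B <;>
          simp only [hA, hB, true_imp_iff, false_imp_iff, imp_false, imp_true_iff] at * <;>
          grind
      refine Prod.ext ?_ ?_ <;> ext x
      · exact (key x).1
      · exact (key x).2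

end Signs

/-! ### Integer-valued height functions with steps of size at most one -/

/-- The edge weight of a height function with steps of size at most one. -/
noncomputable def stepWeight (ε : ℝ) (k : ℤ) : ℝ := if k = 0 then 1 else if |k| = 1 then ε else 0

theorem stepWeight_nonneg {ε : ℝ} (hε : 0 ≤ ε) (k : ℤ) : 0 ≤ stepWeight ε k := by
  unfold stepWeight; split_ifs <;> simp [hε]

@[simp] theorem stepWeight_zero (ε : ℝ) : stepWeight ε 0 = 1 := by simp [stepWeight]

theorem stepWeight_neg (ε : ℝ) (k : ℤ) : stepWeight ε (-k) = stepWeight ε k := by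
  simp [stepWeight]

theorem stepWeight_of_two_le {ε : ℝ} {k : ℤ} (hk : 2 ≤ |k|) : stepWeight ε k = 0 := by
  unfold stepWeight
  rw [if_neg, if_neg]
  · omega
  · rintro rfl; simp at hk

/-- The lattice condition for the weight of one edge, strengthened in the strict case. -/
theorem stepWeight_lattice {ε : ℝ} (hε : 0 ≤ ε) (hε' : ε ≤ 1 / 2) (a b a' b' : ℕ) :
    stepWeight ε ((a : ℤ) - b) * stepWeight ε ((a' : ℤ) - b') *
        (if (a < a' ∧ b' < b) ∨ (a' < a ∧ b < b') then 2 else 1) ≤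
      stepWeight ε (((a ⊓ a' : ℕ) : ℤ) - (b ⊓ b' : ℕ)) *
        stepWeight ε (((a ⊔ a' : ℕ) : ℤ) - (b ⊔ b' : ℕ)) := by
  have key : ∀ a b a' b' : ℕ, a < a' → b' < b →
      stepWeight ε ((a : ℤ) - b) * stepWeight ε ((a' : ℤ) - b') * 2 ≤
      stepWeight ε ((a : ℤ) - b') * stepWeight ε ((a' : ℤ) - b) := by
    intro a b a' b' h1 h2
    by_cases h3 : 2 ≤ |(a : ℤ) - b|
    · rw [stepWeight_of_two_le h3, zero_mul, zero_mul]
      exact mul_nonneg (stepWeight_nonneg hε _) (stepWeight_nonneg hε _)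
    by_cases h4 : 2 ≤ |(a' : ℤ) - b'|
    · rw [stepWeight_of_two_le h4, mul_zero, zero_mul]
      exact mul_nonneg (stepWeight_nonneg hε _) (stepWeight_nonneg hε _)
    rw [not_le, abs_lt] at h3 h4
    -- Strictness puts the two differences at least 2 apart, and both lie in [-1, 1], so they are -1
    -- and 1. After the exchange both edges are flat, and the claim reads 2ε² ≤ 1.
    have e1 : (a : ℤ) - b = -1 := by omega
    have e2 : (a' : ℤ) - b' = 1 := by omega
    have e3 : (a : ℤ) - b' = 0 := by omega
    have e4 : (a' : ℤ) - b = 0 := by omega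
    rw [e1, e2, e3, e4]
    simp only [stepWeight]
    norm_num
    nlinarith
  rcases lt_trichotomy a a' with h1 | h1 | h1
  · by_cases h2 : b' < b
    · rw [if_pos (Or.inl ⟨h1, h2⟩), inf_eq_left.2 h1.le, sup_eq_right.2 h1.le, inf_eq_right.2 h2.le,
        sup_eq_left.2 h2.le]
      exact key _ _ _ _ h1 h2
    · rw [if_neg (by omega), inf_eq_left.2 h1.le, sup_eq_right.2 h1.le, inf_eq_left.2 (not_lt.1 h2),
        sup_eq_right.2 (not_lt.1 h2), mul_one]
  · subst h1
    rw [if_neg (by omega), mul_one, inf_idem, sup_idem]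
    rcases le_total b b' with h2 | h2
    · rw [inf_eq_left.2 h2, sup_eq_right.2 h2]
    · rw [inf_eq_right.2 h2, sup_eq_left.2 h2, mul_comm]
  · by_cases h2 : b < b'
    · rw [if_pos (Or.inr ⟨h1, h2⟩), inf_eq_right.2 h1.le, sup_eq_left.2 h1.le, inf_eq_left.2 h2.le,
        sup_eq_right.2 h2.le, mul_comm (stepWeight ε ((a : ℤ) - b))]
      exact key _ _ _ _ h1 h2
    · rw [if_neg (by omega), inf_eq_right.2 h1.le, sup_eq_left.2 h1.le,
        inf_eq_right.2 (not_lt.1 h2), sup_eq_left.2 (not_lt.1 h2), mul_one, mul_comm]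

/-! ### Finite-volume sums over height functions, and the FKG inequality for their absolute value -/

section Configurations

variable {ι 𝓔 : Type*}

open Classical in
/-- The height functions bounded by `L` and vanishing off `D`. -/
noncomputable def cfg (L : ℕ) (D : Finset ι) : Finset (ι → ℤ) :=
  (Fintype.piFinset fun _ : D => Finset.Icc (-(L : ℤ)) L).image
    fun f x => if hx : x ∈ D then f ⟨x, hx⟩ else 0

theorem mem_cfg {L : ℕ} {D : Finset ι} {h : ι → ℤ} :
    h ∈ cfg L D ↔ (∀ x, x ∉ D → h x = 0) ∧ ∀ x, (h x).natAbs ≤ L := by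
  classical
  simp only [cfg, Finset.mem_image, Fintype.mem_piFinset, Finset.mem_Icc]
  constructor
  · rintro ⟨f, hf, rfl⟩
    refine ⟨fun x hx => by simp [hx], fun x => ?_⟩
    by_cases hx : x ∈ D
    · have := hf ⟨x, hx⟩
      simp only [hx, dite_true]
      omega
    · simp [hx]
  · rintro ⟨h1, h2⟩
    refine ⟨fun x => h x, fun x => ?_, ?_⟩
    · have := h2 (x : ι)
      show -(L : ℤ) ≤ h x ∧ h x ≤ L
      omega
    · funext x
      by_cases hx : x ∈ D
      · simp [hx]
      · simp [hx, h1 x hx]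

theorem zero_mem_cfg (L : ℕ) (D : Finset ι) : (fun _ => 0 : ι → ℤ) ∈ cfg L D := by
  simp [mem_cfg]

theorem cfg_mono (L : ℕ) {D D' : Finset ι} (h : D ⊆ D') : cfg L D ⊆ cfg L D' := fun f hf => by
  rw [mem_cfg] at *
  exact ⟨fun x hx => hf.1 x fun hx' => hx (h hx'), hf.2⟩

/-- The absolute value of a height function. -/
def absH (h : ι → ℤ) : ι → ℕ := fun x => (h x).natAbs

/-- The weight of a height function, for the edge kernel `K`. -/
noncomputable def Net.weight (G : Net ι 𝓔) (K : ℤ → ℤ → ℝ) (h : ι → ℤ) : ℝ :=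
  ∏ e ∈ G.E, K (h (G.s e)) (h (G.t e))

/-- The non-normalised expectation of `f` with respect to the height functions in `cfg L D`. -/
noncomputable def Net.part (G : Net ι 𝓔) (K : ℤ → ℤ → ℝ) (L : ℕ) (D : Finset ι)
    (f : (ι → ℤ) → ℝ) : ℝ :=
  ∑ h ∈ cfg L D, G.weight K h * f h

/-- The kernel of height functions with steps of size at most one. -/
noncomputable def stepKernel (ε : ℝ) (a b : ℤ) : ℝ := stepWeight ε (a - b)

theorem stepKernel_nonneg {ε : ℝ} (hε : 0 ≤ ε) (a b : ℤ) : 0 ≤ stepKernel ε a b :=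
  stepWeight_nonneg hε _

variable (G : Net ι 𝓔)

theorem Net.weight_nonneg {K : ℤ → ℤ → ℝ} (hK : ∀ a b, 0 ≤ K a b) (h : ι → ℤ) :
    0 ≤ G.weight K h := Finset.prod_nonneg fun _ _ => hK _ _

theorem Net.part_nonneg {K : ℤ → ℤ → ℝ} (hK : ∀ a b, 0 ≤ K a b) (L : ℕ) (D : Finset ι)
    {f : (ι → ℤ) → ℝ} (hf : ∀ h, 0 ≤ f h) : 0 ≤ G.part K L D f :=
  Finset.sum_nonneg fun _ _ => mul_nonneg (G.weight_nonneg hK _) (hf _)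

theorem Net.part_mono {K : ℤ → ℤ → ℝ} (hK : ∀ a b, 0 ≤ K a b) (L : ℕ) (D : Finset ι)
    {f g : (ι → ℤ) → ℝ} (hfg : ∀ h ∈ cfg L D, f h ≤ g h) : G.part K L D f ≤ G.part K L D g :=
  Finset.sum_le_sum fun _ hh => mul_le_mul_of_nonneg_left (hfg _ hh) (G.weight_nonneg hK _)

theorem Net.part_pos {K : ℤ → ℤ → ℝ} (hK : ∀ a b, 0 ≤ K a b) (h0 : 0 < K 0 0) (L : ℕ)
    (D : Finset ι) : 0 < G.part K L D fun _ => 1 := by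
  refine Finset.sum_pos' (fun _ _ => mul_nonneg (G.weight_nonneg hK _) zero_le_one)
    ⟨_, zero_mem_cfg L D, ?_⟩
  rw [mul_one]
  exact Finset.prod_pos fun _ _ => h0

open Classical in
/-- Change the sign of `h` on the set `N`. -/
noncomputable def flip (N : Set ι) (h : ι → ℤ) : ι → ℤ := fun x => if x ∈ N then - h x else h x

theorem flip_flip (N : Set ι) (h : ι → ℤ) : flip N (flip N h) = h := by
  funext x; simp only [flip]; split_ifs <;> simp

@[simp] theorem absH_flip (N : Set ι) (h : ι → ℤ) : absH (flip N h) = absH h := by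
  funext x; simp only [flip, absH]; split_ifs <;> simp

/-- A set of vertices is compatible with `ζ` if it does not separate the end points of an edge
on which `ζ` is positive. -/
def Net.Compat (ζ : ι → ℕ) (N : Set ι) : Prop :=
  ∀ e ∈ G.E, ζ (G.s e) ≠ 0 → ζ (G.t e) ≠ 0 → (G.s e ∈ N ↔ G.t e ∈ N)

/-- A compatible set splits an edge only if one end has height zero; then flipping merely negates
the height difference, and the step weight is even. -/
theorem Net.weight_flip (ε : ℝ) {h : ι → ℤ} {N : Set ι} (hN : G.Compat (absH h) N) :
    G.weight (stepKernel ε) (flip N h) = G.weight (stepKernel ε) h := by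
  refine Finset.prod_congr rfl fun e he => ?_
  have h1 := hN e he
  simp only [absH, ne_eq, Int.natAbs_eq_zero] at h1
  simp only [stepKernel, flip]
  by_cases hs : h (G.s e) = 0
  · rw [hs]
    split_ifs <;> simp [stepWeight_neg]
  by_cases ht : h (G.t e) = 0
  · rw [ht]
    split_ifs <;> simp [stepWeight_neg]
  have h2 := h1 hs ht
  by_cases h3 : G.s e ∈ N
  · rw [if_pos h3, if_pos (h2.1 h3), ← stepWeight_neg]
    congr 1; ring
  · rw [if_neg h3, if_neg (fun h4 => h3 (h2.2 h4))]

/-- Nonzero heights of opposite signs differ by at least 2, which a single step cannot achieve. -/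
theorem Net.weight_flip_of_not_compat (ε : ℝ) {ζ : ι → ℕ} {N : Set ι} (hN : ¬ G.Compat ζ N) :
    G.weight (stepKernel ε) (flip N fun x => (ζ x : ℤ)) = 0 := by
  simp only [Net.Compat, not_forall] at hN
  obtain ⟨e, he, hs, ht, hst⟩ := hN
  refine Finset.prod_eq_zero he ?_
  simp only [stepKernel, flip]
  apply stepWeight_of_two_le
  split_ifs with h1 h2 h2
  · tauto
  · rw [le_abs]; omega
  · rw [le_abs]; omega
  · tauto

variable [DecidableEq ι]

theorem Net.mem_signs_iff_compat {D : Finset ι} {ζ : ι → ℕ} (hζ : ∀ x, x ∉ D → ζ x = 0)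
    {N : Finset ι} (hN : N ⊆ D.filter fun x => ζ x ≠ 0) :
    N ∈ G.signs (D.filter fun x => ζ x ≠ 0) ↔ G.Compat ζ N := by
  have key : ∀ x, x ∈ (D.filter fun x => ζ x ≠ 0) ↔ ζ x ≠ 0 := by
    intro x
    have := hζ x
    rw [Finset.mem_filter]
    tauto
  simp only [Net.mem_signs, hN, true_and, key, Net.Compat, Finset.mem_coe]

/-- The total weight of the height functions with a given absolute value. -/
theorem Net.sum_weight_absH_eq (ε : ℝ) {L : ℕ} {D : Finset ι} {ζ : ι → ℕ}
    (hζ : ∀ x, x ∉ D → ζ x = 0) (hL : ∀ x, ζ x ≤ L) [DecidablePred fun h : ι → ℤ => absH h = ζ] :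
    ∑ h ∈ cfg L D with absH h = ζ, G.weight (stepKernel ε) h =
      G.weight (stepKernel ε) (fun x => (ζ x : ℤ)) *
        ((G.signs (D.filter fun x => ζ x ≠ 0)).card : ℝ) := by
  classical
  set A := D.filter fun x => ζ x ≠ 0 with hA
  -- Given |h| = ζ, the function h is encoded by its negative set, an arbitrary subset of the
  -- support; below, the incompatible subsets turn out to have weight zero.
  have h1 : ∑ h ∈ cfg L D with absH h = ζ, G.weight (stepKernel ε) h =
      ∑ N ∈ A.powerset, G.weight (stepKernel ε) (flip (N : Set ι) fun x => (ζ x : ℤ)) := by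
    symm
    refine Finset.sum_nbij' (fun N => flip (N : Set ι) fun x => (ζ x : ℤ))
      (fun h => A.filter fun x => h x < 0) ?_ ?_ ?_ ?_ ?_
    · intro N _
      rw [Finset.mem_filter, mem_cfg, absH_flip]
      refine ⟨⟨fun x hx => ?_, fun x => ?_⟩, ?_⟩
      · simp [flip, hζ x hx]
      · have := hL x
        simp only [flip]; split_ifs <;> simpa using this
      · funext x; simp [absH]
    · intro h _
      exact Finset.mem_powerset.2 (Finset.filter_subset _ _)
    · intro N hN
      ext x
      have h2 : x ∈ N → x ∈ A := fun h => Finset.mem_powerset.1 hN h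
      simp only [hA, Finset.mem_filter, flip, Finset.mem_coe] at h2 ⊢
      by_cases hx : x ∈ N
      · have h3 := h2 hx
        simp only [hx, if_true, iff_true]
        refine ⟨h3, by omega⟩
      · simp only [hx, if_false, iff_false]
        omega
    · intro h hh
      rw [Finset.mem_filter, mem_cfg] at hh
      funext x
      have h2 : (h x).natAbs = ζ x := congrFun hh.2 x
      have h3 := hh.1.1 x
      simp only [flip, Finset.coe_filter, Set.mem_ofPred_eq, hA, Finset.mem_filter]
      split_ifs with h4
      · omega
      · by_cases hx : x ∈ D
        · by_cases h5 : ζ x = 0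
          · omega
          · have : ¬ h x < 0 := fun h6 => h4 ⟨⟨hx, h5⟩, h6⟩
            omega
        · have := h3 hx; omega
    · intro N _; rfl
  rw [h1]
  have h2 : ∀ N ∈ A.powerset, G.weight (stepKernel ε) (flip (N : Set ι) fun x => (ζ x : ℤ)) =
      if N ∈ G.signs A then G.weight (stepKernel ε) (fun x => (ζ x : ℤ)) else 0 := by
    intro N hN
    have h3 := G.mem_signs_iff_compat hζ (Finset.mem_powerset.1 hN)
    split_ifs with h4
    · apply G.weight_flip
      have : absH (fun x => (ζ x : ℤ)) = ζ := by funext x; simp [absH]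
      rw [this]
      exact h3.1 h4
    · exact G.weight_flip_of_not_compat ε fun h5 => h4 (h3.2 h5)
  rw [Finset.sum_congr rfl h2, ← Finset.sum_filter, Finset.sum_const, nsmul_eq_mul, mul_comm]
  congr 3
  ext N
  rw [Finset.mem_filter, Finset.mem_powerset]
  exact ⟨fun h => h.2, fun h => ⟨(G.mem_signs.1 h).1, h⟩⟩

/-- On a crossing edge each of ζ and ξ is positive at an end where the other vanishes, which is the
strict case of `stepWeight_lattice`. The factor 2 gained there pays for the loss in
`Net.card_signs_mul_le`. -/
theorem Net.weight_mul_weight_le {ε : ℝ} (hε : 0 ≤ ε) (hε' : ε ≤ 1 / 2) (D : Finset ι)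
    (ζ ξ : ι → ℕ) :
    G.weight (stepKernel ε) (fun x => (ζ x : ℤ)) * G.weight (stepKernel ε) (fun x => (ξ x : ℤ)) *
      2 ^ (G.crossing (D.filter fun x => ζ x ≠ 0) (D.filter fun x => ξ x ≠ 0)).card ≤
    G.weight (stepKernel ε) (fun x => ((ζ ⊓ ξ) x : ℤ)) *
      G.weight (stepKernel ε) (fun x => ((ζ ⊔ ξ) x : ℤ)) := by
  classical
  simp only [Net.weight]
  rw [Net.crossing, ← Finset.prod_const, Finset.prod_filter, ← Finset.prod_mul_distrib,
    ← Finset.prod_mul_distrib, ← Finset.prod_mul_distrib]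
  refine Finset.prod_le_prod (fun e _ => ?_) fun e _ => ?_
  · refine mul_nonneg (mul_nonneg (stepKernel_nonneg hε _ _) (stepKernel_nonneg hε _ _)) ?_
    split_ifs <;> norm_num
  · refine le_trans ?_ (stepWeight_lattice hε hε' (ζ (G.s e)) (ζ (G.t e)) (ξ (G.s e)) (ξ (G.t e)))
    refine mul_le_mul_of_nonneg_left ?_
      (mul_nonneg (stepKernel_nonneg hε _ _) (stepKernel_nonneg hε _ _))
    simp only [Finset.mem_sdiff, Finset.mem_filter]
    split_ifs with h1 h2 h2
    · rfl
    · exfalso; apply h2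
      rcases h1 with ⟨⟨⟨a1, a2⟩, a3⟩, ⟨b1, b2⟩, b3⟩ | ⟨⟨⟨a1, a2⟩, a3⟩, ⟨b1, b2⟩, b3⟩
      · have a4 : ξ (G.s e) = 0 := by by_contra h; exact a3 ⟨a1, h⟩
        have b4 : ζ (G.t e) = 0 := by by_contra h; exact b3 ⟨b1, h⟩
        right; omega
      · have a4 : ζ (G.s e) = 0 := by by_contra h; exact a3 ⟨a1, h⟩
        have b4 : ξ (G.t e) = 0 := by by_contra h; exact b3 ⟨b1, h⟩
        left; omega
    · norm_num
    · rfl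

/-- The FKG inequality for the absolute value of the height function. -/
theorem Net.fkg {ε : ℝ} (hε : 0 ≤ ε) (hε' : ε ≤ 1 / 2) (L : ℕ) (D : Finset ι)
    {f g : (ι → ℕ) → ℝ} (hf0 : ∀ ζ, 0 ≤ f ζ) (hg0 : ∀ ζ, 0 ≤ g ζ) (hf : Monotone f)
    (hg : Monotone g) :
    G.part (stepKernel ε) L D (fun h => f (absH h)) *
        G.part (stepKernel ε) L D (fun h => g (absH h)) ≤
      G.part (stepKernel ε) L D (fun _ => 1) *
        G.part (stepKernel ε) L D (fun h => f (absH h) * g (absH h)) := by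
  classical
  -- Absolute values are encoded in the finite distributive lattice `D → Fin (L + 1)`, where the
  -- general FKG theorem applies to the push-forward μ of the weight.
  set ext : (D → Fin (L + 1)) → ι → ℕ := fun ζ x => if hx : x ∈ D then (ζ ⟨x, hx⟩ : ℕ) else 0
    with hext
  have ext0 : ∀ ζ x, x ∉ D → ext ζ x = 0 := fun ζ x hx => by simp [hext, hx]
  have extL : ∀ ζ x, ext ζ x ≤ L := fun ζ x => by
    simp only [hext]; split_ifs
    · omega
    · omega
  have extmono : Monotone ext := fun ζ ξ h x => by
    simp only [hext]; split_ifs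
    · exact h _
    · exact le_rfl
  have extinf : ∀ ζ ξ, ext (ζ ⊓ ξ) = ext ζ ⊓ ext ξ := fun ζ ξ => by
    funext x; simp only [hext, Pi.inf_apply]; split_ifs
    · exact (Fin.val_strictMono.monotone).map_inf _ _
    · simp
  have extsup : ∀ ζ ξ, ext (ζ ⊔ ξ) = ext ζ ⊔ ext ξ := fun ζ ξ => by
    funext x; simp only [hext, Pi.sup_apply]; split_ifs
    · exact (Fin.val_strictMono.monotone).map_sup _ _
    · simp
  set μ : (D → Fin (L + 1)) → ℝ := fun ζ =>
    ∑ h ∈ cfg L D with absH h = ext ζ, G.weight (stepKernel ε) h with hμ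
  have hμ' : ∀ ζ, μ ζ = G.weight (stepKernel ε) (fun x => (ext ζ x : ℤ)) *
        ((G.signs (D.filter fun x => ext ζ x ≠ 0)).card : ℝ) := fun ζ =>
    G.sum_weight_absH_eq ε (ext0 ζ) (extL ζ)
  have hpart : ∀ F : (ι → ℕ) → ℝ, G.part (stepKernel ε) L D (fun h => F (absH h)) =
      ∑ ζ, μ ζ * F (ext ζ) := by
    intro F
    rw [Net.part, ← Finset.sum_fiberwise (cfg L D)
      (fun h => (fun x : D => Fin.ofNat (L + 1) (absH h x) : D → Fin (L + 1)))]
    refine Finset.sum_congr rfl fun ζ _ => ?_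
    rw [hμ, Finset.sum_mul]
    have : ∀ h ∈ cfg L D,
        ((fun x : D => Fin.ofNat (L + 1) (absH h x) : D → Fin (L + 1)) = ζ ↔
          absH h = ext ζ) := by
      intro h hh
      rw [mem_cfg] at hh
      constructor
      · rintro rfl
        funext x
        by_cases hx : x ∈ D
        · have : absH h x ≤ L := hh.2 x
          simp only [hext, hx, dite_true, Fin.ofNat]
          rw [Nat.mod_eq_of_lt (by omega)]
        · exact (show absH h x = 0 by simp [absH, hh.1 x hx]).trans (ext0 (fun x : D => Fin.ofNat (L + 1) (absH h x)) x hx).symm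
      · intro h1
        funext x
        apply Fin.ext
        have h2 := congrFun h1 x
        simp only [hext, x.2, dite_true] at h2
        rw [Fin.val_ofNat, h2]
        exact Nat.mod_eq_of_lt (ζ x).2
    rw [Finset.filter_congr this]
    refine Finset.sum_congr rfl fun h hh => ?_
    rw [(Finset.mem_filter.1 hh).2]
  have hμ0 : 0 ≤ μ := fun ζ => Finset.sum_nonneg fun h _ =>
    G.weight_nonneg (stepKernel_nonneg hε) h
  have hlat : ∀ ζ ξ, μ ζ * μ ξ ≤ μ (ζ ⊓ ξ) * μ (ζ ⊔ ξ) := by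
    intro ζ ξ
    rw [hμ', hμ', hμ', hμ', extinf, extsup]
    set A := D.filter fun x => ext ζ x ≠ 0 with hA
    set B := D.filter fun x => ext ξ x ≠ 0 with hB
    have e1 : (D.filter fun x => (ext ζ ⊓ ext ξ) x ≠ 0) = A ∩ B := by
      ext x
      simp only [hA, hB, Finset.mem_filter, Finset.mem_inter, Pi.inf_apply]
      constructor
      · rintro ⟨h1, h2⟩
        have : ext ζ x ⊓ ext ξ x ≤ ext ζ x := inf_le_left
        have : ext ζ x ⊓ ext ξ x ≤ ext ξ x := inf_le_right
        exact ⟨⟨h1, by omega⟩, h1, by omega⟩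
      · rintro ⟨⟨h1, h2⟩, -, h3⟩
        refine ⟨h1, ?_⟩
        rcases min_choice (ext ζ x) (ext ξ x) with h | h <;> rw [h] <;> assumption
    have e2 : (D.filter fun x => (ext ζ ⊔ ext ξ) x ≠ 0) = A ∪ B := by
      ext x
      simp only [hA, hB, Finset.mem_filter, Finset.mem_union, Pi.sup_apply]
      have h1 : ext ζ x ≤ ext ζ x ⊔ ext ξ x := le_sup_left
      have h2 : ext ξ x ≤ ext ζ x ⊔ ext ξ x := le_sup_right
      constructor
      · rintro ⟨h1, h2⟩
        rcases max_choice (ext ζ x) (ext ξ x) with h | h <;> rw [h] at h2 <;> tauto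
      · rintro (⟨h3, h4⟩ | ⟨h3, h4⟩)
        · exact ⟨h3, by omega⟩
        · exact ⟨h3, by omega⟩
    rw [e1, e2]
    have w := G.weight_mul_weight_le hε hε' D (ext ζ) (ext ξ)
    have s : ((G.signs A).card : ℝ) * (G.signs B).card ≤ 2 ^ (G.crossing A B).card *
        ((G.signs (A ∩ B)).card * (G.signs (A ∪ B)).card) := by
      exact_mod_cast G.card_signs_mul_le A B
    have p0 := G.weight_nonneg (stepKernel_nonneg hε) (fun x => (ext ζ x : ℤ))
    have p1 := G.weight_nonneg (stepKernel_nonneg hε) (fun x => (ext ξ x : ℤ))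
    calc _ = (G.weight (stepKernel ε) (fun x => (ext ζ x : ℤ)) *
          G.weight (stepKernel ε) (fun x => (ext ξ x : ℤ))) *
          (((G.signs A).card : ℝ) * (G.signs B).card) := by ring
      _ ≤ (G.weight (stepKernel ε) (fun x => (ext ζ x : ℤ)) *
          G.weight (stepKernel ε) (fun x => (ext ξ x : ℤ))) * (2 ^ (G.crossing A B).card *
        ((G.signs (A ∩ B)).card * (G.signs (A ∪ B)).card)) := by gcongr
      _ = (G.weight (stepKernel ε) (fun x => (ext ζ x : ℤ)) *
          G.weight (stepKernel ε) (fun x => (ext ξ x : ℤ)) * 2 ^ (G.crossing A B).card) *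
        ((G.signs (A ∩ B)).card * (G.signs (A ∪ B)).card) := by ring
      _ ≤ _ := mul_le_mul_of_nonneg_right w (by positivity)
      _ = _ := by ring
  rw [hpart f, hpart g, hpart (fun _ => 1), hpart (fun ζ => f ζ * g ζ)]
  simp only [mul_one]
  exact _root_.fkg (fun ζ => f (ext ζ)) (fun ζ => g (ext ζ)) μ hμ0 (fun ζ => hf0 _)
    (fun ζ => hg0 _) (hf.comp extmono) (hg.comp extmono) hlat

end Configurations

/-! ### Connectivity in the set where the height function does not vanish -/

section Connectivity

variable {ι 𝓔 : Type*} (G : Net ι 𝓔)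

/-- The vertices `a` and `b` are connected in the set where `ζ` is positive. -/
def Net.Conn (ζ : ι → ℕ) (a b : ι) : Prop :=
  ζ a ≠ 0 ∧ ζ b ≠ 0 ∧ ∀ N : Set ι, G.Compat ζ N → (a ∈ N ↔ b ∈ N)

variable {G}

theorem Net.Compat.anti {ζ ξ : ι → ℕ} (h : ζ ≤ ξ) {N : Set ι} (hN : G.Compat ξ N) :
    G.Compat ζ N := fun e he hs ht => by
  have h1 : ζ (G.s e) ≤ ξ (G.s e) := h _
  have h2 : ζ (G.t e) ≤ ξ (G.t e) := h _
  exact hN e he (by omega) (by omega)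

theorem Net.Conn.mono {ζ ξ : ι → ℕ} (h : ζ ≤ ξ) {a b : ι} (hab : G.Conn ζ a b) :
    G.Conn ξ a b := by
  have h1 : ζ a ≤ ξ a := h a
  have h2 : ζ b ≤ ξ b := h b
  have h3 := hab.1
  have h4 := hab.2.1
  exact ⟨by omega, by omega, fun N hN => hab.2.2 N (hN.anti h)⟩

theorem Net.Conn.trans {ζ : ι → ℕ} {a b c : ι} (hab : G.Conn ζ a b) (hbc : G.Conn ζ b c) :
    G.Conn ζ a c :=
  ⟨hab.1, hbc.2.1, fun N hN => (hab.2.2 N hN).trans (hbc.2.2 N hN)⟩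

/-- Connectivity is defined through separating sets rather than paths, so moving along an edge is
immediate from compatibility. -/
theorem Net.Conn.step {ζ : ι → ℕ} {o : ι} {e : 𝓔} (he : e ∈ G.E) (hs : ζ (G.s e) ≠ 0)
    (ht : ζ (G.t e) ≠ 0) : G.Conn ζ o (G.s e) ↔ G.Conn ζ o (G.t e) :=
  ⟨fun h => ⟨h.1, ht, fun N hN => (h.2.2 N hN).trans (hN e he hs ht)⟩,
    fun h => ⟨h.1, hs, fun N hN => (h.2.2 N hN).trans (hN e he hs ht).symm⟩⟩

variable (G)

open Classical in
/-- The indicator function of the event that `a` and `b` are connected. -/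
noncomputable def Net.connInd (a b : ι) (ζ : ι → ℕ) : ℝ := if G.Conn ζ a b then 1 else 0

theorem Net.connInd_nonneg (a b : ι) (ζ : ι → ℕ) : 0 ≤ G.connInd a b ζ := by
  unfold Net.connInd; split_ifs <;> norm_num

theorem Net.connInd_le_one (a b : ι) (ζ : ι → ℕ) : G.connInd a b ζ ≤ 1 := by
  unfold Net.connInd; split_ifs <;> norm_num

theorem Net.connInd_mono (a b : ι) : Monotone (G.connInd a b) := fun ζ ξ h => by
  unfold Net.connInd
  by_cases h1 : G.Conn ζ a b
  · rw [if_pos h1, if_pos (h1.mono h)]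
  · rw [if_neg h1]; split_ifs <;> norm_num

theorem Net.connInd_mul_le (a b c : ι) (ζ : ι → ℕ) :
    G.connInd a b ζ * G.connInd b c ζ ≤ G.connInd a c ζ := by
  unfold Net.connInd
  by_cases h1 : G.Conn ζ a b
  · by_cases h2 : G.Conn ζ b c
    · rw [if_pos h1, if_pos h2, if_pos (h1.trans h2), mul_one]
    · rw [if_neg h2, mul_zero]; split_ifs <;> norm_num
  · rw [if_neg h1, zero_mul]; split_ifs <;> norm_num

/-- Conditionally on the absolute value, the signs at `a` and `b` agree if `a` and `b` are connected
and have zero correlation otherwise. -/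
theorem Net.part_sign_mul_sign (ε : ℝ) (L : ℕ) (D : Finset ι) (a b : ι) (F : (ι → ℕ) → ℝ) :
    G.part (stepKernel ε) L D (fun h => ((h a).sign : ℝ) * ((h b).sign : ℝ) * F (absH h)) =
      G.part (stepKernel ε) L D (fun h => G.connInd a b (absH h) * F (absH h)) := by
  classical
  rw [← sub_eq_zero, Net.part, Net.part, ← Finset.sum_sub_distrib]
  set P : (ι → ℕ) → Prop := fun ζ => ∃ N, G.Compat ζ N ∧ ¬ (a ∈ N ↔ b ∈ N) with hP
  -- The separating set to flip is chosen as a function of |h| alone; flipping preserves |h|, so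
  -- this defines an involution.
  set N : (ι → ℕ) → Set ι := fun ζ => if H : P ζ then H.choose else ∅ with hN
  have hN1 : ∀ ζ, P ζ → G.Compat ζ (N ζ) ∧ ¬ (a ∈ N ζ ↔ b ∈ N ζ) := by
    intro ζ H
    simp only [hN, H, dite_true]
    exact H.choose_spec
  have key : ∀ h, (G.weight (stepKernel ε) h * (((h a).sign : ℝ) * ((h b).sign : ℝ) * F (absH h)) -
      G.weight (stepKernel ε) h * (G.connInd a b (absH h) * F (absH h))) +
      (G.weight (stepKernel ε) (flip (N (absH h)) h) *
        (((flip (N (absH h)) h a).sign : ℝ) * ((flip (N (absH h)) h b).sign : ℝ) *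
          F (absH (flip (N (absH h)) h))) -
      G.weight (stepKernel ε) (flip (N (absH h)) h) *
        (G.connInd a b (absH (flip (N (absH h)) h)) * F (absH (flip (N (absH h)) h)))) = 0 := by
    intro h
    by_cases H : P (absH h)
    · obtain ⟨h1, h2⟩ := hN1 _ H
      have h3 : G.connInd a b (absH h) = 0 := if_neg fun h4 => h2 (h4.2.2 _ h1)
      rw [G.weight_flip ε h1, absH_flip, h3]
      have h4 : ((flip (N (absH h)) h a).sign : ℝ) * ((flip (N (absH h)) h b).sign : ℝ) =
          - (((h a).sign : ℝ) * ((h b).sign : ℝ)) := by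
        simp only [flip]
        by_cases ha : a ∈ N (absH h)
        · have hb : b ∉ N (absH h) := by tauto
          rw [if_pos ha, if_neg hb, Int.sign_neg]; push_cast; ring
        · have hb : b ∈ N (absH h) := by tauto
          rw [if_neg ha, if_pos hb, Int.sign_neg]; push_cast; ring
      rw [h4]; ring
    · have h1 : N (absH h) = ∅ := by simp [hN, H]
      have h2 : flip (∅ : Set ι) h = h := by funext x; simp [flip]
      rw [h1, h2]
      have h3 : G.weight (stepKernel ε) h * (((h a).sign : ℝ) * ((h b).sign : ℝ)) =
          G.weight (stepKernel ε) h * G.connInd a b (absH h) := by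
        by_cases h4 : h a = 0
        · simp [h4, Net.connInd, Net.Conn, absH]
        by_cases h5 : h b = 0
        · simp [h5, Net.connInd, Net.Conn, absH]
        simp only [hP, not_exists, not_and, not_not] at H
        have h6 : G.Conn (absH h) a b := ⟨by simpa [absH], by simpa [absH], H⟩
        rw [Net.connInd, if_pos h6]
        -- Either the negative set of h is compatible, and then connectedness forces equal signs at
        -- a and b, or h has weight zero.
        by_cases h7 : G.Compat (absH h) {x | h x < 0}
        · have h8 := H _ h7
          simp only [Set.mem_ofPred_eq] at h8
          rcases lt_or_gt_of_ne h4 with h9 | h9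
          · rw [Int.sign_eq_neg_one_of_neg h9, Int.sign_eq_neg_one_of_neg (h8.1 h9)]
            norm_num
          · have h10 : 0 < h b := by
              by_contra h11
              have := h8.2 (by omega)
              omega
            rw [Int.sign_eq_one_of_pos h9, Int.sign_eq_one_of_pos h10]
            norm_num
        · have h8 := G.weight_flip_of_not_compat ε h7
          have h9 : flip {x | h x < 0} (fun x => (absH h x : ℤ)) = h := by
            funext x
            simp only [flip, Set.mem_ofPred_eq, absH]
            split_ifs <;> omega
          rw [h9] at h8
          rw [h8, zero_mul, zero_mul]
      linear_combination (2 * F (absH h)) * h3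
  refine Finset.sum_involution (fun h _ => flip (N (absH h)) h) (fun h _ => key h) ?_ ?_ ?_
  -- At a fixed point the pairing identity says that twice the term vanishes.
  · intro h _ h1 h2
    have h3 := key h
    rw [h2] at h3
    exact h1 (by linarith)
  · intro h hh
    rw [mem_cfg] at *
    refine ⟨fun x hx => ?_, fun x => ?_⟩
    · simp [flip, hh.1 x hx]
    · have := hh.2 x
      simp only [flip]; split_ifs <;> simpa using this
  · intro h _
    rw [absH_flip, flip_flip]

variable [DecidableEq ι]

/-- The smaller domain arises from the larger one by conditioning on h = 0 off D. The complement of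
this event is increasing in |h|, so FKG says that the conditioning lowers the expectation of an
increasing f. The inequality is cross-multiplied to avoid quotients. -/
theorem Net.part_le_part_of_monotone {ε : ℝ} (hε : 0 ≤ ε) (hε' : ε ≤ 1 / 2) (L : ℕ)
    {D D' : Finset ι} (hD : D ⊆ D') {f : (ι → ℕ) → ℝ} (hf0 : ∀ ζ, 0 ≤ f ζ) (hf : Monotone f) :
    G.part (stepKernel ε) L D (fun h => f (absH h)) * G.part (stepKernel ε) L D' (fun _ => 1) ≤
      G.part (stepKernel ε) L D' (fun h => f (absH h)) *
        G.part (stepKernel ε) L D (fun _ => 1) := by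
  classical
  set g : (ι → ℕ) → ℝ := fun ζ => if ∃ x, x ∉ D ∧ ζ x ≠ 0 then 1 else 0 with hg
  have hres : ∀ F : (ι → ℤ) → ℝ, G.part (stepKernel ε) L D' (fun h => F h * g (absH h)) =
      G.part (stepKernel ε) L D' F - G.part (stepKernel ε) L D F := by
    intro F
    have h1 : G.part (stepKernel ε) L D F = ∑ h ∈ cfg L D', G.weight (stepKernel ε) h *
        (F h * (1 - g (absH h))) := by
      refine Finset.sum_subset_zero_on_sdiff (cfg_mono L hD) (fun h hh => ?_) fun h hh => ?_
      · rw [Finset.mem_sdiff, mem_cfg, mem_cfg] at hh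
        have : ∃ x, x ∉ D ∧ absH h x ≠ 0 := by
          by_contra h2
          push Not at h2
          exact hh.2 ⟨fun x hx => by simpa [absH] using h2 x hx, hh.1.2⟩
        simp only [hg, this, if_true]; ring
      · rw [mem_cfg] at hh
        have : ¬ ∃ x, x ∉ D ∧ absH h x ≠ 0 := by
          rintro ⟨x, hx, h2⟩
          exact h2 (by simp [absH, hh.1 x hx])
        simp only [hg, this, if_false]; ring
    rw [h1, Net.part, Net.part, ← Finset.sum_sub_distrib]
    exact Finset.sum_congr rfl fun h _ => by ring
  have h1 := G.fkg hε hε' L D' (f := f) (g := g) hf0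
    (fun ζ => by simp only [hg]; split_ifs <;> norm_num) hf (fun ζ ξ h => by
      simp only [hg]
      by_cases h2 : ∃ x, x ∉ D ∧ ζ x ≠ 0
      · obtain ⟨x, hx, h3⟩ := h2
        have h4 : ζ x ≤ ξ x := h x
        rw [if_pos ⟨x, hx, h3⟩, if_pos ⟨x, hx, by omega⟩]
      · rw [if_neg h2]; split_ifs <;> norm_num)
  have h2 := hres fun h => f (absH h)
  have h3 := hres fun _ => 1
  simp only [one_mul] at h3
  rw [h2, h3] at h1
  linarith

theorem Net.part_le_part_of_antitone {ε : ℝ} (hε : 0 ≤ ε) (hε' : ε ≤ 1 / 2) (L : ℕ)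
    {D D' : Finset ι} (hD : D ⊆ D') {f : (ι → ℕ) → ℝ} (hf1 : ∀ ζ, f ζ ≤ 1) (hf : Antitone f) :
    G.part (stepKernel ε) L D' (fun h => f (absH h)) * G.part (stepKernel ε) L D (fun _ => 1) ≤
      G.part (stepKernel ε) L D (fun h => f (absH h)) *
        G.part (stepKernel ε) L D' (fun _ => 1) := by
  have h1 := G.part_le_part_of_monotone hε hε' L hD (f := fun ζ => 1 - f ζ)
    (fun ζ => sub_nonneg.2 (hf1 ζ)) (fun ζ ξ h => sub_le_sub_left (hf h) 1)
  have h2 : ∀ D, G.part (stepKernel ε) L D (fun h => 1 - f (absH h)) =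
      G.part (stepKernel ε) L D (fun _ => 1) - G.part (stepKernel ε) L D fun h => f (absH h) := by
    intro D
    rw [Net.part, Net.part, Net.part, ← Finset.sum_sub_distrib]
    exact Finset.sum_congr rfl fun h _ => by ring
  rw [h2, h2] at h1
  linarith

/-- Both connection events are increasing, so FKG bounds the product by their joint occurrence,
which connects a to c. -/
theorem Net.part_conn_mul_le {ε : ℝ} (hε : 0 ≤ ε) (hε' : ε ≤ 1 / 2) (L : ℕ) (D : Finset ι)
    (a b c : ι) :
    G.part (stepKernel ε) L D (fun h => G.connInd a b (absH h)) *
        G.part (stepKernel ε) L D (fun h => G.connInd b c (absH h)) ≤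
      G.part (stepKernel ε) L D (fun _ => 1) *
        G.part (stepKernel ε) L D (fun h => G.connInd a c (absH h)) :=
  (G.fkg hε hε' L D (G.connInd_nonneg a b) (G.connInd_nonneg b c) (G.connInd_mono a b)
    (G.connInd_mono b c)).trans (mul_le_mul_of_nonneg_left
      (G.part_mono (stepKernel_nonneg hε) L D fun _ _ => G.connInd_mul_le a b c _)
      (G.part_nonneg (stepKernel_nonneg hε) L D fun _ => zero_le_one))

end Connectivity

/-! ### Comparison of the cluster of a vertex in two domains -/

section Cluster

variable {ι 𝓔 : Type*} (G : Net ι 𝓔)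

open Classical in
/-- The restriction of `h` to the cluster of `o`. -/
noncomputable def Net.cluster (o : ι) (h : ι → ℤ) : ι → ℤ :=
  fun x => if G.Conn (absH h) o x then h x else 0

variable {G}

theorem absH_cluster_le (o : ι) (h : ι → ℤ) : absH (G.cluster o h) ≤ absH h := fun x => by
  simp only [absH, Net.cluster]; split_ifs <;> simp

/-- No edge with nonzero heights at both ends leaves the cluster. Hence a set compatible with the
restricted field, intersected with the cluster, is compatible with the whole field. -/
theorem conn_cluster {o x : ι} {h : ι → ℤ} :
    G.Conn (absH (G.cluster o h)) o x ↔ G.Conn (absH h) o x := by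
  refine ⟨fun hc => hc.mono (absH_cluster_le o h), fun hc => ?_⟩
  have ho : G.Conn (absH h) o o := ⟨hc.1, hc.1, fun _ _ => Iff.rfl⟩
  have key : ∀ y, G.Conn (absH h) o y → absH (G.cluster o h) y ≠ 0 := fun y hy => by
    simp only [absH, Net.cluster, hy, if_true]
    exact hy.2.1
  refine ⟨key o ho, key x hc, fun N hN => ?_⟩
  have h1 := hc.2.2 {y | G.Conn (absH h) o y ∧ y ∈ N} fun e he hs ht => by
    have h2 := Net.Conn.step (o := o) he hs ht
    simp only [Set.mem_ofPred_eq]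
    by_cases h3 : G.Conn (absH h) o (G.s e)
    · have h4 := h2.1 h3
      simp only [h3, h4, true_and]
      exact hN e he (key _ h3) (key _ h4)
    · have h4 : ¬ G.Conn (absH h) o (G.t e) := fun h5 => h3 (h2.2 h5)
      simp only [h3, h4, false_and]
  simpa only [Set.mem_ofPred_eq, ho, hc, true_and] using h1

theorem cluster_cluster (o : ι) (h : ι → ℤ) : G.cluster o (G.cluster o h) = G.cluster o h := by
  classical
  funext x
  conv_lhs => unfold Net.cluster
  by_cases hx : G.Conn (absH h) o x
  · have h1 := conn_cluster.2 hx
    unfold Net.cluster at h1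
    simp only [h1, if_true, hx, Net.cluster]
  · have h1 : ¬ G.Conn (absH (G.cluster o h)) o x := fun h2 => hx (conn_cluster.1 h2)
    unfold Net.cluster at h1
    simp only [h1, if_false, hx, Net.cluster]

variable (G) in
/-- The vertex `o`, the support of `η`, and the vertices adjacent to the support of `η`. -/
def Net.Nbhd (o : ι) (η : ι → ℤ) (x : ι) : Prop :=
  x = o ∨ η x ≠ 0 ∨ ∃ e ∈ G.E, (G.s e = x ∧ η (G.t e) ≠ 0) ∨ (G.t e = x ∧ η (G.s e) ≠ 0)

/-- A vertex of nonzero height that belongs or is adjacent to the cluster lies in it. The vertex o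
is included to cover the empty cluster, which means h(o) = 0. -/
theorem sub_cluster_eq_zero {o : ι} {h : ι → ℤ} {x : ι} (hx : G.Nbhd o (G.cluster o h) x) :
    h x - G.cluster o h x = 0 := by
  classical
  by_cases h0 : h x = 0
  · simp [Net.cluster, h0]
  have key : ∀ y, G.cluster o h y ≠ 0 → G.Conn (absH h) o y := fun y hy => by
    by_contra h1
    exact hy (by simp [Net.cluster, h1])
  suffices h1 : G.Conn (absH h) o x by simp [Net.cluster, h1]
  have h0' : absH h x ≠ 0 := by simpa [absH] using h0
  rcases hx with rfl | hx | ⟨e, he, ⟨rfl, hx⟩ | ⟨rfl, hx⟩⟩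
  · exact ⟨h0', h0', fun _ _ => Iff.rfl⟩
  · exact key x hx
  · exact (Net.Conn.step he h0' (key _ hx).2.1).2 (key _ hx)
  · exact (Net.Conn.step he (key _ hx).2.1 h0').1 (key _ hx)

/-- The converse of `sub_cluster_eq_zero`: a field that vanishes on and next to the support of η,
and at o, can be added without enlarging the cluster. Together they make the decomposition by
clusters a bijection. -/
theorem cluster_add {o : ι} {η h : ι → ℤ} (hη : G.cluster o η = η)
    (hh : ∀ x, G.Nbhd o η x → h x = 0) : G.cluster o (η + h) = η := by
  classical
  have hsupp : ∀ x, η x ≠ 0 → h x = 0 := fun x hx => hh x (Or.inr (Or.inl hx))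
  have key : ∀ x, G.Conn (absH (η + h)) o x ↔ η x ≠ 0 := by
    intro x
    constructor
    · intro hc hx
      by_cases ho : η o = 0
      · exact hc.1 (by simp [absH, ho, hh o (Or.inl rfl)])
      have h1 := hc.2.2 {y | η y ≠ 0} fun e he hs ht => by
        simp only [Set.mem_ofPred_eq]
        simp only [absH, Pi.add_apply, ne_eq, Int.natAbs_eq_zero] at hs ht
        constructor
        · intro h2 h3
          exact ht (by rw [h3, hh _ (Or.inr (Or.inr ⟨e, he, Or.inr ⟨rfl, h2⟩⟩)), add_zero])
        · intro h2 h3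
          exact hs (by rw [h3, hh _ (Or.inr (Or.inr ⟨e, he, Or.inl ⟨rfl, h2⟩⟩)), add_zero])
      simp only [Set.mem_ofPred_eq] at h1
      exact (h1.1 ho) hx
    · intro hx
      have h1 : G.Conn (absH η) o x := by
        by_contra h2
        rw [← hη] at hx
        exact hx (by simp [Net.cluster, h2])
      refine h1.mono fun y => ?_
      by_cases hy : η y = 0
      · simp [absH, hy]
      · simp [absH, hsupp y hy]
  funext x
  simp only [Net.cluster, key]
  split_ifs with h1
  · simp [hsupp x h1]
  · simpa using (not_not.1 h1).symm

/-- Each edge sees only one of the two fields: if it meets the support of η, then h vanishes at both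
ends. Flat edges have weight 1, so the product splits. -/
theorem weight_add (ε : ℝ) {o : ι} {η h : ι → ℤ} (hh : ∀ x, G.Nbhd o η x → h x = 0) :
    G.weight (stepKernel ε) (η + h) =
      G.weight (stepKernel ε) η * G.weight (stepKernel ε) h := by
  simp only [Net.weight]
  rw [← Finset.prod_mul_distrib]
  refine Finset.prod_congr rfl fun e he => ?_
  simp only [stepKernel, Pi.add_apply]
  by_cases hs : η (G.s e) = 0
  · by_cases ht : η (G.t e) = 0
    · simp [hs, ht]
    · simp [hh _ (Or.inr (Or.inl ht)), hh _ (Or.inr (Or.inr ⟨e, he, Or.inl ⟨rfl, ht⟩⟩))]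
  · simp [hh _ (Or.inr (Or.inl hs)), hh _ (Or.inr (Or.inr ⟨e, he, Or.inr ⟨rfl, hs⟩⟩))]

variable (G)

open Classical in
/-- Decomposition of an expectation according to the cluster of `o`. -/
theorem Net.part_cluster (ε : ℝ) (L : ℕ) {D D' : Finset ι} (hD : D ⊆ D') (o : ι)
    {F : (ι → ℤ) → ℝ} (hF : ∀ h, F (G.cluster o h) = F h) :
    G.part (stepKernel ε) L D'
        (fun h => F h * if ∀ x, G.Conn (absH h) o x → x ∈ D then 1 else 0) =
      ∑ η ∈ cfg L D with G.cluster o η = η, G.weight (stepKernel ε) η * F η *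
        G.part (stepKernel ε) L D' fun h =>
          if ∀ x, G.Nbhd o η x → absH h x = 0 then 1 else 0 := by
  simp only [Net.part, mul_ite, mul_one, mul_zero]
  rw [← Finset.sum_filter, ← Finset.sum_fiberwise_of_maps_to (g := G.cluster o)
    (t := (cfg L D).filter fun η => G.cluster o η = η)]
  · refine Finset.sum_congr rfl fun η hη => ?_
    rw [Finset.mem_filter, mem_cfg] at hη
    rw [← Finset.sum_filter, Finset.mul_sum]
    -- For a fixed cluster η, subtracting η leaves an arbitrary field on D' that vanishes on the
    -- neighbourhood of η.
    refine Finset.sum_nbij' (fun h => h - η) (fun h => η + h) ?_ ?_ ?_ ?_ ?_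
    · intro h hh
      rw [Finset.mem_filter, Finset.mem_filter, mem_cfg] at hh
      obtain ⟨⟨h1, h2⟩, rfl⟩ := hh
      rw [Finset.mem_filter, mem_cfg]
      refine ⟨⟨fun x hx => ?_, fun x => ?_⟩, fun x hx => ?_⟩
      · simp [Net.cluster, h1.1 x hx]
      · have := h1.2 x
        simp only [Net.cluster, Pi.sub_apply]
        split_ifs <;> simp [this]
      · simp only [absH, Pi.sub_apply, Int.natAbs_eq_zero]
        exact sub_cluster_eq_zero hx
    · intro h hh
      rw [Finset.mem_filter, mem_cfg] at hh
      have h0 : ∀ x, G.Nbhd o η x → h x = 0 := fun x hx => by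
        simpa [absH] using hh.2 x hx
      have h1 := cluster_add hη.2 h0
      rw [Finset.mem_filter, Finset.mem_filter, mem_cfg]
      refine ⟨⟨⟨fun x hx => ?_, fun x => ?_⟩, fun x hx => ?_⟩, h1⟩
      · simp [hh.1.1 x hx, hη.1.1 x (fun h => hx (hD h))]
      · by_cases hx : η x = 0
        · simpa [hx] using hh.1.2 x
        · simpa [h0 x (Or.inr (Or.inl hx))] using hη.1.2 x
      · by_contra h2
        have h3 := congrFun h1 x
        rw [hη.1.1 x h2] at h3
        simp only [Net.cluster, hx, if_true] at h3
        exact hx.2.1 (by simp only [absH, h3, Int.natAbs_zero])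
    · intro h _; simp
    · intro h _; simp
    · intro h hh
      rw [Finset.mem_filter, Finset.mem_filter] at hh
      obtain ⟨⟨h1, h2⟩, rfl⟩ := hh
      rw [hF]
      have h3 := weight_add ε (G := G) (o := o) (η := G.cluster o h) (h := h - G.cluster o h)
        fun x hx => sub_cluster_eq_zero hx
      rw [add_sub_cancel] at h3
      rw [h3]; ring
  · intro h hh
    rw [Finset.mem_filter, mem_cfg] at hh
    rw [Finset.mem_filter, mem_cfg]
    refine ⟨⟨fun x hx => ?_, fun x => ?_⟩, cluster_cluster o h⟩
    · simp only [Net.cluster]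
      rw [if_neg fun h1 => hx (hh.2 x h1)]
    · exact le_trans (absH_cluster_le o h x) (hh.1.2 x)

variable [DecidableEq ι]

-- Given its cluster η, the rest of the field contributes the probability that a field vanishes near
-- η. This event is decreasing in |h|, so it is more likely in the smaller domain. On D itself the
-- restriction on the cluster is automatic.
open Classical in
theorem Net.part_cluster_le {ε : ℝ} (hε : 0 ≤ ε) (hε' : ε ≤ 1 / 2) (L : ℕ) {D D' : Finset ι}
    (hD : D ⊆ D') (o : ι) {F : (ι → ℤ) → ℝ} (hF0 : ∀ h, 0 ≤ F h)
    (hF : ∀ h, F (G.cluster o h) = F h) :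
    G.part (stepKernel ε) L D'
        (fun h => F h * if ∀ x, G.Conn (absH h) o x → x ∈ D then 1 else 0) *
        G.part (stepKernel ε) L D (fun _ => 1) ≤
      G.part (stepKernel ε) L D F * G.part (stepKernel ε) L D' (fun _ => 1) := by
  have h1 : G.part (stepKernel ε) L D F = G.part (stepKernel ε) L D
        (fun h => F h * if ∀ x, G.Conn (absH h) o x → x ∈ D then 1 else 0) := by
    refine Finset.sum_congr rfl fun h hh => ?_
    rw [mem_cfg] at hh
    dsimp only
    rw [if_pos, mul_one]
    intro x hx
    by_contra h2
    exact hx.2.1 (by simp [absH, hh.1 x h2])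
  rw [h1, G.part_cluster ε L hD o hF, G.part_cluster ε L subset_rfl o hF, Finset.sum_mul,
    Finset.sum_mul]
  refine Finset.sum_le_sum fun η _ => ?_
  rw [mul_assoc, mul_assoc (_ * _)]
  refine mul_le_mul_of_nonneg_left ?_
    (mul_nonneg (G.weight_nonneg (stepKernel_nonneg hε) _) (hF0 _))
  refine G.part_le_part_of_antitone hε hε' L hD
    (f := fun ζ => if ∀ x, G.Nbhd o η x → ζ x = 0 then 1 else 0) (fun ζ => ?_) fun ζ ξ h => ?_
  · split_ifs <;> norm_num
  · dsimp only
    by_cases h2 : ∀ x, G.Nbhd o η x → ξ x = 0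
    · rw [if_pos h2, if_pos fun x hx => Nat.le_zero.1 ((h x).trans (h2 x hx).le)]
    · rw [if_neg h2]; split_ifs <;> norm_num

/-- If `b` is not in the domain `D k`, then the cluster of `o` can contain `b` only if it is not
contained in `D k`; decompose according to the first domain that contains it. -/
theorem Net.part_conn_le_sum {ε : ℝ} (hε : 0 ≤ ε) (hε' : ε ≤ 1 / 2) (L : ℕ) {D : ℕ → Finset ι}
    (hD : Monotone D) (o b : ι) {k n : ℕ} (hb : b ∉ D k) :
    G.part (stepKernel ε) L (D n)
        (fun h => (absH h o : ℝ) * (absH h b : ℝ) * G.connInd o b (absH h)) /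
        G.part (stepKernel ε) L (D n) (fun _ => 1) ≤
      ∑ j ∈ Finset.Ico k n, ∑ x ∈ D (j + 1) \ D j, G.part (stepKernel ε) L (D (j + 1))
        (fun h => (absH h o : ℝ) * (absH h b : ℝ) * G.connInd o x (absH h)) /
        G.part (stepKernel ε) L (D (j + 1)) (fun _ => 1) := by
  classical
  have hK := stepKernel_nonneg hε
  have hZ : ∀ D, 0 < G.part (stepKernel ε) L D (fun _ => 1) := fun D =>
    G.part_pos hK (by simp [stepKernel]) L D
  -- F j carries the indicator that the cluster of o leaves D j. It depends on h only through the
  -- cluster, as `Net.part_cluster_le` requires.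
  set F : ℕ → (ι → ℤ) → ℝ := fun j h => (absH h o : ℝ) * (absH h b : ℝ) *
    G.connInd o b (absH h) * if ∀ x, G.Conn (absH h) o x → x ∈ D j then 0 else 1 with hFdef
  have hF0 : ∀ j h, 0 ≤ F j h := fun j h => by
    refine mul_nonneg (mul_nonneg (by positivity) (G.connInd_nonneg _ _ _)) ?_
    split_ifs <;> norm_num
  have hF : ∀ j h, F j (G.cluster o h) = F j h := by
    intro j h
    simp only [hFdef, conn_cluster, Net.connInd]
    by_cases hc : G.Conn (absH h) o b
    · have ho : G.Conn (absH h) o o := ⟨hc.1, hc.1, fun _ _ => Iff.rfl⟩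
      simp only [absH, Net.cluster] at hc ho ⊢
      simp only [hc, ho, if_true]
    · simp only [hc, if_false, mul_zero, zero_mul]
  have step1 : G.part (stepKernel ε) L (D n)
      (fun h => (absH h o : ℝ) * (absH h b : ℝ) * G.connInd o b (absH h)) ≤
      ∑ j ∈ Finset.Ico k n, G.part (stepKernel ε) L (D n)
        (fun h => F j h * if ∀ x, G.Conn (absH h) o x → x ∈ D (j + 1) then 1 else 0) := by
    simp only [Net.part]
    rw [Finset.sum_comm]
    refine Finset.sum_le_sum fun h hh => ?_
    rw [← Finset.mul_sum]
    refine mul_le_mul_of_nonneg_left ?_ (G.weight_nonneg hK _)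
    have hnn : ∀ j, 0 ≤ F j h * if ∀ x, G.Conn (absH h) o x → x ∈ D (j + 1) then 1 else 0 :=
      fun j => mul_nonneg (hF0 j h) (by split_ifs <;> norm_num)
    by_cases hc : G.Conn (absH h) o b
    swap
    · rw [Net.connInd, if_neg hc, mul_zero]
      exact Finset.sum_nonneg fun j _ => hnn j
    -- The first domain that contains the cluster has index j + 1 with k ≤ j < n: the cluster
    -- contains b, which is not in D k, and it is contained in D n.
    have hex : ∃ m, ∀ x, G.Conn (absH h) o x → x ∈ D m := by
      refine ⟨n, fun x hx => ?_⟩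
      by_contra h1
      exact hx.2.1 (by simp [absH, (mem_cfg.1 hh).1 x h1])
    have hkm : k < Nat.find hex := by
      rw [Nat.lt_find_iff]
      intro m hm h1
      exact hb (hD hm (h1 b hc))
    have hmn : Nat.find hex ≤ n := by
      refine Nat.find_min' hex fun x hx => ?_
      by_contra h1
      exact hx.2.1 (by simp [absH, (mem_cfg.1 hh).1 x h1])
    obtain ⟨j, hj⟩ : ∃ j, Nat.find hex = j + 1 := ⟨Nat.find hex - 1, by omega⟩
    refine le_trans (le_of_eq ?_) (Finset.single_le_sum (fun j _ => hnn j)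
      (Finset.mem_Ico.2 ⟨by omega, by omega⟩ : j ∈ Finset.Ico k n))
    have h1 : ∀ x, G.Conn (absH h) o x → x ∈ D (j + 1) := hj ▸ Nat.find_spec hex
    have h2 : ¬ ∀ x, G.Conn (absH h) o x → x ∈ D j := Nat.find_min hex (by omega)
    simp only [hFdef, if_pos h1, if_neg h2, mul_one]
  have step2 : ∀ j ∈ Finset.Ico k n, G.part (stepKernel ε) L (D n)
        (fun h => F j h * if ∀ x, G.Conn (absH h) o x → x ∈ D (j + 1) then 1 else 0) /
        G.part (stepKernel ε) L (D n) (fun _ => 1) ≤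
      G.part (stepKernel ε) L (D (j + 1)) (F j) /
        G.part (stepKernel ε) L (D (j + 1)) (fun _ => 1) := by
    intro j hj
    rw [div_le_div_iff₀ (hZ _) (hZ _)]
    exact G.part_cluster_le hε hε' L (hD (Finset.mem_Ico.1 hj).2) o (hF0 j) (hF j)
  have step3 : ∀ j, G.part (stepKernel ε) L (D (j + 1)) (F j) ≤
      ∑ x ∈ D (j + 1) \ D j, G.part (stepKernel ε) L (D (j + 1))
        (fun h => (absH h o : ℝ) * (absH h b : ℝ) * G.connInd o x (absH h)) := by
    intro j
    simp only [Net.part]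
    rw [Finset.sum_comm]
    refine Finset.sum_le_sum fun h hh => ?_
    rw [← Finset.mul_sum]
    refine mul_le_mul_of_nonneg_left ?_ (G.weight_nonneg hK _)
    have hnn : ∀ x, 0 ≤ (absH h o : ℝ) * (absH h b : ℝ) * G.connInd o x (absH h) :=
      fun x => mul_nonneg (by positivity) (G.connInd_nonneg _ _ _)
    simp only [hFdef]
    split_ifs with h1
    · rw [mul_zero]
      exact Finset.sum_nonneg fun x _ => hnn x
    · push Not at h1
      obtain ⟨x, hx, hxj⟩ := h1
      have hx' : x ∈ D (j + 1) := by
        by_contra h1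
        exact hx.2.1 (by simp [absH, (mem_cfg.1 hh).1 x h1])
      refine le_trans ?_ (Finset.single_le_sum (fun x _ => hnn x) (Finset.mem_sdiff.2 ⟨hx', hxj⟩))
      simp only [mul_one]
      refine mul_le_mul_of_nonneg_left ?_ (by positivity)
      rw [show G.connInd o x (absH h) = 1 from if_pos hx]
      exact G.connInd_le_one _ _ _
  calc _ ≤ (∑ j ∈ Finset.Ico k n, G.part (stepKernel ε) L (D n)
        (fun h => F j h * if ∀ x, G.Conn (absH h) o x → x ∈ D (j + 1) then 1 else 0)) /
          G.part (stepKernel ε) L (D n) (fun _ => 1) := by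
        exact div_le_div_of_nonneg_right step1 (hZ _).le
    _ = ∑ j ∈ Finset.Ico k n, G.part (stepKernel ε) L (D n)
        (fun h => F j h * if ∀ x, G.Conn (absH h) o x → x ∈ D (j + 1) then 1 else 0) /
          G.part (stepKernel ε) L (D n) (fun _ => 1) := Finset.sum_div _ _ _
    _ ≤ _ := by
        refine Finset.sum_le_sum fun j hj => (step2 j hj).trans ?_
        rw [← Finset.sum_div]
        exact div_le_div_of_nonneg_right (step3 j) (hZ _).le

end Cluster

/-! ### Subdivision of the edges -/

section Subdivision

variable {ι 𝓔 : Type*}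

/-- The height function along a path from height `a` to height `b` with interior heights `p`. -/
def pathVal {α : Type*} {M : ℕ} (a b : α) (p : Fin M → α) : Fin (M + 2) → α :=
  Fin.cons (α := fun _ => α) a (Fin.snoc (α := fun _ => α) p b)

theorem pathVal_comp {α γ : Type*} {M : ℕ} (f : α → γ) (a b : α) (p : Fin M → α) (i : Fin (M + 2)) :
    f (pathVal a b p i) = pathVal (f a) (f b) (fun j => f (p j)) i := by
  refine Fin.cases ?_ (fun i => ?_) i
  · rfl
  · simp only [pathVal, Fin.cons_succ]
    refine Fin.lastCases ?_ (fun i => ?_) i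
    · simp
    · simp

/-- The total weight of the paths of `M + 1` steps from `a` to `b` with interior heights
bounded by `L`. -/
noncomputable def pathKernel (K : ℤ → ℤ → ℝ) (L M : ℕ) (a b : ℤ) : ℝ :=
  ∑ p ∈ Fintype.piFinset fun _ : Fin M => Finset.Icc (-(L : ℤ)) L,
    ∏ i : Fin (M + 1), K (pathVal a b p i.castSucc) (pathVal a b p i.succ)

/-- The graph obtained by subdividing every edge into `M + 1` pieces. -/
def Net.subdiv (G : Net ι 𝓔) (M : ℕ) : Net (ι ⊕ 𝓔 × Fin M) (𝓔 × Fin (M + 1)) where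
  E := G.E ×ˢ Finset.univ
  s e := pathVal (Sum.inl (G.s e.1)) (Sum.inl (G.t e.1)) (fun i => Sum.inr (e.1, i)) e.2.castSucc
  t e := pathVal (Sum.inl (G.s e.1)) (Sum.inl (G.t e.1)) (fun i => Sum.inr (e.1, i)) e.2.succ

/-- The domain of the subdivided graph: the vertices of `D` and all the new vertices. -/
def Net.subdivDom (G : Net ι 𝓔) (M : ℕ) (D : Finset ι) : Finset (ι ⊕ 𝓔 × Fin M) :=
  D.disjSum (G.E ×ˢ Finset.univ)

/-- Expanding the product over edges of sums over paths assigns interior heights to each edge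
independently. All new vertices are in the domain, so their heights are free up to the cutoff L. -/
theorem Net.part_subdiv (G : Net ι 𝓔) (K : ℤ → ℤ → ℝ) (L M : ℕ) (D : Finset ι)
    (f : (ι → ℤ) → ℝ) :
    (G.subdiv M).part K L (G.subdivDom M D) (fun h => f fun x => h (Sum.inl x)) =
      G.part (pathKernel K L M) L D f := by
  classical
  simp only [Net.part, Net.weight, pathKernel]
  simp_rw [Finset.prod_sum, Finset.sum_mul]
  rw [← Finset.sum_product']
  refine Finset.sum_nbij' (fun h => (fun x => h (Sum.inl x), fun e _ i => h (Sum.inr (e, i))))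
    (fun p => Sum.elim p.1 fun y => if hy : y.1 ∈ G.E then p.2 y.1 hy y.2 else 0) ?_ ?_ ?_ ?_ ?_
  · intro h hh
    rw [mem_cfg] at hh
    simp only [Finset.mem_product, mem_cfg, Finset.mem_pi, Fintype.mem_piFinset, Finset.mem_Icc]
    refine ⟨⟨fun x hx => hh.1 _ ?_, fun x => hh.2 _⟩, fun e he i => ?_⟩
    · simpa [Net.subdivDom] using hx
    · have := hh.2 (Sum.inr (e, i))
      omega
  · rintro ⟨g, q⟩ hp
    simp only [Finset.mem_product, mem_cfg, Finset.mem_pi, Fintype.mem_piFinset,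
      Finset.mem_Icc] at hp
    rw [mem_cfg]
    refine ⟨?_, ?_⟩
    · rintro (x | ⟨e, i⟩) hx
      · exact hp.1.1 x (by simpa [Net.subdivDom] using hx)
      · have : e ∉ G.E := by simpa [Net.subdivDom] using hx
        simp [this]
    · rintro (x | ⟨e, i⟩)
      · exact hp.1.2 x
      · by_cases he : e ∈ G.E
        · have := hp.2 e he i
          simp only [Sum.elim_inr, he, dite_true]
          omega
        · simp [he]
  · intro h hh
    rw [mem_cfg] at hh
    funext y
    rcases y with x | ⟨e, i⟩
    · rfl
    · by_cases he : e ∈ G.E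
      · simp [he]
      · simp only [Sum.elim_inr, he, dite_false]
        exact (hh.1 _ (by simpa [Net.subdivDom] using he)).symm
  · rintro ⟨g, q⟩ hp
    refine Prod.ext rfl ?_
    funext e he i
    simp [he]
  · intro h _
    dsimp only
    congr 1
    rw [Net.subdiv, Finset.prod_product, ← Finset.prod_attach]
    refine Finset.prod_congr rfl fun e _ => ?_
    refine Finset.prod_congr rfl fun i _ => ?_
    dsimp only
    rw [pathVal_comp h, pathVal_comp h]

theorem pathKernel_nonneg {K : ℤ → ℤ → ℝ} (hK : ∀ a b, 0 ≤ K a b) (L M : ℕ) (a b : ℤ) :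
    0 ≤ pathKernel K L M a b :=
  Finset.sum_nonneg fun _ _ => Finset.prod_nonneg fun _ _ => hK _ _

theorem pathKernel_pos {K : ℤ → ℤ → ℝ} (hK : ∀ a b, 0 ≤ K a b) (h0 : 0 < K 0 0) (L M : ℕ) :
    0 < pathKernel K L M 0 0 := by
  refine Finset.sum_pos' (fun _ _ => Finset.prod_nonneg fun _ _ => hK _ _)
    ⟨fun _ => 0, by simp, Finset.prod_pos fun i _ => ?_⟩
  have : ∀ i, pathVal (0 : ℤ) 0 (fun _ : Fin M => 0) i = 0 := fun i =>
    (pathVal_comp (fun _ : Unit => (0 : ℤ)) () () (fun _ : Fin M => ()) i).symm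
  rw [this, this]
  exact h0

theorem pathKernel_zero (K : ℤ → ℤ → ℝ) (L : ℕ) (a b : ℤ) : pathKernel K L 0 a b = K a b := by
  simp [pathKernel, pathVal, Fin.snoc]

theorem pathKernel_succ (K : ℤ → ℤ → ℝ) (L M : ℕ) (a b : ℤ) : pathKernel K L (M + 1) a b =
    ∑ c ∈ Finset.Icc (-(L : ℤ)) L, K a c * pathKernel K L M c b := by
  simp only [pathKernel, Finset.mul_sum]
  rw [← Finset.sum_product']
  refine Finset.sum_nbij' (fun p => (p 0, fun i => p i.succ))
    (fun q => Fin.cons (α := fun _ => ℤ) q.1 q.2) ?_ ?_ ?_ ?_ ?_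
  · intro p hp
    rw [Fintype.mem_piFinset] at hp
    simp only [Finset.mem_product, Fintype.mem_piFinset]
    exact ⟨hp 0, fun i => hp i.succ⟩
  · rintro ⟨c, q⟩ hq
    simp only [Finset.mem_product, Fintype.mem_piFinset] at hq
    rw [Fintype.mem_piFinset]
    refine Fin.cases ?_ fun i => ?_
    · exact hq.1
    · exact hq.2 i
  · intro p _
    funext i
    refine Fin.cases ?_ (fun i => ?_) i <;> rfl
  · rintro ⟨c, q⟩ _; rfl
  · intro p _
    have key : ∀ i : Fin (M + 2), pathVal a b p i.succ =
        pathVal (p 0) b (fun i => p i.succ) i := by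
      intro i
      simp only [pathVal, Fin.cons_succ]
      refine Fin.cases ?_ (fun i => ?_) i
      · rw [Fin.cons_zero, ← Fin.castSucc_zero, Fin.snoc_castSucc]
      · rw [Fin.cons_succ]
        refine Fin.lastCases ?_ (fun j => ?_) i
        · rw [Fin.succ_last, Fin.snoc_last, Fin.snoc_last]
        · rw [Fin.succ_castSucc, Fin.snoc_castSucc, Fin.snoc_castSucc]
    rw [Fin.prod_univ_succ]
    refine congrArg₂ _ rfl (Finset.prod_congr rfl fun i _ => ?_)
    rw [← Fin.succ_castSucc, key, key]

end Subdivision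

/-! ### Inequalities for height functions weighted by a path kernel -/

section PathInequalities

variable {ι 𝓔 : Type*} (G : Net ι 𝓔)

/-- The product of the signs of the heights at `a` and `b`. -/
noncomputable def signProd (a b : ι) (h : ι → ℤ) : ℝ := ((h a).sign : ℝ) * ((h b).sign : ℝ)

/-- The product of the heights at `a` and `b`. -/
noncomputable def heightProd (a b : ι) (h : ι → ℤ) : ℝ := (h a : ℝ) * (h b : ℝ)

open Classical in
/-- The absolute value of the product of the heights at `a` and `b`, restricted to the event
that one of the heights exceeds `R`. -/
noncomputable def tailProd (R : ℝ) (a b : ι) (h : ι → ℤ) : ℝ :=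
  if |(h a : ℝ)| ≤ R ∧ |(h b : ℝ)| ≤ R then 0 else |(h a : ℝ)| * |(h b : ℝ)|

theorem natCast_absH (h : ι → ℤ) (x : ι) : (absH h x : ℝ) = |(h x : ℝ)| := by
  rw [absH, Nat.cast_natAbs, Int.cast_abs]

theorem Net.part_signProd (ε : ℝ) (L : ℕ) (D : Finset ι) (a b : ι) :
    G.part (stepKernel ε) L D (signProd a b) =
      G.part (stepKernel ε) L D fun h => G.connInd a b (absH h) := by
  have h1 := G.part_sign_mul_sign ε L D a b fun _ => 1
  simp only [mul_one] at h1
  exact h1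

/-- Write h = sign(h) |h| and apply `Net.part_sign_mul_sign` with F the product of the two absolute
values. -/
theorem Net.part_heightProd (ε : ℝ) (L : ℕ) (D : Finset ι) (a b : ι) :
    G.part (stepKernel ε) L D (heightProd a b) = G.part (stepKernel ε) L D fun h =>
      (absH h a : ℝ) * (absH h b : ℝ) * G.connInd a b (absH h) := by
  have h1 := G.part_sign_mul_sign ε L D a b fun ζ => (ζ a : ℝ) * (ζ b : ℝ)
  have h2 : ∀ z : ℤ, (z.sign : ℝ) * |(z : ℝ)| = z := fun z => by
    rw [← Int.cast_abs, ← Int.cast_mul, Int.sign_mul_abs]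
  have h3 : heightProd a b = fun h : ι → ℤ =>
      ((h a).sign : ℝ) * ((h b).sign : ℝ) * ((absH h a : ℝ) * (absH h b : ℝ)) := by
    funext h
    rw [natCast_absH, natCast_absH, heightProd]
    nth_rewrite 1 [← h2 (h a)]
    nth_rewrite 1 [← h2 (h b)]
    ring
  rw [h3, h1]
  exact congrArg _ (funext fun h => mul_comm _ _)

variable {ε : ℝ} (L M : ℕ)

theorem Net.part_path_one (D : Finset ι) : G.part (pathKernel (stepKernel ε) L M) L D (fun _ => 1) =
    (G.subdiv M).part (stepKernel ε) L (G.subdivDom M D) (fun _ => 1) :=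
  (G.part_subdiv (stepKernel ε) L M D fun _ => 1).symm

theorem Net.part_path_signProd (D : Finset ι) (a b : ι) :
    G.part (pathKernel (stepKernel ε) L M) L D (signProd a b) =
    (G.subdiv M).part (stepKernel ε) L (G.subdivDom M D) (signProd (Sum.inl a) (Sum.inl b)) :=
  (G.part_subdiv (stepKernel ε) L M D (signProd a b)).symm

theorem Net.part_path_heightProd (D : Finset ι) (a b : ι) :
    G.part (pathKernel (stepKernel ε) L M) L D (heightProd a b) =
    (G.subdiv M).part (stepKernel ε) L (G.subdivDom M D) (heightProd (Sum.inl a) (Sum.inl b)) :=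
  (G.part_subdiv (stepKernel ε) L M D (heightProd a b)).symm

theorem Net.part_path_tailProd (R : ℝ) (D : Finset ι) (a b : ι) :
    G.part (pathKernel (stepKernel ε) L M) L D (tailProd R a b) =
    (G.subdiv M).part (stepKernel ε) L (G.subdivDom M D) (tailProd R (Sum.inl a) (Sum.inl b)) :=
  (G.part_subdiv (stepKernel ε) L M D (tailProd R a b)).symm

theorem Net.subdivDom_mono {D D' : Finset ι} (hD : D ⊆ D') :
    G.subdivDom M D ⊆ G.subdivDom M D' := Finset.disjSum_mono hD subset_rfl

theorem Net.part_path_signProd_nonneg (hε : 0 ≤ ε) (D : Finset ι) (a b : ι) :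
    0 ≤ G.part (pathKernel (stepKernel ε) L M) L D (signProd a b) := by
  rw [Net.part_path_signProd, Net.part_signProd]
  exact Net.part_nonneg _ (stepKernel_nonneg hε) _ _ fun h => Net.connInd_nonneg _ _ _ _

/-- Connected points have nonzero integer heights, so the product of their absolute values is at
least 1. -/
theorem Net.part_path_signProd_le_heightProd (hε : 0 ≤ ε) (D : Finset ι) (a b : ι) :
    G.part (pathKernel (stepKernel ε) L M) L D (signProd a b) ≤
      G.part (pathKernel (stepKernel ε) L M) L D (heightProd a b) := by
  rw [Net.part_path_signProd, Net.part_signProd, Net.part_path_heightProd, Net.part_heightProd]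
  refine Net.part_mono _ (stepKernel_nonneg hε) _ _ fun h _ => ?_
  by_cases hc : (G.subdiv M).Conn (absH h) (Sum.inl a) (Sum.inl b)
  · have h1 : (1 : ℝ) ≤ absH h (Sum.inl a) := by
      exact_mod_cast Nat.one_le_iff_ne_zero.2 hc.1
    have h2 : (1 : ℝ) ≤ absH h (Sum.inl b) := by
      exact_mod_cast Nat.one_le_iff_ne_zero.2 hc.2.1
    exact le_mul_of_one_le_left (Net.connInd_nonneg _ _ _ _)
      (by nlinarith)
  · simp [Net.connInd, hc]

variable [DecidableEq ι]

theorem Net.part_path_signProd_mono (hε : 0 ≤ ε) (hε' : ε ≤ 1 / 2) {D D' : Finset ι}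
    (hD : D ⊆ D') (a b : ι) :
    G.part (pathKernel (stepKernel ε) L M) L D (signProd a b) *
        G.part (pathKernel (stepKernel ε) L M) L D' (fun _ => 1) ≤
      G.part (pathKernel (stepKernel ε) L M) L D' (signProd a b) *
        G.part (pathKernel (stepKernel ε) L M) L D (fun _ => 1) := by
  classical
  simp only [Net.part_path_signProd, Net.part_signProd, Net.part_path_one]
  exact Net.part_le_part_of_monotone _ hε hε' L (G.subdivDom_mono M hD)
    (Net.connInd_nonneg _ _ _) (Net.connInd_mono _ _ _)

theorem Net.part_path_heightProd_mono (hε : 0 ≤ ε) (hε' : ε ≤ 1 / 2) {D D' : Finset ι}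
    (hD : D ⊆ D') (a b : ι) :
    G.part (pathKernel (stepKernel ε) L M) L D (heightProd a b) *
        G.part (pathKernel (stepKernel ε) L M) L D' (fun _ => 1) ≤
      G.part (pathKernel (stepKernel ε) L M) L D' (heightProd a b) *
        G.part (pathKernel (stepKernel ε) L M) L D (fun _ => 1) := by
  classical
  simp only [Net.part_path_heightProd, Net.part_heightProd, Net.part_path_one]
  refine Net.part_le_part_of_monotone _ hε hε' L (G.subdivDom_mono M hD)
    (f := fun ζ => (ζ (Sum.inl a) : ℝ) * (ζ (Sum.inl b) : ℝ) *
      (G.subdiv M).connInd (Sum.inl a) (Sum.inl b) ζ)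
    (fun ζ => mul_nonneg (by positivity) (Net.connInd_nonneg _ _ _ _)) fun ζ ξ h => ?_
  have h1 : (ζ (Sum.inl a) : ℝ) ≤ ξ (Sum.inl a) := by exact_mod_cast h _
  have h2 : (ζ (Sum.inl b) : ℝ) ≤ ξ (Sum.inl b) := by exact_mod_cast h _
  exact mul_le_mul (mul_le_mul h1 h2 (Nat.cast_nonneg _) (Nat.cast_nonneg _))
    (Net.connInd_mono _ _ _ h) (Net.connInd_nonneg _ _ _ _) (by positivity)

theorem Net.part_path_signProd_mul_le (hε : 0 ≤ ε) (hε' : ε ≤ 1 / 2) (D : Finset ι)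
    (a b c : ι) :
    G.part (pathKernel (stepKernel ε) L M) L D (signProd a b) *
        G.part (pathKernel (stepKernel ε) L M) L D (signProd b c) ≤
      G.part (pathKernel (stepKernel ε) L M) L D (fun _ => 1) *
        G.part (pathKernel (stepKernel ε) L M) L D (signProd a c) := by
  classical
  simp only [Net.part_path_signProd, Net.part_signProd, Net.part_path_one]
  exact Net.part_conn_mul_le _ hε hε' L _ _ _ _

/-- Here the unbounded factor is removed: |h(o) h(b)| is at most R² unless a height exceeds R, so a
connection probability and a tail remain. The truncation R may depend on the scale j. -/
theorem Net.part_path_heightProd_le_sum (hε : 0 ≤ ε) (hε' : ε ≤ 1 / 2) {D : ℕ → Finset ι}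
    (hD : Monotone D) (o b : ι) {k n : ℕ} (hb : b ∉ D k) (R : ℕ → ℝ) :
    G.part (pathKernel (stepKernel ε) L M) L (D n) (heightProd o b) /
        G.part (pathKernel (stepKernel ε) L M) L (D n) (fun _ => 1) ≤
      ∑ j ∈ Finset.Ico k n, ∑ x ∈ D (j + 1) \ D j,
        (R j ^ 2 * (G.part (pathKernel (stepKernel ε) L M) L (D (j + 1)) (signProd o x) /
          G.part (pathKernel (stepKernel ε) L M) L (D (j + 1)) (fun _ => 1)) +
        G.part (pathKernel (stepKernel ε) L M) L (D (j + 1)) (tailProd (R j) o b) /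
          G.part (pathKernel (stepKernel ε) L M) L (D (j + 1)) (fun _ => 1)) := by
  classical
  simp only [Net.part_path_signProd, Net.part_signProd, Net.part_path_one,
    Net.part_path_heightProd, Net.part_heightProd, Net.part_path_tailProd]
  refine (Net.part_conn_le_sum (G.subdiv M) hε hε' L (D := fun j => G.subdivDom M (D j))
    (fun i j h => G.subdivDom_mono M (hD h)) (Sum.inl o) (Sum.inl b) (k := k) ?_).trans ?_
  · simpa [Net.subdivDom] using hb
  refine Finset.sum_le_sum fun j _ => ?_
  -- The subdivision vertices belong to every domain, so the shells consist of original vertices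
  -- only.
  have hsd : G.subdivDom M (D (j + 1)) \ G.subdivDom M (D j) =
      (D (j + 1) \ D j).map ⟨Sum.inl, Sum.inl_injective⟩ := by
    ext x
    rcases x with x | x
    · simp [Net.subdivDom]
    · simp [Net.subdivDom]
  rw [hsd, Finset.sum_map]
  refine Finset.sum_le_sum fun x _ => ?_
  rw [← mul_div_assoc, ← add_div]
  refine div_le_div_of_nonneg_right ?_ (Net.part_nonneg _ (stepKernel_nonneg hε) _ _
    fun _ => zero_le_one)
  rw [Net.part, Net.part, Net.part, Finset.mul_sum, ← Finset.sum_add_distrib]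
  refine Finset.sum_le_sum fun h _ => ?_
  have hW := (G.subdiv M).weight_nonneg (stepKernel_nonneg hε) h
  have hc0 := (G.subdiv M).connInd_nonneg (Sum.inl o) (Sum.inl x) (absH h)
  have hc1 := (G.subdiv M).connInd_le_one (Sum.inl o) (Sum.inl x) (absH h)
  rw [mul_left_comm (R j ^ 2), ← mul_add]
  refine mul_le_mul_of_nonneg_left ?_ hW
  simp only [Function.Embedding.coeFn_mk, natCast_absH]
  unfold tailProd
  have p1 := abs_nonneg (h (Sum.inl o) : ℝ)
  have p2 := abs_nonneg (h (Sum.inl b) : ℝ)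
  split_ifs with hR
  · rw [add_zero]
    refine mul_le_mul_of_nonneg_right ?_ hc0
    rw [sq]
    exact mul_le_mul hR.1 hR.2 p2 (p1.trans hR.1)
  · have h1 := mul_le_of_le_one_right (mul_nonneg p1 p2) hc1
    have h2 := mul_nonneg (sq_nonneg (R j)) hc0
    linarith

end PathInequalities

/-! ### The edge weight as a limit of path kernels -/

section Kernel

/-- The number of simple random walk paths of length `m` from `0` to `k`. -/
noncomputable def walkCount (m : ℕ) (k : ℤ) : ℝ :=
  ∑ p ∈ Finset.HasAntidiagonal.antidiagonal m, (m.choose p.1 : ℝ) * if (p.1 : ℤ) - p.2 = k then 1 else 0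

/-- The weight of an edge with height difference `k`: a modified Bessel function of `2 * t`. -/
noncomputable def edgeWeight (t : ℝ) (k : ℤ) : ℝ :=
  ∑' m : ℕ, t ^ m / (m.factorial : ℝ) * walkCount m k

/-- The total weight of the paths of `N` steps of size at most one from `0` to `k`. -/
noncomputable def lazyWeight (ε : ℝ) (N : ℕ) (k : ℤ) : ℝ :=
  ∑ p ∈ Finset.HasAntidiagonal.antidiagonal N, (N.choose p.1 : ℝ) * (ε ^ p.1 * walkCount p.1 k)

theorem walkCount_nonneg (m : ℕ) (k : ℤ) : 0 ≤ walkCount m k :=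
  Finset.sum_nonneg fun p _ => mul_nonneg (Nat.cast_nonneg _) (by split_ifs <;> norm_num)

theorem walkCount_le (m : ℕ) (k : ℤ) : walkCount m k ≤ 2 ^ m := by
  have h1 : walkCount m k ≤ ∑ p ∈ Finset.HasAntidiagonal.antidiagonal m, (m.choose p.1 : ℝ) :=
    Finset.sum_le_sum fun p _ => mul_le_of_le_one_right (Nat.cast_nonneg _)
      (by split_ifs <;> norm_num)
  refine h1.trans (le_of_eq ?_)
  rw [Finset.Nat.sum_antidiagonal_eq_sum_range_succ_mk]
  exact_mod_cast Nat.sum_range_choose m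

theorem walkCount_zero (k : ℤ) : walkCount 0 k = if k = 0 then 1 else 0 := by
  simp [walkCount, eq_comm]

theorem walkCount_succ (m : ℕ) (k : ℤ) :
    walkCount (m + 1) k = walkCount m (k - 1) + walkCount m (k + 1) := by
  simp only [walkCount]
  rw [Finset.sum_antidiagonal_choose_succ_mul
    (fun i j => if ((i : ℕ) : ℤ) - (j : ℕ) = k then (1 : ℝ) else 0) m, add_comm]
  congr 1
  · refine Finset.sum_congr rfl fun p hp => ?_
    rw [Finset.HasAntidiagonal.mem_antidiagonal] at hp
    rw [← Nat.choose_symm_of_eq_add (show m = p.1 + p.2 by omega)]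
    congr 2
    push_cast
    rw [eq_iff_iff]
    constructor <;> intro h <;> linarith
  · refine Finset.sum_congr rfl fun p _ => ?_
    congr 2
    push_cast
    rw [eq_iff_iff]
    constructor <;> intro h <;> linarith

theorem lazyWeight_zero (ε : ℝ) (k : ℤ) : lazyWeight ε 0 k = if k = 0 then 1 else 0 := by
  simp [lazyWeight, walkCount_zero]

theorem lazyWeight_succ (ε : ℝ) (N : ℕ) (k : ℤ) : lazyWeight ε (N + 1) k =
    lazyWeight ε N k + ε * (lazyWeight ε N (k - 1) + lazyWeight ε N (k + 1)) := by
  simp only [lazyWeight]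
  rw [Finset.sum_antidiagonal_choose_succ_mul (fun i _ => ε ^ i * walkCount i k) N]
  congr 1
  rw [← Finset.sum_add_distrib, Finset.mul_sum]
  refine Finset.sum_congr rfl fun p hp => ?_
  rw [Finset.HasAntidiagonal.mem_antidiagonal] at hp
  rw [← Nat.choose_symm_of_eq_add (show N = p.1 + p.2 by omega), walkCount_succ]
  ring

theorem lazyWeight_nonneg {ε : ℝ} (hε : 0 ≤ ε) (N : ℕ) (k : ℤ) : 0 ≤ lazyWeight ε N k :=
  Finset.sum_nonneg fun _ _ => mul_nonneg (Nat.cast_nonneg _)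
    (mul_nonneg (pow_nonneg hε _) (walkCount_nonneg _ _))

theorem lazyWeight_one (ε : ℝ) (k : ℤ) : lazyWeight ε 1 k = stepWeight ε k := by
  rw [show (1 : ℕ) = 0 + 1 from rfl, lazyWeight_succ, lazyWeight_zero, lazyWeight_zero,
    lazyWeight_zero, stepWeight]
  by_cases h0 : k = 0
  · subst h0; norm_num
  by_cases h1 : k = 1
  · subst h1; norm_num
  by_cases h2 : k = -1
  · subst h2; norm_num
  have h3 : ¬ |k| = 1 := by rw [abs_eq (by norm_num)]; tauto
  rw [if_neg h0, if_neg h0, if_neg h3, if_neg (by omega), if_neg (by omega)]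
  ring

theorem sum_stepWeight_eq (ε : ℝ) {S : Finset ℤ} {a : ℤ} (h0 : a ∈ S) (h1 : a - 1 ∈ S)
    (h2 : a + 1 ∈ S) (φ : ℤ → ℝ) :
    ∑ c ∈ S, stepWeight ε (a - c) * φ c = φ a + ε * (φ (a - 1) + φ (a + 1)) := by
  have : ∑ c ∈ S, stepWeight ε (a - c) * φ c =
      ∑ c ∈ {a, a - 1, a + 1}, stepWeight ε (a - c) * φ c := by
    symm
    refine Finset.sum_subset (fun c hc => ?_) fun c _ hc => ?_
    · simp only [Finset.mem_insert, Finset.mem_singleton] at hc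
      rcases hc with rfl | rfl | rfl <;> assumption
    · simp only [Finset.mem_insert, Finset.mem_singleton] at hc
      rw [stepWeight_of_two_le, zero_mul]
      rw [le_abs]; omega
  rw [this, Finset.sum_insert, Finset.sum_insert, Finset.sum_singleton]
  · have e1 : a - (a - 1) = 1 := by ring
    have e2 : a - (a + 1) = -1 := by ring
    rw [sub_self, e1, e2, stepWeight_zero, stepWeight_neg]
    simp only [stepWeight]
    norm_num
    ring
  · simp only [Finset.mem_singleton]; omega
  · simp only [Finset.mem_insert, Finset.mem_singleton]; omega

/-- The cutoff L on the interior heights only discards paths. -/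
theorem pathKernel_step_le {ε : ℝ} (hε : 0 ≤ ε) (L M : ℕ) (a b : ℤ) :
    pathKernel (stepKernel ε) L M a b ≤ lazyWeight ε (M + 1) (a - b) := by
  induction M generalizing a with
  | zero => rw [pathKernel_zero, zero_add, lazyWeight_one]; exact le_rfl
  | succ M ih =>
    rw [pathKernel_succ, lazyWeight_succ]
    -- Once the range of summation contains a and a ± 1, the one-step sum is exactly the recursion
    -- of `lazyWeight_succ`.
    set S : Finset ℤ := Finset.Icc (-(L : ℤ)) L ∪ {a, a - 1, a + 1}
    calc _ ≤ ∑ c ∈ Finset.Icc (-(L : ℤ)) L, stepWeight ε (a - c) * lazyWeight ε (M + 1) (c - b) :=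
          Finset.sum_le_sum fun c _ => mul_le_mul_of_nonneg_left (ih c) (stepWeight_nonneg hε _)
      _ ≤ ∑ c ∈ S, stepWeight ε (a - c) * lazyWeight ε (M + 1) (c - b) :=
          Finset.sum_le_sum_of_subset_of_nonneg Finset.subset_union_left fun c _ _ =>
            mul_nonneg (stepWeight_nonneg hε _) (lazyWeight_nonneg hε _ _)
      _ = _ := by
          rw [sum_stepWeight_eq ε (by simp [S]) (by simp [S]) (by simp [S])
            fun c => lazyWeight ε (M + 1) (c - b)]
          congr 4 <;> ring

/-- The M interior points of a path from a stay within distance M of a, so here the cutoff is not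
felt; the end point b is unconstrained. -/
theorem pathKernel_step_eq (ε : ℝ) (L M : ℕ) {a : ℤ} (b : ℤ) (ha : a.natAbs + M ≤ L) :
    pathKernel (stepKernel ε) L M a b = lazyWeight ε (M + 1) (a - b) := by
  induction M generalizing a with
  | zero => rw [pathKernel_zero, zero_add, lazyWeight_one]; rfl
  | succ M ih =>
    rw [pathKernel_succ, lazyWeight_succ]
    simp only [stepKernel]
    rw [sum_stepWeight_eq ε (by rw [Finset.mem_Icc]; omega) (by rw [Finset.mem_Icc]; omega)
      (by rw [Finset.mem_Icc]; omega) fun c => pathKernel (stepKernel ε) L M c b]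
    rw [ih (by omega), ih (by omega), ih (by omega)]
    congr 4 <;> ring

theorem summable_edgeWeight {t : ℝ} (ht : 0 ≤ t) (k : ℤ) :
    Summable fun m : ℕ => t ^ m / (m.factorial : ℝ) * walkCount m k := by
  refine Summable.of_nonneg_of_le (fun m => mul_nonneg (by positivity) (walkCount_nonneg _ _))
    (fun m => ?_) (Real.summable_pow_div_factorial (t * 2))
  rw [mul_pow, mul_div_right_comm]
  exact mul_le_mul_of_nonneg_left (walkCount_le m k) (by positivity)

theorem edgeWeight_nonneg {t : ℝ} (ht : 0 ≤ t) (k : ℤ) : 0 ≤ edgeWeight t k :=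
  tsum_nonneg fun m => mul_nonneg (by positivity) (walkCount_nonneg _ _)

theorem edgeWeight_zero_pos {t : ℝ} (ht : 0 ≤ t) : 0 < edgeWeight t 0 := by
  refine (summable_edgeWeight ht 0).tsum_pos
    (fun m => mul_nonneg (by positivity) (walkCount_nonneg _ _)) 0 ?_
  simp [walkCount_zero]

theorem lazyWeight_eq_tsum (ε : ℝ) (N : ℕ) (k : ℤ) :
    lazyWeight ε N k = ∑' m : ℕ, (N.choose m : ℝ) * ε ^ m * walkCount m k := by
  rw [tsum_eq_sum (s := Finset.range N.succ), lazyWeight,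
    Finset.Nat.sum_antidiagonal_eq_sum_range_succ_mk]
  · exact Finset.sum_congr rfl fun m _ => by ring
  · intro m hm
    rw [Nat.choose_eq_zero_of_lt (by simpa using hm)]
    simp

/-- The binomial weights lie below their Poisson limit for every N. This makes the limiting edge
weight an upper bound for all path kernels, and thus the dominating function in the limits below. -/
theorem choose_mul_pow_le {t : ℝ} (ht : 0 ≤ t) (N m : ℕ) :
    (N.choose m : ℝ) * (t / N) ^ m ≤ t ^ m / (m.factorial : ℝ) := by
  have h1 : (N.choose m : ℝ) ≤ (N : ℝ) ^ m / (m.factorial : ℝ) := Nat.choose_le_pow_div m N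
  calc _ ≤ (N : ℝ) ^ m / (m.factorial : ℝ) * (t / N) ^ m :=
        mul_le_mul_of_nonneg_right h1 (by positivity)
    _ = ((N : ℝ) * (t / N)) ^ m / (m.factorial : ℝ) := by rw [mul_pow]; ring
    _ ≤ _ := by
        gcongr
        rcases eq_or_ne (N : ℝ) 0 with h | h
        · simp [h, ht]
        · rw [mul_div_cancel₀ _ h]

theorem lazyWeight_le_edgeWeight {t : ℝ} (ht : 0 ≤ t) (N : ℕ) (k : ℤ) :
    lazyWeight (t / N) N k ≤ edgeWeight t k := by
  rw [lazyWeight_eq_tsum, edgeWeight]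
  have h1 : ∀ m, (N.choose m : ℝ) * (t / N) ^ m * walkCount m k ≤
      t ^ m / (m.factorial : ℝ) * walkCount m k := fun m =>
    mul_le_mul_of_nonneg_right (choose_mul_pow_le ht N m) (walkCount_nonneg _ _)
  have h2 := summable_edgeWeight ht k
  exact (h2.of_nonneg_of_le (fun m => mul_nonneg (by positivity) (walkCount_nonneg _ _))
    h1).tsum_le_tsum h1 h2

theorem tendsto_lazyWeight {t : ℝ} (ht : 0 ≤ t) (k : ℤ) :
    Tendsto (fun N : ℕ => lazyWeight (t / N) N k) atTop (𝓝 (edgeWeight t k)) := by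
  simp only [lazyWeight_eq_tsum, edgeWeight]
  refine tendsto_tsum_of_dominated_convergence (summable_edgeWeight ht k) (fun m => ?_)
    (Eventually.of_forall fun N m => ?_)
  · refine Tendsto.mul_const _ (tendsto_choose_mul_pow_atTop m ?_)
    refine tendsto_const_nhds.congr' ?_
    filter_upwards [eventually_gt_atTop 0] with N hN
    rw [mul_div_cancel₀ _ (by positivity)]
  · rw [Real.norm_of_nonneg (mul_nonneg (by positivity) (walkCount_nonneg _ _))]
    exact mul_le_mul_of_nonneg_right (choose_mul_pow_le ht N m) (walkCount_nonneg _ _)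

theorem pathKernel_le_edgeWeight {t : ℝ} (ht : 0 ≤ t) (L M : ℕ) (a b : ℤ) :
    pathKernel (stepKernel (t / (M + 1 : ℕ))) L M a b ≤ edgeWeight t (a - b) :=
  (pathKernel_step_le (by positivity) L M a b).trans (lazyWeight_le_edgeWeight ht _ _)

theorem tendsto_pathKernel {t : ℝ} (ht : 0 ≤ t) (a b : ℤ) :
    Tendsto (fun M : ℕ => pathKernel (stepKernel (t / (M + 1 : ℕ))) (2 * M) M a b) atTop
      (𝓝 (edgeWeight t (a - b))) := by
  refine ((tendsto_lazyWeight ht (a - b)).comp (tendsto_add_atTop_nat 1)).congr' ?_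
  filter_upwards [eventually_ge_atTop a.natAbs] with M hM
  exact (pathKernel_step_eq _ _ _ _ (by omega)).symm

end Kernel

/-! ### Passing to the limit -/

section Limit

variable {ι 𝓔 : Type*} (G : Net ι 𝓔)

/-- The weight of a height function in the limit. -/
noncomputable def Net.limWeight (t : ℝ) (h : ι → ℤ) : ℝ :=
  G.weight (fun a b => edgeWeight t (a - b)) h

open Classical in
/-- The summand of the non-normalised expectation of `f` in the limit. -/
noncomputable def Net.limTerm (t : ℝ) (D : Finset ι) (f : (ι → ℤ) → ℝ) (h : ι → ℤ) : ℝ :=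
  if ∀ x, x ∉ D → h x = 0 then G.limWeight t h * f h else 0

/-- The non-normalised expectation of `f` in the limit. -/
noncomputable def Net.limPart (t : ℝ) (D : Finset ι) (f : (ι → ℤ) → ℝ) : ℝ :=
  ∑' h : ι → ℤ, G.limTerm t D f h

theorem Net.limWeight_nonneg {t : ℝ} (ht : 0 ≤ t) (h : ι → ℤ) : 0 ≤ G.limWeight t h :=
  G.weight_nonneg (fun _ _ => edgeWeight_nonneg ht _) h

/-- Dominated convergence with the limiting summand as majorant. The height cutoff 2M grows with the
subdivision, so a fixed configuration, which takes finitely many values, is eventually admitted. -/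
theorem Net.tendsto_part {t : ℝ} (ht : 0 ≤ t) (D : Finset ι) {f : (ι → ℤ) → ℝ}
    (hf : Summable (G.limTerm t D f)) :
    Tendsto (fun M : ℕ => G.part (pathKernel (stepKernel (t / (M + 1 : ℕ))) (2 * M) M) (2 * M) D f)
      atTop (𝓝 (G.limPart t D f)) := by
  classical
  have h1 : ∀ M : ℕ, G.part (pathKernel (stepKernel (t / (M + 1 : ℕ))) (2 * M) M) (2 * M) D f =
      ∑' h, if h ∈ cfg (2 * M) D then
        G.weight (pathKernel (stepKernel (t / (M + 1 : ℕ))) (2 * M) M) h * f h else 0 := by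
    intro M
    rw [tsum_eq_sum (s := cfg (2 * M) D) fun h hh => if_neg hh, Net.part]
    exact Finset.sum_congr rfl fun h hh => (if_pos hh).symm
  simp only [h1]
  refine tendsto_tsum_of_dominated_convergence hf.norm (fun h => ?_)
    (Eventually.of_forall fun M h => ?_)
  · unfold Net.limTerm
    split_ifs with hD
    · have h2 : Tendsto (fun M : ℕ =>
          G.weight (pathKernel (stepKernel (t / (M + 1 : ℕ))) (2 * M) M) h * f h) atTop
          (𝓝 (G.limWeight t h * f h)) :=
        (tendsto_finsetProd _ fun e _ => tendsto_pathKernel ht _ _).mul_const _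
      refine h2.congr' ?_
      have hfin : (Set.range h).Finite := by
        refine ((D.image h ∪ {0}).finite_toSet).subset ?_
        rintro _ ⟨x, rfl⟩
        by_cases hx : x ∈ D
        · simpa using Or.inr ⟨x, hx, rfl⟩
        · simp [hD x hx]
      obtain ⟨B, hB⟩ := (hfin.image Int.natAbs).bddAbove
      filter_upwards [eventually_ge_atTop B] with M hM
      rw [if_pos]
      refine mem_cfg.2 ⟨hD, fun x => ?_⟩
      have := hB (Set.mem_image_of_mem _ (Set.mem_range_self x))
      omega
    · refine tendsto_const_nhds.congr fun M => ?_
      rw [if_neg fun h3 => hD (mem_cfg.1 h3).1]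
  · unfold Net.limTerm
    by_cases h2 : h ∈ cfg (2 * M) D
    · rw [if_pos h2, if_pos (mem_cfg.1 h2).1, norm_mul, norm_mul]
      refine mul_le_mul_of_nonneg_right ?_ (norm_nonneg _)
      rw [Real.norm_of_nonneg (G.limWeight_nonneg ht h), Real.norm_of_nonneg
        (G.weight_nonneg (fun _ _ => pathKernel_nonneg
          (stepKernel_nonneg (by positivity)) _ _ _ _) h)]
      exact Finset.prod_le_prod (fun e _ => pathKernel_nonneg
          (stepKernel_nonneg (by positivity)) _ _ _ _) fun e _ => pathKernel_le_edgeWeight ht _ _ _ _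
    · rw [if_neg h2, norm_zero]
      exact norm_nonneg _

end Limit

/-! ### Correlation inequalities for the Bessel weights -/

section LimitInequalities

variable {ι 𝓔 : Type*} (G : Net ι 𝓔)

/-- The expectation of `f` in the limit. -/
noncomputable def Net.av (t : ℝ) (D : Finset ι) (f : (ι → ℤ) → ℝ) : ℝ :=
  G.limPart t D f / G.limPart t D fun _ => 1

/-- The height functions on `D` form a probability measure with finite second moments. -/
structure Net.Tame (t : ℝ) (D : Finset ι) : Prop where
  one : Summable (G.limTerm t D fun _ => 1)
  heightProd : ∀ a b, Summable (G.limTerm t D (heightProd a b))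

variable {G} {t : ℝ}

theorem Net.abs_limTerm_le (D : Finset ι) {f g : (ι → ℤ) → ℝ}
    (hfg : ∀ h, |f h| ≤ |g h|) (h : ι → ℤ) : |G.limTerm t D f h| ≤ |G.limTerm t D g h| := by
  unfold Net.limTerm
  split_ifs
  · rw [abs_mul, abs_mul]
    exact mul_le_mul_of_nonneg_left (hfg h) (abs_nonneg _)
  · exact le_rfl

theorem Net.summable_limTerm_of_le {D : Finset ι} {f g : (ι → ℤ) → ℝ}
    (hfg : ∀ h, |f h| ≤ |g h|) (hg : Summable (G.limTerm t D g)) : Summable (G.limTerm t D f) :=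
  hg.norm.of_norm_bounded fun h => Net.abs_limTerm_le D hfg h

theorem abs_sign_le_one (z : ℤ) : |(z.sign : ℝ)| ≤ 1 := by
  rcases Int.sign_trichotomy z with h | h | h <;> rw [h] <;> norm_num

theorem Net.Tame.signProd {D : Finset ι} (hG : G.Tame t D) (a b : ι) :
    Summable (G.limTerm t D (signProd a b)) :=
  Net.summable_limTerm_of_le (fun h => by
    rw [XYHeight.signProd, abs_mul, abs_one]
    exact mul_le_one₀ (abs_sign_le_one _) (abs_nonneg _) (abs_sign_le_one _)) hG.one

theorem Net.Tame.tailProd {D : Finset ι} (hG : G.Tame t D) (R : ℝ) (a b : ι) :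
    Summable (G.limTerm t D (tailProd R a b)) :=
  Net.summable_limTerm_of_le (fun h => by
    unfold XYHeight.tailProd XYHeight.heightProd
    split_ifs
    · rw [abs_zero]; exact abs_nonneg _
    · simp [abs_mul]) (hG.heightProd a b)

theorem Net.limPart_one_pos (ht : 0 ≤ t) {D : Finset ι} (hG : G.Tame t D) :
    0 < G.limPart t D fun _ => 1 := by
  refine hG.one.tsum_pos (fun h => ?_) (fun _ => 0) ?_
  · unfold Net.limTerm
    split_ifs
    · exact mul_nonneg (G.limWeight_nonneg ht h) zero_le_one
    · exact le_rfl
  · unfold Net.limTerm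
    rw [if_pos fun _ _ => rfl, mul_one]
    exact Finset.prod_pos fun e _ => by simpa using edgeWeight_zero_pos ht

theorem Net.tendsto_av (ht : 0 ≤ t) {D : Finset ι} (hG : G.Tame t D) {f : (ι → ℤ) → ℝ}
    (hf : Summable (G.limTerm t D f)) :
    Tendsto (fun M : ℕ => G.part (pathKernel (stepKernel (t / (M + 1 : ℕ))) (2 * M) M) (2 * M) D f /
      G.part (pathKernel (stepKernel (t / (M + 1 : ℕ))) (2 * M) M) (2 * M) D fun _ => 1)
      atTop (𝓝 (G.av t D f)) :=
  (G.tendsto_part ht D hf).div (G.tendsto_part ht D hG.one) (Net.limPart_one_pos ht hG).ne'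

/-- FKG needs ε ≤ 1/2, which holds once the subdivision is fine enough; this suffices for
inequalities between limits. -/
theorem eventually_step_le (t : ℝ) : ∀ᶠ M : ℕ in atTop, t / (M + 1 : ℕ) ≤ 1 / 2 := by
  have h1 : Tendsto (fun M : ℕ => t / (M + 1 : ℕ)) atTop (𝓝 0) :=
    (tendsto_const_div_atTop_nhds_zero_nat t).comp (tendsto_add_atTop_nat 1)
  exact h1.eventually_le_const (by norm_num)

theorem part_path_one_pos (ht : 0 ≤ t) (L M : ℕ) (D : Finset ι) :
    0 < G.part (pathKernel (stepKernel (t / (M + 1 : ℕ))) L M) L D fun _ => 1 := by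
  have hε : 0 ≤ t / (M + 1 : ℕ) := by positivity
  have h1 := pathKernel_nonneg (stepKernel_nonneg hε) L M
  have h2 := pathKernel_pos (stepKernel_nonneg hε) (by simp [stepKernel]) L M
  exact G.part_pos h1 h2 L D

theorem Net.av_signProd_nonneg (ht : 0 ≤ t) {D : Finset ι} (hG : G.Tame t D) (a b : ι) :
    0 ≤ G.av t D (XYHeight.signProd a b) :=
  ge_of_tendsto' (Net.tendsto_av ht hG (hG.signProd a b)) fun M =>
    div_nonneg (G.part_path_signProd_nonneg _ _ (by positivity) _ _ _)
      (part_path_one_pos ht _ _ _).le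

theorem Net.av_signProd_le_heightProd (ht : 0 ≤ t) {D : Finset ι} (hG : G.Tame t D) (a b : ι) :
    G.av t D (XYHeight.signProd a b) ≤ G.av t D (XYHeight.heightProd a b) :=
  le_of_tendsto_of_tendsto' (Net.tendsto_av ht hG (hG.signProd a b))
    (Net.tendsto_av ht hG (hG.heightProd a b)) fun M =>
    div_le_div_of_nonneg_right (G.part_path_signProd_le_heightProd _ _ (by positivity) _ _ _)
      (part_path_one_pos ht _ _ _).le

variable [DecidableEq ι]

theorem Net.av_signProd_mono (ht : 0 ≤ t) {D D' : Finset ι} (hD : D ⊆ D') (hG : G.Tame t D)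
    (hG' : G.Tame t D') (a b : ι) :
    G.av t D (XYHeight.signProd a b) ≤ G.av t D' (XYHeight.signProd a b) := by
  refine le_of_tendsto_of_tendsto (Net.tendsto_av ht hG (hG.signProd a b))
    (Net.tendsto_av ht hG' (hG'.signProd a b)) ?_
  filter_upwards [eventually_step_le t] with M hM
  rw [div_le_div_iff₀ (part_path_one_pos ht _ _ _) (part_path_one_pos ht _ _ _)]
  exact G.part_path_signProd_mono _ _ (by positivity) hM hD a b

theorem Net.av_heightProd_mono (ht : 0 ≤ t) {D D' : Finset ι} (hD : D ⊆ D') (hG : G.Tame t D)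
    (hG' : G.Tame t D') (a b : ι) :
    G.av t D (XYHeight.heightProd a b) ≤ G.av t D' (XYHeight.heightProd a b) := by
  refine le_of_tendsto_of_tendsto (Net.tendsto_av ht hG (hG.heightProd a b))
    (Net.tendsto_av ht hG' (hG'.heightProd a b)) ?_
  filter_upwards [eventually_step_le t] with M hM
  rw [div_le_div_iff₀ (part_path_one_pos ht _ _ _) (part_path_one_pos ht _ _ _)]
  exact G.part_path_heightProd_mono _ _ (by positivity) hM hD a b

theorem Net.av_signProd_mul_le (ht : 0 ≤ t) {D : Finset ι} (hG : G.Tame t D) (a b c : ι) :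
    G.av t D (XYHeight.signProd a b) * G.av t D (XYHeight.signProd b c) ≤
      G.av t D (XYHeight.signProd a c) := by
  refine le_of_tendsto_of_tendsto ((Net.tendsto_av ht hG (hG.signProd a b)).mul
    (Net.tendsto_av ht hG (hG.signProd b c)))
    (Net.tendsto_av ht hG (hG.signProd a c)) ?_
  filter_upwards [eventually_step_le t] with M hM
  have hZ := part_path_one_pos (G := G) ht (2 * M) M D
  rw [div_mul_div_comm, div_le_div_iff₀ (mul_pos hZ hZ) hZ]
  have h1 := G.part_path_signProd_mul_le (2 * M) M (by positivity) hM D a b c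
  calc _ ≤ _ := mul_le_mul_of_nonneg_right h1 hZ.le
    _ = _ := by ring

theorem Net.av_heightProd_le_sum (ht : 0 ≤ t) {D : ℕ → Finset ι} (hD : Monotone D)
    {n : ℕ} (hG : ∀ j ≤ n, G.Tame t (D j)) (o b : ι) {k : ℕ} (hb : b ∉ D k) (R : ℕ → ℝ) :
    G.av t (D n) (XYHeight.heightProd o b) ≤
      ∑ j ∈ Finset.Ico k n, ∑ x ∈ D (j + 1) \ D j,
        (R j ^ 2 * G.av t (D (j + 1)) (XYHeight.signProd o x) +
          G.av t (D (j + 1)) (XYHeight.tailProd (R j) o b)) := by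
  refine le_of_tendsto_of_tendsto
    (Net.tendsto_av ht (hG n le_rfl) ((hG n le_rfl).heightProd o b))
    (tendsto_finsetSum _ fun j hj => tendsto_finsetSum _ fun x _ =>
      ((Net.tendsto_av ht (hG _ (Finset.mem_Ico.1 hj).2)
        ((hG _ (Finset.mem_Ico.1 hj).2).signProd o x)).const_mul (R j ^ 2)).add
      (Net.tendsto_av ht (hG _ (Finset.mem_Ico.1 hj).2)
        ((hG _ (Finset.mem_Ico.1 hj).2).tailProd (R j) o b))) ?_
  filter_upwards [eventually_step_le t] with M hM
  exact G.part_path_heightProd_le_sum _ _ (by positivity) hM hD o b hb R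

end LimitInequalities

/-! ### The law of the height function of a random current -/

section Pairs

/-- The measure on pairs of occupation numbers of the two directions of an edge. -/
noncomputable def pairWeight (t : ℝ) : Measure (ℕ × ℕ) := (poissonWeight t).prod (poissonWeight t)

instance instFinitePairWeight (t : ℝ) : IsFiniteMeasure (pairWeight t) := by
  unfold pairWeight; infer_instance

theorem pairWeight_singleton {t : ℝ} (ht : 0 ≤ t) (p : ℕ × ℕ) :
    pairWeight t {p} = ENNReal.ofReal (t ^ (p.1 + p.2) / (p.1.factorial * p.2.factorial : ℝ)) := by
  rw [pairWeight, ← Set.singleton_prod_singleton, Measure.prod_prod, poissonWeight_singleton,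
    poissonWeight_singleton, ← ENNReal.ofReal_mul (by positivity)]
  congr 1
  rw [pow_add]; ring

/-- Group the pairs by their sum m: since 1/(p! q!) = (1/m!) (m choose p), each antidiagonal
contributes a multiple of the number of m-step walks. -/
theorem pairWeight_net {t : ℝ} (ht : 0 ≤ t) (k : ℤ) :
    pairWeight t {p | (p.1 : ℤ) - p.2 = k} = ENNReal.ofReal (edgeWeight t k) := by
  classical
  have h1 : pairWeight t {p | (p.1 : ℤ) - p.2 = k} = ∑' p : ℕ × ℕ,
      ENNReal.ofReal (t ^ (p.1 + p.2) / (p.1.factorial * p.2.factorial : ℝ) *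
        if (p.1 : ℤ) - p.2 = k then 1 else 0) := by
    rw [← lintegral_indicator_one (Set.to_countable _).measurableSet, lintegral_countable']
    refine tsum_congr fun p => ?_
    rw [pairWeight_singleton ht]
    by_cases hp : (p.1 : ℤ) - p.2 = k
    · simp [hp]
    · simp [hp]
  rw [h1, ← Finset.HasAntidiagonal.sigmaAntidiagonalEquivProd.tsum_eq, ENNReal.tsum_sigma', edgeWeight,
    ENNReal.ofReal_tsum_of_nonneg (fun m => mul_nonneg (by positivity) (walkCount_nonneg _ _))
      (summable_edgeWeight ht k)]
  refine tsum_congr fun m => ?_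
  rw [tsum_fintype, Finset.univ_eq_attach]
  refine (Finset.sum_attach (Finset.HasAntidiagonal.antidiagonal m) (fun p : ℕ × ℕ =>
      ENNReal.ofReal (t ^ (p.1 + p.2) / (p.1.factorial * p.2.factorial : ℝ) *
        if (p.1 : ℤ) - p.2 = k then 1 else 0))).trans ?_
  rw [← ENNReal.ofReal_sum_of_nonneg fun p _ =>
    mul_nonneg (by positivity) (by split_ifs <;> norm_num)]
  congr 1
  rw [walkCount, Finset.mul_sum]
  refine Finset.sum_congr rfl fun p hp => ?_
  rw [Finset.HasAntidiagonal.mem_antidiagonal] at hp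
  have h2 : (m.choose p.1 : ℝ) = (m.factorial : ℝ) / (p.1.factorial * p.2.factorial) := by
    rw [← hp, Nat.cast_add_choose]
  rw [hp, h2, ← mul_assoc]
  congr 1
  field_simp

theorem edgeWeight_neg {t : ℝ} (k : ℤ) : edgeWeight t (-k) = edgeWeight t k := by
  refine tsum_congr fun m => ?_
  congr 1
  simp only [walkCount]
  rw [← Finset.Nat.sum_antidiagonal_swap]
  refine Finset.sum_congr rfl fun p hp => ?_
  rw [Finset.HasAntidiagonal.mem_antidiagonal] at hp
  rw [Prod.fst_swap, Prod.snd_swap, ← Nat.choose_symm_of_eq_add (show m = p.1 + p.2 by omega)]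
  congr 2
  rw [eq_iff_iff]
  omega

end Pairs

/-! ### Independence of the net currents through undirected edges -/

section CurrentLaw

/-- The directed edges of the box that point right or up. -/
noncomputable def posEdges (n : ℕ) : Finset (V × V) :=
  (dirEdges n).filter fun e => e.2 = (e.1.1 + 1, e.1.2) ∨ e.2 = (e.1.1, e.1.2 + 1)

theorem mem_posEdges {n : ℕ} {e : V × V} : e ∈ posEdges n ↔ e ∈ dirEdges n ∧
    (e.2 = (e.1.1 + 1, e.1.2) ∨ e.2 = (e.1.1, e.1.2 + 1)) := by
  simp [posEdges]

theorem swap_mem_dirEdges {n : ℕ} {e : V × V} (he : e ∈ dirEdges n) : e.swap ∈ dirEdges n := by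
  obtain ⟨x, y⟩ := e
  rw [Prod.swap_prod_mk]
  rw [mem_dirEdges] at *
  exact ⟨he.2.1, he.1, by linarith [he.2.2]⟩

theorem posEdges_or {n : ℕ} {e : V × V} (he : e ∈ dirEdges n) :
    e ∈ posEdges n ∨ e.swap ∈ posEdges n := by
  have h1 := swap_mem_dirEdges he
  rw [mem_posEdges, mem_posEdges]
  obtain ⟨⟨i, j⟩, ⟨p, q⟩⟩ := e
  have hu := unit_cases (mem_dirEdges.1 he).2.2
  simp only [Prod.swap_prod_mk, Prod.mk.injEq] at *
  rcases hu with hu | hu | hu | hu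
  · left; exact ⟨he, Or.inl (by omega)⟩
  · right; exact ⟨h1, Or.inl (by omega)⟩
  · left; exact ⟨he, Or.inr (by omega)⟩
  · right; exact ⟨h1, Or.inr (by omega)⟩

theorem swap_notMem_posEdges {n : ℕ} {e : V × V} (he : e ∈ posEdges n) : e.swap ∉ posEdges n := by
  rw [mem_posEdges] at *
  obtain ⟨⟨i, j⟩, ⟨p, q⟩⟩ := e
  simp only [Prod.swap_prod_mk, Prod.mk.injEq] at *
  omega

theorem prod_dirEdges {M : Type*} [CommMonoid M] (n : ℕ) (φ : {e : V × V // e ∈ dirEdges n} → M) :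
    ∏ e, φ e = ∏ e : {e : V × V // e ∈ posEdges n},
      (φ ⟨e.1, (mem_posEdges.1 e.2).1⟩ *
        φ ⟨e.1.swap, swap_mem_dirEdges (mem_posEdges.1 e.2).1⟩) := by
  classical
  rw [Finset.prod_mul_distrib, ← Finset.prod_mul_prod_compl
    (Finset.univ.filter fun e : {e : V × V // e ∈ dirEdges n} => e.1 ∈ posEdges n)]
  congr 1
  · refine (Finset.prod_nbij' (fun e : {e : V × V // e ∈ posEdges n} =>
        (⟨e.1, (mem_posEdges.1 e.2).1⟩ : {e : V × V // e ∈ dirEdges n}))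
      (fun e => if h : e.1 ∈ posEdges n then ⟨e.1, h⟩ else ⟨e.1.swap, (posEdges_or e.2).resolve_left h⟩)
      ?_ ?_ ?_ ?_ ?_).symm
    · intro e _; simp [e.2]
    · intro e _; simp
    · intro e _; simp [e.2]
    · intro e he
      have : e.1 ∈ posEdges n := by simpa using he
      simp [this]
    · intro e _; rfl
  · refine (Finset.prod_nbij' (fun e : {e : V × V // e ∈ posEdges n} =>
        (⟨e.1.swap, swap_mem_dirEdges (mem_posEdges.1 e.2).1⟩ : {e : V × V // e ∈ dirEdges n}))
      (fun e => if h : e.1 ∈ posEdges n then ⟨e.1, h⟩ else ⟨e.1.swap, (posEdges_or e.2).resolve_left h⟩)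
      ?_ ?_ ?_ ?_ ?_).symm
    · intro e _; simpa using swap_notMem_posEdges e.2
    · intro e _; simp
    · intro e _; simp [swap_notMem_posEdges e.2]
    · intro e he
      have : e.1 ∉ posEdges n := by simpa using he
      simp [this]
    · intro e _; rfl

/-- The current with given pairs of occupation numbers. -/
noncomputable def ofPairs {n : ℕ} (q : {e : V × V // e ∈ posEdges n} → ℕ × ℕ) : Current n := fun e =>
  open Classical in
  if h : e.1 ∈ posEdges n then (q ⟨e.1, h⟩).1
  else (q ⟨e.1.swap, (posEdges_or e.2).resolve_left h⟩).2

theorem ofPairs_pos {n : ℕ} (q : {e : V × V // e ∈ posEdges n} → ℕ × ℕ)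
    (e : {e : V × V // e ∈ posEdges n}) :
    ofPairs q ⟨e.1, (mem_posEdges.1 e.2).1⟩ = (q e).1 := by
  simp [ofPairs, e.2]

theorem ofPairs_swap {n : ℕ} (q : {e : V × V // e ∈ posEdges n} → ℕ × ℕ)
    (e : {e : V × V // e ∈ posEdges n}) :
    ofPairs q ⟨e.1.swap, swap_mem_dirEdges (mem_posEdges.1 e.2).1⟩ = (q e).2 := by
  simp [ofPairs, swap_notMem_posEdges e.2]

theorem map_ofPairs (n : ℕ) (t : ℝ) :
    (Measure.pi fun _ : {e : V × V // e ∈ posEdges n} => pairWeight t).map ofPairs =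
      currentMeasure n t := by
  refine Measure.ext_of_singleton fun c => ?_
  rw [Measure.map_apply (Measurable.of_discrete) (measurableSet_singleton c)]
  have h1 : ofPairs ⁻¹' {c} = {fun e : {e : V × V // e ∈ posEdges n} =>
      (c ⟨e.1, (mem_posEdges.1 e.2).1⟩, c ⟨e.1.swap, swap_mem_dirEdges (mem_posEdges.1 e.2).1⟩)} := by
    ext q
    simp only [Set.mem_preimage, Set.mem_singleton_iff]
    constructor
    · rintro rfl
      funext e
      rw [ofPairs_pos, ofPairs_swap]
    · rintro rfl
      funext e
      simp only [ofPairs]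
      split_ifs
      · rfl
      · rfl
  rw [h1, Measure.pi_singleton, currentMeasure, Measure.pi_singleton, prod_dirEdges]
  refine Finset.prod_congr rfl fun e _ => ?_
  rw [pairWeight, ← Set.singleton_prod_singleton, Measure.prod_prod]

/-- The law of the net currents through the edges. -/
theorem currentMeasure_net (n : ℕ) {t : ℝ} (ht : 0 ≤ t) (g : V × V → ℤ) :
    currentMeasure n t {c | ∀ e ∈ posEdges n, c.net e.1 e.2 = g e} =
      ENNReal.ofReal (∏ e ∈ posEdges n, edgeWeight t (g e)) := by
  rw [← map_ofPairs, Measure.map_apply (Measurable.of_discrete) (Set.to_countable _).measurableSet]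
  have h1 : ofPairs ⁻¹' {c : Current n | ∀ e ∈ posEdges n, c.net e.1 e.2 = g e} =
      Set.univ.pi fun e : {e : V × V // e ∈ posEdges n} => {p : ℕ × ℕ | (p.1 : ℤ) - p.2 = g e} := by
    ext q
    simp only [Set.mem_preimage, Set.mem_ofPred_eq, Set.mem_pi, Set.mem_univ, true_imp_iff,
      Subtype.forall]
    refine forall₂_congr fun e he => ?_
    have h2 := (mem_posEdges.1 he).1
    have h3 : (e.2, e.1) ∈ dirEdges n := swap_mem_dirEdges h2
    have h4 := ofPairs_pos q ⟨e, he⟩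
    have h5 : ofPairs q ⟨(e.2, e.1), h3⟩ = _ := ofPairs_swap q ⟨e, he⟩
    rw [Current.net, Current.val, Current.val, dif_pos h2, dif_pos h3, h5]
    simp only [Prod.mk.eta]
    rw [h4]
  rw [h1, Measure.pi_pi, ENNReal.ofReal_prod_of_nonneg fun e _ => edgeWeight_nonneg ht _,
    ← Finset.prod_coe_sort (posEdges n)]
  exact Finset.prod_congr rfl fun e _ => pairWeight_net ht _

end CurrentLaw

/-! ### The graph of faces -/

section Faces

/-- The four neighbours of a face. -/
def nbrs (a : V) : Finset V := {(a.1 + 1, a.2), (a.1 - 1, a.2), (a.1, a.2 + 1), (a.1, a.2 - 1)}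

theorem mem_nbrs {a b : V} : b ∈ nbrs a ↔ b = (a.1 + 1, a.2) ∨ b = (a.1 - 1, a.2) ∨
    b = (a.1, a.2 + 1) ∨ b = (a.1, a.2 - 1) := by
  simp [nbrs]

theorem mem_nbrs_comm {a b : V} : b ∈ nbrs a ↔ a ∈ nbrs b := by
  simp only [mem_nbrs, Prod.ext_iff]
  omega

open Classical in
/-- The pairs of neighbouring faces that have at least one face in `D`. -/
noncomputable def latEdges (D : Finset V) : Finset (Sym2 V) :=
  D.biUnion fun a => (nbrs a).image fun b => s(a, b)

theorem mk_mem_latEdges {D : Finset V} {a b : V} :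
    s(a, b) ∈ latEdges D ↔ (a ∈ D ∨ b ∈ D) ∧ b ∈ nbrs a := by
  simp only [latEdges, Finset.mem_biUnion, Finset.mem_image, Sym2.eq_iff]
  constructor
  · rintro ⟨x, hx, y, hy, ⟨rfl, rfl⟩ | ⟨rfl, rfl⟩⟩
    · exact ⟨Or.inl hx, hy⟩
    · exact ⟨Or.inr hx, mem_nbrs_comm.1 hy⟩
  · rintro ⟨h | h, hab⟩
    · exact ⟨a, h, b, hab, Or.inl ⟨rfl, rfl⟩⟩
    · exact ⟨b, h, a, mem_nbrs_comm.1 hab, Or.inr ⟨rfl, rfl⟩⟩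

/-- The graph of the faces in `D`, together with their neighbours. -/
noncomputable def latNet (D : Finset V) : Net V (Sym2 V) where
  E := latEdges D
  s e := (Quot.out e).1
  t e := (Quot.out e).2

/-- The faces of the box. -/
noncomputable def faces (n : ℕ) : Finset V :=
  Finset.Icc (-(n : ℤ), -(n : ℤ)) ((n : ℤ) - 1, (n : ℤ) - 1)

theorem mem_faces {n : ℕ} {a : V} :
    a ∈ faces n ↔ -(n : ℤ) ≤ a.1 ∧ a.1 < n ∧ -(n : ℤ) ≤ a.2 ∧ a.2 < n := by
  simp only [faces, Finset.mem_Icc, Prod.le_def]; omega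

theorem faces_mono : Monotone faces := fun m n h a ha => by
  rw [mem_faces] at *; omega

theorem edgeWeight_out (t : ℝ) (h : V → ℤ) (a b : V) :
    edgeWeight t (h (Quot.out s(a, b)).1 - h (Quot.out s(a, b)).2) = edgeWeight t (h a - h b) := by
  have h1 : s((Quot.out s(a, b)).1, (Quot.out s(a, b)).2) = s(a, b) := Quot.out_eq s(a, b)
  rcases Sym2.eq_iff.1 h1 with ⟨e1, e2⟩ | ⟨e1, e2⟩
  · rw [e1, e2]
  · rw [e1, e2, ← edgeWeight_neg, neg_sub]

theorem limWeight_latNet (t : ℝ) (D : Finset V) (h : V → ℤ) : (latNet D).limWeight t h =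
    ∏ e ∈ latEdges D, edgeWeight t (h (Quot.out e).1 - h (Quot.out e).2) := rfl

/-- Planar duality: the right and left faces of an edge are neighbours, and every neighbouring pair
with a face in the box arises from exactly one edge of the box pointing right or up. -/
theorem prod_posEdges (n : ℕ) (t : ℝ) (h : V → ℤ) :
    ∏ e ∈ posEdges n, edgeWeight t (h (rightFace e.1 e.2) - h (leftFace e.1 e.2)) =
      (latNet (faces n)).limWeight t h := by
  rw [limWeight_latNet]
  have hcase : ∀ e ∈ posEdges n, (∃ i j : ℤ, -(n : ℤ) ≤ i ∧ i < n ∧ -(n : ℤ) ≤ j ∧ j ≤ n ∧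
      e = ((i, j), (i + 1, j)) ∧ rightFace e.1 e.2 = (i, j - 1) ∧ leftFace e.1 e.2 = (i, j)) ∨
      (∃ i j : ℤ, -(n : ℤ) ≤ i ∧ i ≤ n ∧ -(n : ℤ) ≤ j ∧ j < n ∧
      e = ((i, j), (i, j + 1)) ∧ rightFace e.1 e.2 = (i, j) ∧ leftFace e.1 e.2 = (i - 1, j)) := by
    rintro ⟨⟨i, j⟩, ⟨p, q⟩⟩ he
    rw [mem_posEdges, mem_dirEdges, mem_box, mem_box] at he
    obtain ⟨⟨h1, h2, -⟩, h3⟩ := he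
    simp only [Prod.mk.injEq] at h1 h2 h3
    rcases h3 with ⟨rfl, rfl⟩ | ⟨rfl, rfl⟩
    · left
      refine ⟨i, q, h1.1, by omega, h1.2.2.1, h1.2.2.2, rfl, ?_, ?_⟩ <;>
        simp only [rightFace, leftFace, Prod.mk.injEq] <;> omega
    · right
      refine ⟨p, j, h1.1, h1.2.1, h1.2.2.1, by omega, rfl, ?_, ?_⟩ <;>
        simp only [rightFace, leftFace, Prod.mk.injEq] <;> omega
  refine Finset.prod_nbij (fun e => s(rightFace e.1 e.2, leftFace e.1 e.2)) ?_ ?_ ?_ ?_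
  · intro e he
    rw [mk_mem_latEdges, mem_faces, mem_faces, mem_nbrs]
    rcases hcase e he with ⟨i, j, h1, h2, h3, h4, -, h5, h6⟩ | ⟨i, j, h1, h2, h3, h4, -, h5, h6⟩ <;>
      rw [h5, h6] <;> 
      simp only [Prod.mk.injEq, true_and, and_true, true_or, or_true] <;> omega
  · intro e he e' he' hee
    simp only [Sym2.eq_iff] at hee
    rcases hcase e he with ⟨i, j, -, -, -, -, h4, h5, h6⟩ | ⟨i, j, -, -, -, -, h4, h5, h6⟩ <;>
    rcases hcase e' he' with ⟨i', j', -, -, -, -, h4', h5', h6'⟩ |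
      ⟨i', j', -, -, -, -, h4', h5', h6'⟩ <;>
    rw [h5, h6, h5', h6'] at hee <;> rw [h4, h4'] <;>
    simp only [Prod.mk.injEq] at hee ⊢ <;> omega
  · intro e he
    induction e using Sym2.ind with
    | _ a b =>
    rw [Finset.mem_coe, mk_mem_latEdges, mem_faces, mem_faces, mem_nbrs] at he
    obtain ⟨i, j⟩ := a
    obtain ⟨p, q⟩ := b
    simp only [Prod.mk.injEq] at he
    have hmem : ∀ x y : V, x ∈ box n → y ∈ box n → (y = (x.1 + 1, x.2) ∨ y = (x.1, x.2 + 1)) →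
        (x, y) ∈ posEdges n := by
      intro x y hx hy hxy
      rw [mem_posEdges, mem_dirEdges]
      refine ⟨⟨hx, hy, ?_⟩, hxy⟩
      rcases hxy with rfl | rfl <;> simp
    rcases he.2 with h1 | h1 | h1 | h1
    · refine ⟨((p, q), (p, q + 1)), Finset.mem_coe.2 (hmem _ _ ?_ ?_ ?_), ?_⟩
      · rw [mem_box]; simp only; omega
      · rw [mem_box]; simp only; omega
      · simp
      · simp only [Sym2.eq_iff, rightFace, leftFace, Prod.mk.injEq]; omega
    · refine ⟨((i, j), (i, j + 1)), Finset.mem_coe.2 (hmem _ _ ?_ ?_ ?_), ?_⟩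
      · rw [mem_box]; simp only; omega
      · rw [mem_box]; simp only; omega
      · simp
      · simp only [Sym2.eq_iff, rightFace, leftFace, Prod.mk.injEq]; omega
    · refine ⟨((p, q), (p + 1, q)), Finset.mem_coe.2 (hmem _ _ ?_ ?_ ?_), ?_⟩
      · rw [mem_box]; simp only; omega
      · rw [mem_box]; simp only; omega
      · simp
      · simp only [Sym2.eq_iff, rightFace, leftFace, Prod.mk.injEq]; omega
    · refine ⟨((i, j), (i + 1, j)), Finset.mem_coe.2 (hmem _ _ ?_ ?_ ?_), ?_⟩
      · rw [mem_box]; simp only; omega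
      · rw [mem_box]; simp only; omega
      · simp
      · simp only [Sym2.eq_iff, rightFace, leftFace, Prod.mk.injEq]; omega
  · intro e _
    exact (edgeWeight_out t h _ _).symm

/-- A current is sourceless with height function `h` if and only if its net currents are
the height differences of `h`. -/
theorem sourceless_height_iff {n : ℕ} {h : V → ℤ} (hh : ∀ x, x ∉ faces n → h x = 0)
    (c : Current n) : (c ∈ sourceless n ∧ height c = h) ↔
      ∀ e ∈ posEdges n, c.net e.1 e.2 = h (rightFace e.1 e.2) - h (leftFace e.1 e.2) := by
  constructor
  · rintro ⟨hc, rfl⟩ e he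
    exact ((isHeightFunction_height hc).2 e.1 e.2 (mem_posEdges.1 he).1).symm
  · intro hnet
    have hall : ∀ x y : V, (y = (x.1 + 1, x.2) ∨ y = (x.1, x.2 + 1)) →
        c.net x y = h (rightFace x y) - h (leftFace x y) := by
      rintro ⟨i, j⟩ y hxy
      by_cases he : ((i, j), y) ∈ dirEdges n
      · exact hnet _ (mem_posEdges.2 ⟨he, hxy⟩)
      -- An edge that is not in the box has both adjacent faces outside, where h is zero.
      · rw [net_eq_zero c he]
        rw [mem_dirEdges, mem_box, mem_box] at he
        rcases hxy with rfl | rfl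
        · have r : rightFace (i, j) (i + 1, j) = (i, j - 1) := by
            simp only [rightFace, Prod.mk.injEq]; omega
          have l : leftFace (i, j) (i + 1, j) = (i, j) := by
            simp only [leftFace, rightFace, Prod.mk.injEq]; omega
          have h1 : (i + 1 - i) ^ 2 + (j - j) ^ 2 = 1 := by ring
          simp only [h1, and_true] at he
          rw [r, l, hh _ (by rw [mem_faces]; simp only; omega),
            hh _ (by rw [mem_faces]; simp only; omega), sub_self]
        · have r : rightFace (i, j) (i, j + 1) = (i, j) := by
            simp only [rightFace, Prod.mk.injEq]; omega
          have l : leftFace (i, j) (i, j + 1) = (i - 1, j) := by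
            simp only [leftFace, rightFace, Prod.mk.injEq]; omega
          have h1 : (i - i) ^ 2 + (j + 1 - j) ^ 2 = 1 := by ring
          simp only [h1, and_true] at he
          rw [r, l, hh _ (by rw [mem_faces]; simp only; omega),
            hh _ (by rw [mem_faces]; simp only; omega), sub_self]
    have hH : ∀ i j : ℤ, c.net (i, j) (i + 1, j) = h (i, j - 1) - h (i, j) := by
      intro i j
      rw [hall _ _ (Or.inl rfl)]
      congr 2 <;> simp only [leftFace, rightFace, Prod.mk.injEq] <;> omega
    have hV : ∀ i j : ℤ, c.net (i, j) (i, j + 1) = h (i, j) - h (i - 1, j) := by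
      intro i j
      rw [hall _ _ (Or.inr rfl)]
      congr 2 <;> simp only [leftFace, rightFace, Prod.mk.injEq] <;> omega
    have hs : c ∈ sourceless n := by
      rintro ⟨i, j⟩ _
      have h1 := hH (i - 1) j
      have h2 := hV i (j - 1)
      rw [sub_add_cancel] at h1 h2
      rw [source_eq, hH, hV, h1, h2]
      ring
    refine ⟨hs, (IsHeightFunction.eq_height hs ⟨fun a ha => hh a ?_, fun x y hxy => ?_⟩).symm⟩
    · rwa [mem_faces]
    · rcases posEdges_or hxy with h1 | h1
      · exact (hall x y (mem_posEdges.1 h1).2).symm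
      · have h2 := hall y x (mem_posEdges.1 h1).2
        rw [net_symm, h2, leftFace, leftFace]
        ring

theorem currentMeasure_height (n : ℕ) {t : ℝ} (ht : 0 ≤ t) {h : V → ℤ}
    (hh : ∀ x, x ∉ faces n → h x = 0) :
    currentMeasure n t {c | c ∈ sourceless n ∧ height c = h} =
      ENNReal.ofReal ((latNet (faces n)).limWeight t h) := by
  simp only [sourceless_height_iff hh]
  rw [currentMeasure_net n ht (fun e => h (rightFace e.1 e.2) - h (leftFace e.1 e.2)),
    prod_posEdges]

end Faces

/-! ### Expectations over currents as sums over height functions -/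

section Expectation

variable {n : ℕ} {t : ℝ}

/-- The extension by zero of a height function on the faces of the box. -/
noncomputable def extendFaces (y : faces n → ℤ) : V → ℤ :=
  fun x => if hx : x ∈ faces n then y ⟨x, hx⟩ else 0

theorem extendFaces_injective : Function.Injective (extendFaces (n := n)) := fun y z h => by
  funext x
  have := congrFun h x
  simpa [extendFaces] using this

theorem extendFaces_of_notMem (y : faces n → ℤ) {x : V} (hx : x ∉ faces n) :
    extendFaces y x = 0 := by simp [extendFaces, hx]

theorem extendFaces_restrict {h : V → ℤ} (hh : ∀ x, x ∉ faces n → h x = 0) :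
    extendFaces (fun x : faces n => h x) = h := by
  funext x
  by_cases hx : x ∈ faces n
  · simp [extendFaces, hx]
  · simp [extendFaces, hx, hh x hx]

theorem height_eq_zero {c : Current n} (hc : c ∈ sourceless n) {x : V} (hx : x ∉ faces n) :
    height c x = 0 := (isHeightFunction_height hc).1 x (by rwa [mem_faces] at hx)

/-- The law of the heights of the faces of the box. -/
noncomputable def heightMeasure (n : ℕ) (t : ℝ) : Measure (faces n → ℤ) :=
  ((currentMeasure n t).restrict (sourceless n)).map fun c x => height c x

/-- Recording heights only on the finitely many faces of the box makes the state space countable, so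
that integrals become sums over singletons. -/
theorem heightMeasure_singleton (ht : 0 ≤ t) (y : faces n → ℤ) :
    heightMeasure n t {y} = ENNReal.ofReal ((latNet (faces n)).limWeight t (extendFaces y)) := by
  rw [heightMeasure, Measure.map_apply Measurable.of_discrete (measurableSet_singleton y),
    Measure.restrict_apply (Set.to_countable _).measurableSet,
    ← currentMeasure_height n ht fun x hx => extendFaces_of_notMem y hx]
  congr 1
  ext c
  simp only [Set.mem_inter_iff, Set.mem_preimage, Set.mem_singleton_iff, Set.mem_ofPred_eq]
  rw [and_comm]
  refine and_congr_right fun hc => ?_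
  have h1 := extendFaces_restrict fun x hx => height_eq_zero hc hx
  constructor
  · rintro rfl
    exact h1.symm
  · intro h2
    exact extendFaces_injective (h1.trans h2)

theorem ae_extendFaces (f : (V → ℤ) → ℝ) :
    (fun c => f (extendFaces fun x : faces n => height c x))
      =ᵐ[(currentMeasure n t).restrict (sourceless n)] fun c => f (height c) := by
  refine (ae_restrict_iff' (Set.to_countable _).measurableSet).2 (ae_of_all _ fun c hc => ?_)
  dsimp only
  rw [extendFaces_restrict fun x hx => height_eq_zero hc hx]

theorem integrable_heightMeasure {f : (V → ℤ) → ℝ}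
    (hf : Integrable (fun c => f (height c)) ((currentMeasure n t).restrict (sourceless n))) :
    Integrable (fun y => f (extendFaces y)) (heightMeasure n t) := by
  rw [heightMeasure, integrable_map_measure (Measurable.of_discrete).aestronglyMeasurable
    (Measurable.of_discrete).aemeasurable]
  exact hf.congr (ae_extendFaces f).symm

theorem limTerm_extendFaces (f : (V → ℤ) → ℝ) (y : faces n → ℤ) :
    (latNet (faces n)).limTerm t (faces n) f (extendFaces y) =
      (latNet (faces n)).limWeight t (extendFaces y) * f (extendFaces y) :=
  if_pos fun _ hx => extendFaces_of_notMem y hx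

theorem limTerm_of_notMem_range (f : (V → ℤ) → ℝ) {h : V → ℤ}
    (hh : h ∉ Set.range (extendFaces (n := n))) :
    (latNet (faces n)).limTerm t (faces n) f h = 0 :=
  if_neg fun h1 => hh ⟨fun x => h x, extendFaces_restrict h1⟩

theorem summable_limTerm_of_integrable (ht : 0 ≤ t) {f : (V → ℤ) → ℝ}
    (hf : Integrable (fun c => f (height c)) ((currentMeasure n t).restrict (sourceless n))) :
    Summable ((latNet (faces n)).limTerm t (faces n) f) := by
  rw [← extendFaces_injective.summable_iff fun h hh => limTerm_of_notMem_range f hh]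
  have h1 := (integrable_heightMeasure hf).2
  rw [HasFiniteIntegral, lintegral_countable'] at h1
  refine (ENNReal.summable_toReal h1.ne).of_norm_bounded fun y => le_of_eq ?_
  rw [Function.comp_apply, limTerm_extendFaces, heightMeasure_singleton ht, ENNReal.toReal_mul,
    ENNReal.toReal_ofReal (Net.limWeight_nonneg _ ht _), toReal_enorm, norm_mul,
    Real.norm_of_nonneg (Net.limWeight_nonneg _ ht _), mul_comm]

theorem setIntegral_height (ht : 0 ≤ t) {f : (V → ℤ) → ℝ}
    (hf : Integrable (fun c => f (height c)) ((currentMeasure n t).restrict (sourceless n))) :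
    ∫ c in sourceless n, f (height c) ∂(currentMeasure n t) =
      (latNet (faces n)).limPart t (faces n) f := by
  rw [Net.limPart, ← extendFaces_injective.tsum_eq fun h hh => by
    by_contra h1
    exact hh (limTerm_of_notMem_range f h1)]
  rw [← integral_congr_ae (ae_extendFaces f), ← integral_map
    (φ := fun c : Current n => fun x : faces n => height c x)
    (f := fun y => f (extendFaces y)) (Measurable.of_discrete).aemeasurable
    (Measurable.of_discrete).aestronglyMeasurable]
  refine (integral_countable (integrable_heightMeasure hf)).trans (tsum_congr fun y => ?_)
  rw [limTerm_extendFaces, measureReal_def, heightMeasure_singleton ht,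
    ENNReal.toReal_ofReal (Net.limWeight_nonneg _ ht _), smul_eq_mul]

theorem measure_sourceless_ne_zero {β : ℝ} (hβ : 0 ≤ β) :
    currentMeasure n (β / 2) (sourceless n) ≠ 0 := by
  have := isProbabilityMeasure_currentLaw n hβ
  intro h0
  exact IsProbabilityMeasure.ne_zero (currentLaw n β) (cond_eq_zero_of_meas_eq_zero h0)

theorem integrable_restrict_of_currentLaw {β : ℝ} (hβ : 0 ≤ β) {f : Current n → ℝ}
    (hf : Integrable f (currentLaw n β)) :
    Integrable f ((currentMeasure n (β / 2)).restrict (sourceless n)) :=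
  (integrable_smul_measure (ENNReal.inv_ne_zero.2 (measure_ne_top _ _))
    (ENNReal.inv_ne_top.2 (measure_sourceless_ne_zero hβ))).1 hf

end Expectation

/-! ### Finite-volume covariances: monotonicity, bounds and supermultiplicativity -/

section LatticeAverages

variable {β t : ℝ}

theorem tame_faces (ht : 0 ≤ t) (n : ℕ) : (latNet (faces n)).Tame t (faces n) := by
  have hβ : 0 ≤ 2 * t := by positivity
  have h2 : 2 * t / 2 = t := by ring
  constructor
  · exact summable_limTerm_of_integrable ht (integrable_const _)
  · intro a b
    have h1 := integrable_restrict_of_currentLaw hβ (integrable_height_mul_height n hβ a b)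
    rw [h2] at h1
    exact summable_limTerm_of_integrable ht h1

theorem integral_currentLaw (hβ : 0 ≤ β) (n : ℕ) {f : (V → ℤ) → ℝ}
    (hf : Integrable (fun c => f (height c)) (currentLaw n β)) :
    ∫ c, f (height c) ∂(currentLaw n β) =
      (latNet (faces n)).av (β / 2) (faces n) f := by
  have ht : 0 ≤ β / 2 := by positivity
  have h1 := setIntegral_height (n := n) ht (f := fun _ => 1) (integrable_const _)
  rw [integral_const, smul_eq_mul, mul_one, measureReal_restrict_apply MeasurableSet.univ,
    Set.univ_inter] at h1
  rw [Net.av, ← h1, ← setIntegral_height ht (integrable_restrict_of_currentLaw hβ hf), currentLaw,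
    ProbabilityTheory.cond, integral_smul_measure, ENNReal.toReal_inv, smul_eq_mul, measureReal_def]
  exact (div_eq_inv_mul _ _).symm

theorem heightCov_eq (hβ : 0 ≤ β) (n : ℕ) (a b : V) : heightCov n β a b =
    (latNet (faces n)).av (β / 2) (faces n) (heightProd a b) :=
  integral_currentLaw hβ n (f := heightProd a b) (integrable_height_mul_height n hβ a b)

theorem abs_signProd_le {ι : Type*} (a b : ι) (h : ι → ℤ) : |signProd a b h| ≤ 1 := by
  rw [signProd, abs_mul]
  exact mul_le_one₀ (abs_sign_le_one _) (abs_nonneg _) (abs_sign_le_one _)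

theorem integrable_signProd (hβ : 0 ≤ β) (n : ℕ) (a b : V) :
    Integrable (fun c => signProd a b (height c)) (currentLaw n β) := by
  have := isProbabilityMeasure_currentLaw n hβ
  exact Integrable.of_bound (Measurable.of_discrete).aestronglyMeasurable 1
    (ae_of_all _ fun c => abs_signProd_le a b _)

theorem sigCov_eq (hβ : 0 ≤ β) (n : ℕ) (a b : V) : sigCov n β a b =
    (latNet (faces n)).av (β / 2) (faces n) (signProd a b) :=
  integral_currentLaw hβ n (f := signProd a b) (integrable_signProd hβ n a b)

theorem sigCov_le_one (hβ : 0 ≤ β) (n : ℕ) (a b : V) : sigCov n β a b ≤ 1 := by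
  have := isProbabilityMeasure_currentLaw n hβ
  have h1 := norm_integral_le_of_norm_le_const (μ := currentLaw n β)
    (f := fun c => signProd a b (height c)) (ae_of_all _ fun c => abs_signProd_le a b _)
  rw [probReal_univ, mul_one] at h1
  exact (le_abs_self _).trans h1

theorem latEdges_mono {D D' : Finset V} (hD : D ⊆ D') : latEdges D ⊆ latEdges D' := fun e he => by
  induction e using Sym2.ind with
  | _ a b =>
  rw [mk_mem_latEdges] at *
  exact ⟨he.1.imp (fun h => hD h) (fun h => hD h), he.2⟩

/-- Edges of the larger graph that do not touch D are flat, so they contribute a constant, which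
cancels in averages. Two domains can then be compared inside one graph, as the FKG argument demands.
-/
theorem limTerm_latNet {D D' : Finset V} (hD : D ⊆ D') (f : (V → ℤ) → ℝ) (h : V → ℤ) :
    (latNet D').limTerm t D f h =
      edgeWeight t 0 ^ (latEdges D' \ latEdges D).card * (latNet D).limTerm t D f h := by
  classical
  unfold Net.limTerm
  split_ifs with hh
  · rw [← mul_assoc]
    congr 1
    rw [limWeight_latNet, limWeight_latNet, ← Finset.prod_sdiff (latEdges_mono hD)]
    congr 1
    rw [← Finset.prod_const]
    refine Finset.prod_congr rfl fun e he => ?_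
    induction e using Sym2.ind with
    | _ a b =>
    rw [edgeWeight_out]
    rw [Finset.mem_sdiff, mk_mem_latEdges, mk_mem_latEdges] at he
    rw [hh a (by tauto), hh b (by tauto), sub_self]
  · rw [mul_zero]

theorem limPart_latNet {D D' : Finset V} (hD : D ⊆ D') (f : (V → ℤ) → ℝ) :
    (latNet D').limPart t D f =
      edgeWeight t 0 ^ (latEdges D' \ latEdges D).card * (latNet D).limPart t D f := by
  rw [Net.limPart, Net.limPart, ← tsum_mul_left]
  exact tsum_congr fun h => limTerm_latNet hD f h

theorem av_latNet (ht : 0 ≤ t) {D D' : Finset V} (hD : D ⊆ D') (f : (V → ℤ) → ℝ) :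
    (latNet D').av t D f = (latNet D).av t D f := by
  rw [Net.av, Net.av, limPart_latNet hD, limPart_latNet hD,
    mul_div_mul_left _ _ (pow_pos (edgeWeight_zero_pos ht) _).ne']

theorem summable_latNet_iff (ht : 0 ≤ t) {D D' : Finset V} (hD : D ⊆ D') (f : (V → ℤ) → ℝ) :
    Summable ((latNet D').limTerm t D f) ↔ Summable ((latNet D).limTerm t D f) := by
  rw [show (latNet D').limTerm t D f = fun h => _ from funext fun h => limTerm_latNet hD f h]
  exact summable_mul_left_iff (pow_pos (edgeWeight_zero_pos ht) _).ne'

theorem Net.summable_limTerm_mono {ι 𝓔 : Type*} (G : Net ι 𝓔) {D D' : Finset ι} (hD : D ⊆ D')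
    {f : (ι → ℤ) → ℝ} (hf : Summable (G.limTerm t D' f)) : Summable (G.limTerm t D f) := by
  refine hf.norm.of_norm_bounded fun h => ?_
  unfold Net.limTerm
  by_cases hh : ∀ x, x ∉ D → h x = 0
  · rw [if_pos hh, if_pos fun x hx => hh x fun h1 => hx (hD h1)]
  · rw [if_neg hh, norm_zero]
    exact norm_nonneg _

theorem exists_subset_faces (D : Finset V) : ∃ n, D ⊆ faces n := by
  induction D using Finset.induction_on with
  | empty => exact ⟨0, Finset.empty_subset _⟩
  | insert a D _ ih =>
    obtain ⟨n, hn⟩ := ih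
    refine ⟨max n (a.1.natAbs + a.2.natAbs + 1), fun x hx => ?_⟩
    rcases Finset.mem_insert.1 hx with rfl | hx
    · rw [mem_faces]; omega
    · exact faces_mono (le_max_left _ _) (hn hx)

/-- Summability is known on boxes from the integrability of the current model. Any finite D lies in
a box, and imposing more zeros only removes terms. -/
theorem tame_latNet (ht : 0 ≤ t) {D D' : Finset V} (hD : D ⊆ D') : (latNet D').Tame t D := by
  obtain ⟨n, hn⟩ := exists_subset_faces D
  have key : ∀ f : (V → ℤ) → ℝ, Summable ((latNet (faces n)).limTerm t (faces n) f) →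
      Summable ((latNet D').limTerm t D f) := by
    intro f hf
    rw [summable_latNet_iff ht hD, ← summable_latNet_iff ht hn]
    exact (latNet (faces n)).summable_limTerm_mono hn hf
  exact ⟨key _ (tame_faces ht n).one, fun a b => key _ ((tame_faces ht n).heightProd a b)⟩

theorem av_latNet_signProd_mono (ht : 0 ≤ t) {D D' : Finset V} (hD : D ⊆ D') (a b : V) :
    (latNet D).av t D (signProd a b) ≤ (latNet D').av t D' (signProd a b) := by
  rw [← av_latNet ht hD]
  exact Net.av_signProd_mono ht hD (tame_latNet ht hD) (tame_latNet ht subset_rfl) a b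

theorem sigCov_mono (hβ : 0 ≤ β) (a b : V) : Monotone fun n => sigCov n β a b := fun m n h => by
  simp only [sigCov_eq hβ]
  exact av_latNet_signProd_mono (by positivity) (faces_mono h) a b

theorem heightCov_mono (hβ : 0 ≤ β) (a b : V) : Monotone fun n => heightCov n β a b :=
  fun m n h => by
  have ht : 0 ≤ β / 2 := by positivity
  simp only [heightCov_eq hβ]
  rw [← av_latNet ht (faces_mono h)]
  exact Net.av_heightProd_mono ht (faces_mono h) (tame_latNet ht (faces_mono h))
    (tame_latNet ht subset_rfl) a b

theorem sigCov_nonneg (hβ : 0 ≤ β) (n : ℕ) (a b : V) : 0 ≤ sigCov n β a b := by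
  have ht : 0 ≤ β / 2 := by positivity
  rw [sigCov_eq hβ]
  exact Net.av_signProd_nonneg ht (tame_faces ht n) a b

theorem sigCov_le_heightCov (hβ : 0 ≤ β) (n : ℕ) (a b : V) :
    sigCov n β a b ≤ heightCov n β a b := by
  have ht : 0 ≤ β / 2 := by positivity
  rw [sigCov_eq hβ, heightCov_eq hβ]
  exact Net.av_signProd_le_heightProd ht (tame_faces ht n) a b

theorem sigCov_mul_le (hβ : 0 ≤ β) (n : ℕ) (a b c : V) :
    sigCov n β a b * sigCov n β b c ≤ sigCov n β a c := by
  have ht : 0 ≤ β / 2 := by positivity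
  rw [sigCov_eq hβ, sigCov_eq hβ, sigCov_eq hβ]
  exact Net.av_signProd_mul_le ht (tame_faces ht n) a b c

theorem sigCov_comm (n : ℕ) (β : ℝ) (a b : V) : sigCov n β a b = sigCov n β b a := by
  unfold sigCov
  simp only [mul_comm]

end LatticeAverages

/-! ### Symmetries of the lattice -/

section Symmetry

variable {β t : ℝ}

theorem limWeight_latNet_map (t : ℝ) (D : Finset V) (τ : V ≃ V)
    (hτ : ∀ a b, τ b ∈ nbrs (τ a) ↔ b ∈ nbrs a) (h : V → ℤ) :
    (latNet (D.map τ.toEmbedding)).limWeight t (fun x => h (τ.symm x)) =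
      (latNet D).limWeight t h := by
  rw [limWeight_latNet, limWeight_latNet]
  refine Finset.prod_nbij' (Sym2.map τ.symm) (Sym2.map τ) ?_ ?_ ?_ ?_ ?_
  · intro e he
    induction e using Sym2.ind with
    | _ a b =>
    rw [mk_mem_latEdges, Finset.mem_map_equiv, Finset.mem_map_equiv] at he
    rw [Sym2.map_mk, mk_mem_latEdges, ← hτ]
    simpa using he
  · intro e he
    induction e using Sym2.ind with
    | _ a b =>
    rw [mk_mem_latEdges] at he
    rw [Sym2.map_mk, mk_mem_latEdges, hτ, Finset.mem_map_equiv, Finset.mem_map_equiv]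
    simpa using he
  · intro e _
    induction e using Sym2.ind with
    | _ a b => simp
  · intro e _
    induction e using Sym2.ind with
    | _ a b => simp
  · intro e _
    induction e using Sym2.ind with
    | _ a b =>
    rw [Sym2.map_mk, edgeWeight_out, edgeWeight_out t (fun x => h (τ.symm x))]

theorem limPart_latNet_map (t : ℝ) (D : Finset V) (τ : V ≃ V)
    (hτ : ∀ a b, τ b ∈ nbrs (τ a) ↔ b ∈ nbrs a) (f : (V → ℤ) → ℝ) :
    (latNet (D.map τ.toEmbedding)).limPart t (D.map τ.toEmbedding) f =
      (latNet D).limPart t D fun h => f fun x => h (τ.symm x) := by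
  rw [Net.limPart, Net.limPart, ← (Equiv.arrowCongr τ (Equiv.refl ℤ)).tsum_eq]
  refine tsum_congr fun h => ?_
  have e : Equiv.arrowCongr τ (Equiv.refl ℤ) h = fun x => h (τ.symm x) := rfl
  rw [e]
  unfold Net.limTerm
  rw [limWeight_latNet_map t D τ hτ]
  congr 1
  rw [eq_iff_iff]
  constructor
  · intro h1 x hx
    have := h1 (τ x) (by rwa [Finset.mem_map_equiv, τ.symm_apply_apply])
    simpa only [τ.symm_apply_apply] using this
  · intro h1 x hx
    exact h1 _ (by rwa [Finset.mem_map_equiv] at hx)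

theorem av_latNet_map (t : ℝ) (D : Finset V) (τ : V ≃ V)
    (hτ : ∀ a b, τ b ∈ nbrs (τ a) ↔ b ∈ nbrs a) (a b : V) :
    (latNet (D.map τ.toEmbedding)).av t (D.map τ.toEmbedding) (signProd (τ a) (τ b)) =
      (latNet D).av t D (signProd a b) := by
  rw [Net.av, Net.av, limPart_latNet_map t D τ hτ, limPart_latNet_map t D τ hτ]
  simp only [signProd, τ.symm_apply_apply]
  rfl

/-- The infinite-volume sign covariance as a real number. -/
noncomputable def sigCovSup (β : ℝ) (a b : V) : ℝ := ⨆ n, sigCov n β a b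

theorem bddAbove_sigCov (hβ : 0 ≤ β) (a b : V) : BddAbove (Set.range fun n => sigCov n β a b) :=
  ⟨1, by rintro _ ⟨n, rfl⟩; exact sigCov_le_one hβ n a b⟩

theorem sigCov_le_sup (hβ : 0 ≤ β) (n : ℕ) (a b : V) : sigCov n β a b ≤ sigCovSup β a b :=
  le_ciSup (bddAbove_sigCov hβ a b) n

theorem sigCovSup_nonneg (hβ : 0 ≤ β) (a b : V) : 0 ≤ sigCovSup β a b :=
  (sigCov_nonneg hβ 0 a b).trans (sigCov_le_sup hβ 0 a b)

theorem sigCovSup_le_one (hβ : 0 ≤ β) (a b : V) : sigCovSup β a b ≤ 1 :=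
  ciSup_le fun n => sigCov_le_one hβ n a b

theorem tendsto_sigCov (hβ : 0 ≤ β) (a b : V) :
    Tendsto (fun n => sigCov n β a b) atTop (𝓝 (sigCovSup β a b)) :=
  tendsto_atTop_ciSup (sigCov_mono hβ a b) (bddAbove_sigCov hβ a b)

theorem sigCovSup_mul_le (hβ : 0 ≤ β) (a b c : V) :
    sigCovSup β a b * sigCovSup β b c ≤ sigCovSup β a c :=
  le_of_tendsto_of_tendsto' ((tendsto_sigCov hβ a b).mul (tendsto_sigCov hβ b c))
    (tendsto_sigCov hβ a c) fun n => sigCov_mul_le hβ n a b c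

theorem sigCovSup_comm (β : ℝ) (a b : V) : sigCovSup β a b = sigCovSup β b a := by
  simp only [sigCovSup, sigCov_comm _ β a b]

/-- A symmetry need not preserve the boxes, but the image of a box lies in a larger box, and
monotonicity in the domain does the rest. -/
theorem sigCovSup_le_map (hβ : 0 ≤ β) (τ : V ≃ V)
    (hτ : ∀ a b, τ b ∈ nbrs (τ a) ↔ b ∈ nbrs a) (a b : V) :
    sigCovSup β a b ≤ sigCovSup β (τ a) (τ b) := by
  refine ciSup_le fun n => ?_
  obtain ⟨m, hm⟩ := exists_subset_faces ((faces n).map τ.toEmbedding)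
  refine le_trans ?_ (sigCov_le_sup hβ m (τ a) (τ b))
  rw [sigCov_eq hβ, sigCov_eq hβ, ← av_latNet_map _ _ τ hτ]
  exact av_latNet_signProd_mono (by positivity) hm _ _

/-- The reflection that exchanges the heights `0` and `k`. -/
def reflect (k : ℤ) : V ≃ V where
  toFun x := (x.1, k - x.2)
  invFun x := (x.1, k - x.2)
  left_inv x := by simp
  right_inv x := by simp

theorem reflect_mem_nbrs (k : ℤ) (a b : V) : reflect k b ∈ nbrs (reflect k a) ↔ b ∈ nbrs a := by
  simp only [reflect, Equiv.coe_fn_mk, mem_nbrs, Prod.ext_iff]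
  omega

theorem swap_mem_nbrs (a b : V) :
    Equiv.prodComm ℤ ℤ b ∈ nbrs (Equiv.prodComm ℤ ℤ a) ↔ b ∈ nbrs a := by
  simp only [Equiv.prodComm_apply, mem_nbrs, Prod.ext_iff, Prod.fst_swap, Prod.snd_swap]
  omega

/-- The reflection `reflect (2 * k)` fixes (j, k) and sends the origin to (0, 2k), so the two halves
of the route through (j, k) are equally likely. -/
theorem sigCovSup_sq_le (hβ : 0 ≤ β) (j k : ℤ) :
    sigCovSup β (0, 0) (j, k) ^ 2 ≤ sigCovSup β (0, 0) (0, 2 * k) := by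
  have h1 := sigCovSup_le_map hβ (reflect (2 * k)) (reflect_mem_nbrs _) (0, 0) (j, k)
  have e1 : reflect (2 * k) (0, 0) = (0, 2 * k) := by simp [reflect]
  have e2 : reflect (2 * k) (j, k) = (j, k) := by simp [reflect]; ring
  rw [e1, e2, sigCovSup_comm β (0, 2 * k)] at h1
  have h0 := sigCovSup_nonneg hβ (0, 0) (j, k)
  calc _ = sigCovSup β (0, 0) (j, k) * sigCovSup β (0, 0) (j, k) := sq _
    _ ≤ sigCovSup β (0, 0) (j, k) * sigCovSup β (j, k) (0, 2 * k) :=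
        mul_le_mul_of_nonneg_left h1 h0
    _ ≤ _ := sigCovSup_mul_le hβ _ _ _

/-- The sign covariance with a face at distance `r` from the origin. -/
theorem sigCovSup_sq_le_of_natAbs_eq (hβ : 0 ≤ β) (x : V) (r : ℕ)
    (hx : x.1.natAbs = r ∨ x.2.natAbs = r) :
    sigCovSup β (0, 0) x ^ 2 ≤ sigCovSup β (0, 0) (0, ((2 * r : ℕ) : ℤ)) := by
  have key : ∀ j k : ℤ, k.natAbs = r →
      sigCovSup β (0, 0) (j, k) ^ 2 ≤ sigCovSup β (0, 0) (0, ((2 * r : ℕ) : ℤ)) := by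
    intro j k hk
    have h0 := sigCovSup_nonneg hβ (0, 0) (j, k)
    rcases Int.natAbs_eq k with h | h
    · have h1 := sigCovSup_sq_le hβ j k
      rw [h, hk] at h1 ⊢
      push_cast
      exact h1
    · have h1 := sigCovSup_le_map hβ (reflect 0) (reflect_mem_nbrs _) (0, 0) (j, k)
      have e1 : reflect 0 (0, 0) = (0, 0) := by simp [reflect]
      have e2 : reflect 0 (j, k) = (j, -k) := by simp [reflect]
      rw [e1, e2] at h1
      have h2 := sigCovSup_sq_le hβ j (-k)
      have h3 : -k = r := by omega
      rw [h3] at h1 h2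
      push_cast
      exact (pow_le_pow_left₀ h0 h1 2).trans h2
  obtain ⟨j, k⟩ := x
  rcases hx with hx | hx
  · have h1 := sigCovSup_le_map hβ (Equiv.prodComm ℤ ℤ) swap_mem_nbrs (0, 0) (j, k)
    exact (pow_le_pow_left₀ (sigCovSup_nonneg hβ _ _) h1 2).trans (key k j hx)
  · exact key j k hx

end Symmetry

/-! ### Exponential moments of the current -/

section Tail

variable {β t : ℝ}

theorem hasSum_exp_poisson (t : ℝ) (s : ℝ) :
    HasSum (fun k : ℕ => t ^ k / (k.factorial : ℝ) * Real.exp (s * k))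
      (Real.exp (Real.exp s * t)) := by
  have h1 := NormedSpace.expSeries_div_hasSum_exp (Real.exp s * t)
  rw [← Real.exp_eq_exp_ℝ] at h1
  refine h1.congr_fun fun k => ?_
  rw [mul_pow, ← Real.exp_nat_mul, mul_comm (k : ℝ) s]
  ring

theorem integrable_exp_mul_poissonWeight (ht : 0 ≤ t) (s : ℝ) :
    Integrable (fun k : ℕ => Real.exp (s * k)) (poissonWeight t) := by
  unfold poissonWeight
  rw [integrable_withDensity_iff (by fun_prop) (by simp), integrable_count_iff]
  refine (hasSum_exp_poisson t s).summable.norm.congr fun k => ?_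
  rw [ENNReal.toReal_ofReal (by positivity), mul_comm]

theorem integral_exp_mul_poissonWeight (ht : 0 ≤ t) (s : ℝ) :
    ∫ k : ℕ, Real.exp (s * k) ∂(poissonWeight t) = Real.exp (Real.exp s * t) := by
  rw [integral_countable (integrable_exp_mul_poissonWeight ht s)]
  refine Eq.trans (tsum_congr fun k => ?_) (hasSum_exp_poisson t s).tsum_eq
  rw [measureReal_def, poissonWeight_singleton, ENNReal.toReal_ofReal (by positivity), smul_eq_mul]

theorem integrable_exp_sum (ht : 0 ≤ t) (n : ℕ) (s : ℝ) :
    Integrable (fun c : Current n => Real.exp (s * ∑ e, (c e : ℝ))) (currentMeasure n t) := by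
  have h1 : Integrable (fun c : Current n => ∏ e, Real.exp (s * c e)) (currentMeasure n t) :=
    Integrable.fintype_prod (f := fun _ (k : ℕ) => Real.exp (s * k)) fun _ =>
      integrable_exp_mul_poissonWeight ht s
  simpa only [← Real.exp_sum, ← Finset.mul_sum] using h1

theorem integral_exp_sum (ht : 0 ≤ t) (n : ℕ) (s : ℝ) :
    ∫ c : Current n, Real.exp (s * ∑ e, (c e : ℝ)) ∂(currentMeasure n t) =
      Real.exp (Real.exp s * t * (dirEdges n).card) := by
  have h1 := integral_fintype_prod_eq_prod (μ := fun _ : {e : V × V // e ∈ dirEdges n} =>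
    poissonWeight t) (fun _ (k : ℕ) => Real.exp (s * k))
  simp only [integral_exp_mul_poissonWeight ht, Finset.prod_const, Finset.card_univ,
    Fintype.card_coe, ← Real.exp_sum, ← Finset.mul_sum, ← Real.exp_nat_mul] at h1
  rw [mul_comm (Real.exp s * t)]
  exact h1

/-- The zero current alone has mass 1, so the normalising constant is at least 1 and the
conditioning can be dropped in upper bounds. -/
theorem currentLaw_le (hβ : 0 ≤ β) (n : ℕ) : currentLaw n β ≤ currentMeasure n (β / 2) := by
  have hz : (fun _ => 0 : Current n) ∈ sourceless n := by
    intro x _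
    simp [Current.source, Current.net, Current.val]
  have h1 : 1 ≤ currentMeasure n (β / 2) (sourceless n) := by
    refine le_trans ?_ (measure_mono (Set.singleton_subset_iff.2 hz))
    rw [currentMeasure_singleton n (by positivity)]
    simp
  rw [currentLaw, ProbabilityTheory.cond]
  refine le_trans ?_ (Measure.restrict_le_self (s := sourceless n))
  intro A
  rw [Measure.smul_apply, smul_eq_mul]
  exact mul_le_of_le_one_left zero_le (ENNReal.inv_le_one.2 h1)

theorem card_box (n : ℕ) : (box n).card = (2 * n + 1) ^ 2 := by
  rw [box, Finset.card_Icc_prod, Int.card_Icc, sq]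
  congr 1 <;> simp only <;> omega

theorem card_dirEdges_le (n : ℕ) : (dirEdges n).card ≤ (2 * n + 1) ^ 4 := by
  refine (Finset.card_filter_le _ _).trans ?_
  rw [Finset.card_product, card_box]
  exact le_of_eq (by ring)

/-- Above the vertical axis a height is a sum of n + 1 net currents, hence at most (n + 1)S with S
the total current. A height beyond R forces S > ρ, and then S² ≤ 2 exp(S) ≤ 2 exp(-ρ + 2S). -/
theorem tailProd_height_le {n : ℕ} (c : Current n) {a b : V} (ha : a.1 = 0) (hb : b.1 = 0)
    {R ρ : ℝ} (hR : (n + 1) * ρ ≤ R) :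
    tailProd R a b (height c) ≤
      2 * (n + 1) ^ 2 * Real.exp (-ρ) * Real.exp (2 * ∑ e, (c e : ℝ)) := by
  have hκ : ((Finset.Icc (-(n : ℤ)) 0).card : ℝ) = n + 1 := by
    rw [Int.card_Icc, show (0 + 1 - -(n : ℤ)).toNat = n + 1 by omega]
    push_cast; ring
  have h1 := abs_height_le c a
  have h2 := abs_height_le c b
  rw [ha, hκ] at h1
  rw [hb, hκ] at h2
  set S : ℝ := ∑ e, (c e : ℝ)
  have hS : 0 ≤ S := Finset.sum_nonneg fun _ _ => Nat.cast_nonneg _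
  have hn : (0 : ℝ) < n + 1 := by positivity
  unfold tailProd
  split_ifs with h
  · positivity
  · have hρ : ρ < S := by
      rw [not_and_or, not_le, not_le] at h
      have : (n + 1) * ρ < (n + 1) * S := by
        rcases h with h | h <;> linarith
      exact lt_of_mul_lt_mul_left this hn.le
    have hq : S * S ≤ 2 * Real.exp S := by nlinarith [Real.quadratic_le_exp_of_nonneg hS]
    calc _ ≤ ((n + 1) * S) * ((n + 1) * S) :=
          mul_le_mul h1 h2 (abs_nonneg _) (by positivity)
      _ = (n + 1) ^ 2 * (S * S) := by ring
      _ ≤ (n + 1) ^ 2 * (2 * Real.exp S) := by gcongr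
      _ ≤ (n + 1) ^ 2 * (2 * Real.exp (-ρ + 2 * S)) := by gcongr; linarith
      _ = _ := by rw [Real.exp_add]; ring

theorem integrable_tailProd (hβ : 0 ≤ β) (n : ℕ) (R : ℝ) (a b : V) :
    Integrable (fun c => tailProd R a b (height c)) (currentLaw n β) := by
  refine (integrable_height_mul_height n hβ a b).mono
    (Measurable.of_discrete).aestronglyMeasurable (ae_of_all _ fun c => ?_)
  unfold tailProd
  split_ifs
  · rw [norm_zero]; exact norm_nonneg _
  · simp

/-- Large heights are rare. -/
theorem av_tailProd_le (hβ : 0 ≤ β) (n : ℕ) {a b : V} (ha : a.1 = 0) (hb : b.1 = 0)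
    {R s : ℝ} (hR : (n + 1) * (Real.exp 2 * (β / 2) * (2 * n + 1) ^ 4 + s) ≤ R) :
    (latNet (faces n)).av (β / 2) (faces n) (tailProd R a b) ≤
      2 * (n + 1) ^ 2 * Real.exp (-s) := by
  have ht : 0 ≤ β / 2 := by positivity
  -- The first summand of ρ cancels the exponential moment exp(e² (β/2) |edges|) of 2S, with the
  -- crude count (2n + 1)⁴ of edges; the factor exp(-s) is left.
  have hE := (integrable_exp_sum ht n 2).const_mul
    (2 * (n + 1) ^ 2 * Real.exp (-(Real.exp 2 * (β / 2) * (2 * n + 1) ^ 4 + s)))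
  rw [← integral_currentLaw hβ n (f := tailProd R a b) (integrable_tailProd hβ n R a b)]
  calc _ ≤ ∫ c : Current n, 2 * (n + 1) ^ 2 *
          Real.exp (-(Real.exp 2 * (β / 2) * (2 * n + 1) ^ 4 + s)) *
          Real.exp (2 * ∑ e, (c e : ℝ)) ∂(currentLaw n β) :=
        integral_mono (integrable_tailProd hβ n R a b) (hE.mono_measure (currentLaw_le hβ n))
          fun c => tailProd_height_le c ha hb hR
    _ ≤ ∫ c : Current n, 2 * (n + 1) ^ 2 *
          Real.exp (-(Real.exp 2 * (β / 2) * (2 * n + 1) ^ 4 + s)) *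
          Real.exp (2 * ∑ e, (c e : ℝ)) ∂(currentMeasure n (β / 2)) :=
        integral_mono_measure (currentLaw_le hβ n) (ae_of_all _ fun c => by positivity) hE
    _ = 2 * (n + 1) ^ 2 * (Real.exp (-(Real.exp 2 * (β / 2) * (2 * n + 1) ^ 4 + s)) *
          Real.exp (Real.exp 2 * (β / 2) * (dirEdges n).card)) := by
        rw [integral_const_mul, integral_exp_sum ht]; ring
    _ ≤ _ := by
        rw [← Real.exp_add]
        have h1 : ((dirEdges n).card : ℝ) ≤ (2 * n + 1) ^ 4 := by exact_mod_cast card_dirEdges_le n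
        have h2 : Real.exp 2 * (β / 2) * (dirEdges n).card ≤
            Real.exp 2 * (β / 2) * (2 * n + 1) ^ 4 := by gcongr
        gcongr
        linarith

end Tail

/-! ### Exponential decay of the height covariance -/

section Decay

variable {β : ℝ}

theorem summable_pow_mul_exp {δ : ℝ} (hδ : 0 < δ) (m : ℕ) :
    Summable fun j : ℕ => ((2 * j + 4 : ℕ) : ℝ) ^ m * Real.exp (-δ * j) := by
  have h1 := ((summable_nat_add_iff 2).2 (Real.summable_pow_mul_exp_neg_nat_mul m hδ)).mul_left
    (2 ^ m * Real.exp (2 * δ))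
  refine h1.congr fun j => ?_
  have e : Real.exp (-δ * j) = Real.exp (2 * δ) * Real.exp (-δ * (j + 2 : ℕ)) := by
    rw [← Real.exp_add]; congr 1; push_cast; ring
  rw [e, show ((2 * j + 4 : ℕ) : ℝ) = 2 * (j + 2 : ℕ) by push_cast; ring, mul_pow]
  ring

/-- Off the box some coordinate has absolute value r ≥ j. Its squared sign covariance is bounded on
the axis at distance 2r, so the square root restores the rate c without loss. -/
theorem sigCovSup_le_of_notMem_faces (hβ : 0 ≤ β) {c : ℝ} (hc : 0 ≤ c) {K : ℕ}
    (hK : ∀ k : ℕ, K ≤ k → sigCovSup β (0, 0) (0, (k : ℤ)) ≤ Real.exp (-c * k)) {j : ℕ}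
    (hj : K ≤ 2 * j) {x : V} (hx : x ∉ faces j) :
    sigCovSup β (0, 0) x ≤ Real.exp (-c * j) := by
  obtain ⟨r, hr, hxr⟩ : ∃ r, j ≤ r ∧ (x.1.natAbs = r ∨ x.2.natAbs = r) := by
    rw [mem_faces] at hx
    by_cases h : j ≤ x.1.natAbs
    · exact ⟨_, h, Or.inl rfl⟩
    · exact ⟨x.2.natAbs, by omega, Or.inr rfl⟩
  have h1 := (sigCovSup_sq_le_of_natAbs_eq hβ x r hxr).trans (hK (2 * r) (by omega))
  have h2 : Real.exp (-c * (2 * r : ℕ)) = Real.exp (-c * r) ^ 2 := by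
    rw [← Real.exp_nat_mul]; congr 1; push_cast; ring
  rw [h2] at h1
  refine (le_of_sq_le_sq h1 (Real.exp_pos _).le).trans (Real.exp_le_exp.2 ?_)
  have : (j : ℝ) ≤ r := by exact_mod_cast hr
  nlinarith

theorem card_faces (n : ℕ) : (faces n).card = (2 * n) ^ 2 := by
  rw [faces, Finset.card_Icc_prod, Int.card_Icc, sq]
  congr 1 <;> simp only <;> omega

/-- Scale j contributes at most a polynomial times exp(-cj). Giving up c - c' of the rate makes the
sum over scales converge, and j ≥ k leaves exp(-c'k), uniformly in the box. -/
theorem heightCov_le_exp (hβ : 0 ≤ β) {c c' : ℝ} (hc' : 0 ≤ c') (hc : c' < c) {K : ℕ}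
    (hK : ∀ k : ℕ, K ≤ k → sigCovSup β (0, 0) (0, (k : ℤ)) ≤ Real.exp (-c * k)) :
    ∃ B : ℝ, 0 < B ∧ ∀ k : ℕ, K ≤ 2 * k → ∀ n,
      heightCov n β (0, 0) (0, (k : ℤ)) ≤ B * Real.exp (-c' * k) := by
  have ht : 0 ≤ β / 2 := by positivity
  have hc0 : 0 ≤ c := by linarith
  set A : ℝ := Real.exp 2 * (β / 2) + c with hA
  have hA0 : 0 ≤ A := by positivity
  have hs := (summable_pow_mul_exp (sub_pos.2 hc) 12).mul_left (A ^ 2 + 2)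
  set T : ℝ := ∑' j : ℕ, (A ^ 2 + 2) * (((2 * j + 4 : ℕ) : ℝ) ^ 12 * Real.exp (-(c - c') * j))
  have hT : 0 ≤ T := tsum_nonneg fun j => by positivity
  -- The added 1 makes the constant strictly positive, so that its logarithm can be absorbed later.
  refine ⟨T + 1, by positivity, fun k hk n => ?_⟩
  have hb : ((0 : ℤ), (k : ℤ)) ∉ faces k := by rw [mem_faces]; simp
  -- With q = 2j + 4, the truncation A q⁵ dominates the threshold of `av_tailProd_le` in the box j +
  -- 1 with s = cj. Its square gives q¹⁰, and the at most q² faces of the shell raise this to q¹².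
  have h1 := Net.av_heightProd_le_sum (G := latNet (faces n)) ht faces_mono (n := n)
    (fun j hj => tame_latNet ht (faces_mono hj)) (0, 0) (0, (k : ℤ)) hb
    (fun j => A * ((2 * j + 4 : ℕ) : ℝ) ^ 5)
  rw [← heightCov_eq hβ] at h1
  have key : ∀ j ∈ Finset.Ico k n, ∀ x ∈ faces (j + 1) \ faces j,
      (A * ((2 * j + 4 : ℕ) : ℝ) ^ 5) ^ 2 *
          (latNet (faces n)).av (β / 2) (faces (j + 1)) (signProd (0, 0) x) +
        (latNet (faces n)).av (β / 2) (faces (j + 1))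
          (tailProd (A * ((2 * j + 4 : ℕ) : ℝ) ^ 5) (0, 0) (0, (k : ℤ))) ≤
      (A ^ 2 + 2) * ((2 * j + 4 : ℕ) : ℝ) ^ 10 * Real.exp (-c * j) := by
    intro j hj x hx
    rw [Finset.mem_Ico] at hj
    have hjn : faces (j + 1) ⊆ faces n := faces_mono (by omega)
    rw [av_latNet ht hjn, av_latNet ht hjn, ← sigCov_eq hβ]
    set q : ℝ := ((2 * j + 4 : ℕ) : ℝ) with hq
    have hq' : q = 2 * j + 4 := by rw [hq]; push_cast; ring
    have hj0 : (0 : ℝ) ≤ j := Nat.cast_nonneg _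
    have hq1 : 1 ≤ q := by linarith
    have hsig : sigCov (j + 1) β (0, 0) x ≤ Real.exp (-c * j) :=
      (sigCov_le_sup hβ _ _ _).trans
        (sigCovSup_le_of_notMem_faces hβ hc0 hK (by omega) (Finset.mem_sdiff.1 hx).2)
    have htail := av_tailProd_le hβ (j + 1) (a := (0, 0)) (b := (0, (k : ℤ))) rfl rfl
      (R := A * q ^ 5) (s := c * j) (by
        have e1 : ((j + 1 : ℕ) : ℝ) + 1 ≤ q := by rw [hq']; push_cast; linarith
        have e2 : 2 * ((j + 1 : ℕ) : ℝ) + 1 ≤ q := by rw [hq']; push_cast; linarith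
        have e3 : (j : ℝ) ≤ q ^ 4 :=
          le_trans (by linarith) (le_self_pow₀ hq1 (by norm_num : 4 ≠ 0))
        calc _ ≤ q * (Real.exp 2 * (β / 2) * q ^ 4 + c * q ^ 4) := by gcongr
          _ = _ := by rw [hA]; ring)
    have e4 : 2 * (((j + 1 : ℕ) : ℝ) + 1) ^ 2 ≤ 2 * q ^ 10 := by
      have e1 : ((j + 1 : ℕ) : ℝ) + 1 ≤ q := by rw [hq']; push_cast; linarith
      calc _ ≤ 2 * q ^ 2 := by gcongr
        _ ≤ _ := by gcongr; norm_num
    calc _ ≤ (A * q ^ 5) ^ 2 * Real.exp (-c * j) +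
          2 * (((j + 1 : ℕ) : ℝ) + 1) ^ 2 * Real.exp (-(c * j)) := by gcongr
      _ ≤ (A * q ^ 5) ^ 2 * Real.exp (-c * j) + 2 * q ^ 10 * Real.exp (-(c * j)) := by gcongr
      _ = _ := by rw [← neg_mul]; ring
  have hcard : ∀ j : ℕ, ((faces (j + 1) \ faces j).card : ℝ) ≤ ((2 * j + 4 : ℕ) : ℝ) ^ 2 := by
    intro j
    have := (Finset.card_le_card (Finset.sdiff_subset (s := faces (j + 1)) (t := faces j))).trans
      (card_faces (j + 1)).le
    calc _ ≤ (((2 * (j + 1)) ^ 2 : ℕ) : ℝ) := by exact_mod_cast this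
      _ ≤ _ := by push_cast; gcongr; linarith
  refine h1.trans ?_
  calc _ ≤ ∑ j ∈ Finset.Ico k n, ∑ x ∈ faces (j + 1) \ faces j,
          (A ^ 2 + 2) * ((2 * j + 4 : ℕ) : ℝ) ^ 10 * Real.exp (-c * j) :=
        Finset.sum_le_sum fun j hj => Finset.sum_le_sum fun x hx => key j hj x hx
    _ ≤ ∑ j ∈ Finset.Ico k n, (A ^ 2 + 2) *
          (((2 * j + 4 : ℕ) : ℝ) ^ 12 * Real.exp (-(c - c') * j)) * Real.exp (-c' * k) := by
        refine Finset.sum_le_sum fun j hj => ?_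
        have hkj : (k : ℝ) ≤ j := by exact_mod_cast (Finset.mem_Ico.1 hj).1
        rw [Finset.sum_const, nsmul_eq_mul]
        have e1 : Real.exp (-c * j) ≤ Real.exp (-(c - c') * j) * Real.exp (-c' * k) := by
          rw [← Real.exp_add]
          exact Real.exp_le_exp.2 (by nlinarith)
        calc _ ≤ ((2 * j + 4 : ℕ) : ℝ) ^ 2 * ((A ^ 2 + 2) * ((2 * j + 4 : ℕ) : ℝ) ^ 10 *
              (Real.exp (-(c - c') * j) * Real.exp (-c' * k))) := by
              gcongr
              exact hcard j
          _ = _ := by ring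
    _ = (∑ j ∈ Finset.Ico k n, (A ^ 2 + 2) *
          (((2 * j + 4 : ℕ) : ℝ) ^ 12 * Real.exp (-(c - c') * j))) * Real.exp (-c' * k) := by
        rw [Finset.sum_mul]
    _ ≤ T * Real.exp (-c' * k) := by
        gcongr
        exact hs.sum_le_tsum _ fun j _ => by positivity
    _ ≤ _ := by gcongr; linarith

end Decay

/-! ### Infinite volume -/

section InfiniteVolume

variable {β : ℝ}

/-- An increasing sequence in `ENNReal` converges, possibly to infinity; no bound on the height
variance is needed. -/
theorem tendsto_heightCovLim (hβ : 0 ≤ β) (a b : V) :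
    Tendsto (fun n : ℕ => ENNReal.ofReal (heightCov n β a b)) atTop (𝓝 (heightCovLim β a b)) :=
  tendsto_nhds_limUnder ⟨_, tendsto_atTop_iSup fun _ _ h =>
    ENNReal.ofReal_le_ofReal (heightCov_mono hβ a b h)⟩

theorem sigCovLim_eq (hβ : 0 ≤ β) (a b : V) :
    sigCovLim β a b = ENNReal.ofReal (sigCovSup β a b) :=
  (ENNReal.tendsto_ofReal (tendsto_sigCov hβ a b)).limUnder_eq

theorem tendsto_coe_ereal {u : ℕ → ℝ} (hu : ∀ n, 0 ≤ u n) {x : ENNReal}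
    (h : Tendsto (fun n => ENNReal.ofReal (u n)) atTop (𝓝 x)) :
    Tendsto (fun n => (u n : EReal)) atTop (𝓝 (x : EReal)) := by
  refine ((continuous_coe_ennreal_ereal.tendsto x).comp h).congr fun n => ?_
  rw [Function.comp_apply, EReal.coe_ennreal_ofReal, max_eq_left (hu n)]

theorem sigCovLim_le (hβ : 0 ≤ β) (a b : V) :
    sigCovLim β a b ≤ min (heightCovLim β a b) 1 := by
  refine le_min ?_ ?_
  · rw [sigCovLim_eq hβ]
    exact le_of_tendsto_of_tendsto' (ENNReal.tendsto_ofReal (tendsto_sigCov hβ a b))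
      (tendsto_heightCovLim hβ a b) fun n =>
      ENNReal.ofReal_le_ofReal (sigCov_le_heightCov hβ n a b)
  · rw [sigCovLim_eq hβ, ← ENNReal.ofReal_one]
    exact ENNReal.ofReal_le_ofReal (sigCovSup_le_one hβ a b)

/-- Lower bounds on an exponential rate. -/
theorem coe_le_rate_iff {k : ℕ} (hk : 0 < k) (c : ℝ) (x : ENNReal) :
    (c : EReal) ≤ -(1 / (k : EReal)) * ENNReal.log x ↔ x ≤ ENNReal.ofReal (Real.exp (-c * k)) := by
  have hk' : (0 : ℝ) < k := by exact_mod_cast hk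
  have e1 : -(1 / (k : EReal)) = ((-(1 / k : ℝ) : ℝ) : EReal) := by
    rw [EReal.coe_neg, EReal.coe_div]
    rfl
  have h1 : -(1 / k : ℝ) < 0 := by
    have := one_div_pos.2 hk'
    linarith
  rw [e1, ← EReal.exp_coe, ← ENNReal.log_le_log_iff, EReal.log_exp]
  generalize ENNReal.log x = L
  induction L using EReal.rec with
  | bot =>
    rw [EReal.coe_mul_bot_of_neg h1]
    exact iff_of_true le_top bot_le
  | top =>
    rw [EReal.coe_mul_top_of_neg h1]
    exact iff_of_false (fun h => EReal.coe_ne_bot c (le_bot_iff.1 h))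
      fun h => EReal.coe_ne_top _ (top_le_iff.1 h)
  | coe r =>
    rw [← EReal.coe_mul, EReal.coe_le_coe_iff, EReal.coe_le_coe_iff,
      show -(1 / k : ℝ) * r = -r / k by ring, le_div_iff₀ hk']
    constructor <;> intro h <;> linarith

/-- The sign covariance is at most the truncated height covariance, and the rate is decreasing in
its argument; the comparison is made through real lower bounds z. -/
theorem massHeight_le (hβ : 0 ≤ β) :
    massHeight β ≤ liminf (fun k : ℕ =>
      -(1 / (k : EReal)) * ENNReal.log (sigCovLim β (0, 0) (0, k))) atTop := by
  refine liminf_le_liminf ?_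
  filter_upwards [eventually_gt_atTop 0] with k hk
  refine EReal.ge_of_forall_gt_iff_ge.1 fun z hz => ?_
  rw [coe_le_rate_iff hk]
  exact (sigCovLim_le hβ _ _).trans ((coe_le_rate_iff hk z _).1 hz.le)

theorem le_massHeight (hβ : 0 ≤ β) :
    liminf (fun k : ℕ => -(1 / (k : EReal)) * ENNReal.log (sigCovLim β (0, 0) (0, k))) atTop ≤
      massHeight β := by
  refine EReal.ge_of_forall_gt_iff_ge.1 fun z hz => ?_
  refine le_liminf_of_le (by isBoundedDefault) ?_
  rcases le_or_gt z 0 with hz0 | hz0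
  -- For z ≤ 0 the truncation at 1 alone gives the bound.
  · filter_upwards [eventually_gt_atTop 0] with k hk
    rw [coe_le_rate_iff hk]
    refine (min_le_right _ _).trans ?_
    rw [← ENNReal.ofReal_one]
    refine ENNReal.ofReal_le_ofReal (Real.one_le_exp ?_)
    exact mul_nonneg (neg_nonneg.2 hz0) (Nat.cast_nonneg _)
  · obtain ⟨c, hzc, hc⟩ := EReal.lt_iff_exists_real_btwn.1 hz
    rw [EReal.coe_lt_coe_iff] at hzc
    obtain ⟨K, hK⟩ := eventually_atTop.1
      ((eventually_lt_of_lt_liminf hc).and (eventually_gt_atTop 0))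
    have hdecay : ∀ k : ℕ, K ≤ k → sigCovSup β (0, 0) (0, (k : ℤ)) ≤ Real.exp (-c * k) := by
      intro k hk
      obtain ⟨h1, h2⟩ := hK k hk
      have h3 := (coe_le_rate_iff h2 c _).1 h1.le
      rw [sigCovLim_eq hβ] at h3
      exact (ENNReal.ofReal_le_ofReal_iff (Real.exp_pos _).le).1 h3
    -- Decay at the midpoint of z and c leaves a margin (c - z)/2 in the rate, which absorbs log B
    -- for large k.
    obtain ⟨B, hB, hcov⟩ := heightCov_le_exp hβ (c' := (z + c) / 2) (by linarith) (by linarith)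
      hdecay
    have hδ : 0 < (c - z) / 2 := by linarith
    filter_upwards [eventually_gt_atTop 0, eventually_ge_atTop K,
      (tendsto_natCast_atTop_atTop.const_mul_atTop hδ).eventually_ge_atTop (Real.log B)]
      with k hk hkK hkB
    rw [coe_le_rate_iff hk]
    refine (min_le_left _ _).trans (le_of_tendsto' (tendsto_heightCovLim hβ _ _) fun n =>
      ENNReal.ofReal_le_ofReal ((hcov k (by omega) n).trans ?_))
    rw [← Real.exp_log hB, ← Real.exp_add]
    exact Real.exp_le_exp.2 (by linarith)

end InfiniteVolume

end XYHeight

theorem mainTheorem4 (β : ℝ) (hβ : 0 ≤ β) :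
    (∀ a b : XYHeight.V,
      Tendsto (fun n : ℕ => (XYHeight.heightCov n β a b : EReal)) atTop
        (𝓝 (XYHeight.heightCovLim β a b : EReal))) ∧
    (∀ a b : XYHeight.V,
      Tendsto (fun n : ℕ => (XYHeight.sigCov n β a b : EReal)) atTop
        (𝓝 (XYHeight.sigCovLim β a b : EReal))) ∧
    XYHeight.massHeight β =
      liminf (fun k : ℕ =>
        -(1 / (k : EReal)) * ENNReal.log (XYHeight.sigCovLim β (0, 0) (0, k))) atTop := by
  refine ⟨fun a b => ?_, fun a b => ?_, ?_⟩
  · exact XYHeight.tendsto_coe_ereal (fun n => (XYHeight.sigCov_nonneg hβ n a b).trans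
      (XYHeight.sigCov_le_heightCov hβ n a b)) (XYHeight.tendsto_heightCovLim hβ a b)
  · refine XYHeight.tendsto_coe_ereal (fun n => XYHeight.sigCov_nonneg hβ n a b) ?_
    rw [XYHeight.sigCovLim_eq hβ]
    exact ENNReal.tendsto_ofReal (XYHeight.tendsto_sigCov hβ a b)
  · exact (XYHeight.massHeight_le hβ).antisymm (XYHeight.le_massHeight hβ)
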